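/- Let $U\subseteq\mathbb R^4$ be open with coordinates $(x,y,z,p)$ and let $F=F(x,y,z,p)$ be a $C^\infty$ function on $U$ with $$DF:=F_x+pF_z\equiv 0,\qquad F_{pp}\neq 0 \text{ everywhere on } U$$ (the right-hand side of a PDE $z_y=F(x,y,z,z_x)$). Put $\Delta:=\partial_y+F\partial_z$; below, $\Delta F_{p\cdots p}$ means $\Delta$ applied to $F_{p\cdots p}$. On $P_7:=U\times\mathbb R^*\times\mathbb R^*\times\mathbb R\ni(x,y,z,p,u_3,u_5,u_8)$ set $$\omega^1=dz-p\,dx-F\,dy,\quad \omega^3=dx+F_p\,dy-\tfrac13\tfrac{F_{ppp}}{F_{pp}}\omega^1,\quad \omega^4=F_{pp}\,dy+\tfrac{4F_{ppp}^2-3F_{pp}F_{pppp}}{18F_{pp}^2}\,\omega^1,$$ $$\theta^1=u_3u_5\,\omega^1,\quad \theta^3=-u_3u_8\,\omega^1+u_5\,\omega^3,\quad \theta^4=-\tfrac{u_3u_8^2}{2u_5}\,\omega^1+u_8\,\omega^3+\tfrac{u_5}{u_3}\,\omega^4,$$ $$\widetilde g=\theta^3\theta^3+\theta^1\theta^4+\theta^4\theta^1,\qquad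 \Omega_3=r_x\,dx+r_y\,dy+r_z\,dz+\tfrac13\,d\log|u_5^3F_{pp}|,$$ where $$\begin{aligned} 3F_{pp}^4\,r_x={}&\Delta F_{ppp}F_{pp}^2-\Delta F_{pp}F_{pp}F_{ppp}+3F_pF_{pp}^2F_{ppz}-F_{pp}^3F_{pz}-2F_pF_{pp}F_{ppp}F_{pz}\\ &-\Delta F_{pppp}F_{pp}^2p+3\Delta F_{ppp}F_{pp}F_{ppp}p-3\Delta F_{pp}F_{ppp}^2p+\Delta F_{pp}F_{pp}F_{pppp}p\\ &-4F_pF_{pp}^2F_{pppz}p-2F_{pp}^3F_{ppz}p+9F_pF_{pp}F_{ppp}F_{ppz}p+F_{pp}^2F_{ppp}F_{pz}p\\ &-6F_pF_{ppp}^2F_{pz}p+2F_pF_{pp}F_{pppp}F_{pz}p,\\ 3F_{pp}^4\,r_y={}&-\Delta F_{pppp}FF_{pp}^2+\Delta F_{ppp}F_pF_{pp}^2-\Delta F_{pp}F_{pp}^3+3\Delta F_{ppp}FF_{pp}F_{ppp}\\ &-\Delta F_{pp}F_pF_{pp}F_{ppp}-3\Delta F_{pp}FF_{ppp}^2+\Delta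 F_{pp}FF_{pp}F_{pppp}-4FF_pF_{pp}^2F_{pppz}\\ &+3F_p^2F_{pp}^2F_{ppz}-2FF_{pp}^3F_{ppz}+9FF_pF_{pp}F_{ppp}F_{ppz}-3F_pF_{pp}^3F_{pz}\\ &-2F_p^2F_{pp}F_{ppp}F_{pz}+FF_{pp}^2F_{ppp}F_{pz}-6FF_pF_{ppp}^2F_{pz}+2FF_pF_{pp}F_{pppp}F_{pz}+3F_{pp}^4F_z,\\ 3F_{pp}^4\,r_z={}&\Delta F_{pppp}F_{pp}^2-3\Delta F_{ppp}F_{pp}F_{ppp}+3\Delta F_{pp}F_{ppp}^2-\Delta F_{pp}F_{pp}F_{pppp}+4F_pF_{pp}^2F_{pppz}\\ &+2F_{pp}^3F_{ppz}-9F_pF_{pp}F_{ppp}F_{ppz}-F_{pp}^2F_{ppp}F_{pz}+6F_pF_{ppp}^2F_{pz}-2F_pF_{pp}F_{pppp}F_{pz}. \end{aligned}$$ Define $$\mathsf M(F)=9F_{ppppp}F_{pp}^2-45F_{pppp}F_{ppp}F_{pp}+40F_{ppp}^3,$$ $$\begin{aligned} \mathsf K(F)={}&\Delta F_{ppppp}F_{pp}^3-5\Delta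 F_{pppp}F_{pp}^2F_{ppp}+12\Delta F_{ppp}F_{pp}F_{ppp}^2-12\Delta F_{pp}F_{ppp}^3-4\Delta F_{ppp}F_{pp}^2F_{pppp}\\ &+9\Delta F_{pp}F_{pp}F_{ppp}F_{pppp}-\Delta F_{pp}F_{pp}^2F_{ppppp}+5F_pF_{pp}^3F_{ppppz}+6F_{pp}^4F_{pppz}\\ &-20F_pF_{pp}^2F_{ppp}F_{pppz}-12F_{pp}^3F_{ppp}F_{ppz}+36F_pF_{pp}F_{ppp}^2F_{ppz}-12F_pF_{pp}^2F_{pppp}F_{ppz}\\ &+8F_{pp}^2F_{ppp}^2F_{pz}-24F_pF_{ppp}^3F_{pz}-3F_{pp}^3F_{pppp}F_{pz}+18F_pF_{pp}F_{ppp}F_{pppp}F_{pz}-2F_pF_{pp}^2F_{ppppp}F_{pz}. \end{aligned}$$ Let $\mathcal D_4$ be the annihilator of $\theta^1,\theta^3,\theta^4$, and let $\pi\colon P_7\to M_3$ be the projection to the leaf space of $\mathcal D_4$ (two points are on the same leaf when a piecewise $C^1$ path tangent to $\mathcal D_4$ joins them). **Theorem.** 1. One has $$\begin{aligned}\widetilde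 g=\frac{u_5^2}{9F_{pp}^2}\Big\{&\big(3F_{pp}[dx+F_p\,dy]-F_{ppp}[dz-p\,dx-F\,dy]\big)^2\\ &+(dz-p\,dx-F\,dy)\big(18F_{pp}^3\,dy+[4F_{ppp}^2-3F_{pp}F_{pppp}][dz-p\,dx-F\,dy]\big)\Big\}.\end{aligned}$$ This form has signature $(+,+,-,0,0,0,0)$ at every point, its radical is $\mathcal D_4$, and $\mathcal D_4$ is an integrable distribution of rank $4$. The functions $(x,y,z)$ descend to local coordinates on $M_3$: the induced map $M_3\to\mathbb R^3$ is a local homeomorphism. In these coordinates, smooth tensors on $M_3$ are those with coefficients that are constant on the leaves and smooth on $P_7$. 2. The form $\widetilde g$ descends to a Lorentzian conformal class $[g]$ on $M_3$ if and only if $\mathsf M(F)\equiv0$. (Descending means: there is a conformal class consisting exactly of the smooth Lorentzian metrics $g$ on $M_3$ with $\widetilde g=e^{2\varphi}\pi^*g$ for some smooth function $\varphi$ on $P_7$.) When $\mathsf M(F)\equiv0$, near every point of $P_7$ one can write $\widetilde g=e^{2\varphi}\sum_{i,j}g_{ij}(x,y,z)\,dx^i dx^j$ with $(x^1,x^2,x^3)=(x,y,z)$,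 smooth $\varphi$, and smooth coefficients $g_{ij}$ depending only on $(x,y,z)$. 3. The form $\Omega_3$ descends to a $1$-form $A$ on $M_3$, given up to the differential of a function on $M_3$, if and only if $\mathsf K(F)\equiv0$. (That is: there is a class of $1$-forms modulo gradients on $M_3$ consisting exactly of the smooth $1$-forms $A$ with $\Omega_3=\pi^*A+d\varphi$ for some smooth function $\varphi$ on $P_7$.) 4. The pair $(\widetilde g,\Omega_3)$ descends to a Weyl structure $[(g,A)]$ on $M_3$, i.e. to a class modulo $(g,A)\sim(e^{2\psi}g,A+d\psi)$, if and only if both $\mathsf M(F)\equiv0$ and $\mathsf K(F)\equiv0$. (Here the class consists exactly of the pairs $(g,A)$ such that $\widetilde g=e^{2\varphi}\pi^*g$ and $\Omega_3=\pi^*A+d\varphi$ with one common smooth $\varphi$ on $P_7$.) 5. In that case the Weyl structure is Einstein–Weyl: for each representative $(g,A)$, the torsion-free connection $\mathsf D$ with $\mathsf D g=2Ag$ has a Ricci tensor satisfying $R_{(\mu\nu)}-\tfrac13R\,g_{\mu\nu}=0$. -/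

import Mathlib

open scoped ContDiff
open Set TopologicalSpace

noncomputable section

namespace PDEWeyl

/-! ## Jet coordinates and derivatives of the right-hand side

Points of the jet space `J₄` are `b = (x, y, z, p) : Fin 4 → ℝ`; points of the bundle `P₇` are
`q = (x, y, z, p, u₃, u₅, u₈) : Fin 7 → ℝ`. -/

/-- The partial derivative with respect to the `i`-th coordinate. -/
def pd {n : ℕ} (i : Fin n) (f : (Fin n → ℝ) → ℝ) (b : Fin n → ℝ) : ℝ :=
  fderiv ℝ f b (Pi.single i 1)

/-- `Fp F k = ∂ᵏF/∂pᵏ`. -/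
def Fp (F : (Fin 4 → ℝ) → ℝ) (k : ℕ) : (Fin 4 → ℝ) → ℝ := (pd 3)^[k] F

/-- `Fpz F k = ∂ᵏ⁺¹F/∂pᵏ∂z`. -/
def Fpz (F : (Fin 4 → ℝ) → ℝ) (k : ℕ) : (Fin 4 → ℝ) → ℝ := pd 2 (Fp F k)

/-- `D F = F_x + p F_z`. -/
def DF (F : (Fin 4 → ℝ) → ℝ) (b : Fin 4 → ℝ) : ℝ := pd 0 F b + b 3 * pd 2 F b

/-- `ΔFp F k = Δ(∂ᵏF/∂pᵏ)`, where `Δ = ∂_y + F ∂_z`. -/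
def ΔFp (F : (Fin 4 → ℝ) → ℝ) (k : ℕ) (b : Fin 4 → ℝ) : ℝ :=
  pd 1 (Fp F k) b + F b * pd 2 (Fp F k) b

/-- The Monge invariant `9 F_{ppppp} F_{pp}² - 45 F_{pppp} F_{ppp} F_{pp} + 40 F_{ppp}³`. -/
def Monge (F : (Fin 4 → ℝ) → ℝ) (b : Fin 4 → ℝ) : ℝ :=
  9 * Fp F 5 b * Fp F 2 b ^ 2 - 45 * Fp F 4 b * Fp F 3 b * Fp F 2 b + 40 * Fp F 3 b ^ 3

/-- The invariant `K(F)`. -/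
def KInv (F : (Fin 4 → ℝ) → ℝ) (b : Fin 4 → ℝ) : ℝ :=
  ΔFp F 5 b * Fp F 2 b ^ 3
    - 5 * ΔFp F 4 b * Fp F 2 b ^ 2 * Fp F 3 b
    + 12 * ΔFp F 3 b * Fp F 2 b * Fp F 3 b ^ 2
    - 12 * ΔFp F 2 b * Fp F 3 b ^ 3
    - 4 * ΔFp F 3 b * Fp F 2 b ^ 2 * Fp F 4 b
    + 9 * ΔFp F 2 b * Fp F 2 b * Fp F 3 b * Fp F 4 b
    - ΔFp F 2 b * Fp F 2 b ^ 2 * Fp F 5 b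
    + 5 * Fp F 1 b * Fp F 2 b ^ 3 * Fpz F 4 b
    + 6 * Fp F 2 b ^ 4 * Fpz F 3 b
    - 20 * Fp F 1 b * Fp F 2 b ^ 2 * Fp F 3 b * Fpz F 3 b
    - 12 * Fp F 2 b ^ 3 * Fp F 3 b * Fpz F 2 b
    + 36 * Fp F 1 b * Fp F 2 b * Fp F 3 b ^ 2 * Fpz F 2 b
    - 12 * Fp F 1 b * Fp F 2 b ^ 2 * Fp F 4 b * Fpz F 2 b
    + 8 * Fp F 2 b ^ 2 * Fp F 3 b ^ 2 * Fpz F 1 b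
    - 24 * Fp F 1 b * Fp F 3 b ^ 3 * Fpz F 1 b
    - 3 * Fp F 2 b ^ 3 * Fp F 4 b * Fpz F 1 b
    + 18 * Fp F 1 b * Fp F 2 b * Fp F 3 b * Fp F 4 b * Fpz F 1 b
    - 2 * Fp F 1 b * Fp F 2 b ^ 2 * Fp F 5 b * Fpz F 1 b

/-- The coefficient `r_x`. -/
def rx (F : (Fin 4 → ℝ) → ℝ) (b : Fin 4 → ℝ) : ℝ :=
  1 / (3 * Fp F 2 b ^ 4) *
    (ΔFp F 3 b * Fp F 2 b ^ 2
      - ΔFp F 2 b * Fp F 2 b * Fp F 3 b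
      + 3 * Fp F 1 b * Fp F 2 b ^ 2 * Fpz F 2 b
      - Fp F 2 b ^ 3 * Fpz F 1 b
      - 2 * Fp F 1 b * Fp F 2 b * Fp F 3 b * Fpz F 1 b
      - ΔFp F 4 b * Fp F 2 b ^ 2 * b 3
      + 3 * ΔFp F 3 b * Fp F 2 b * Fp F 3 b * b 3
      - 3 * ΔFp F 2 b * Fp F 3 b ^ 2 * b 3
      + ΔFp F 2 b * Fp F 2 b * Fp F 4 b * b 3
      - 4 * Fp F 1 b * Fp F 2 b ^ 2 * Fpz F 3 b * b 3
      - 2 * Fp F 2 b ^ 3 * Fpz F 2 b * b 3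
      + 9 * Fp F 1 b * Fp F 2 b * Fp F 3 b * Fpz F 2 b * b 3
      + Fp F 2 b ^ 2 * Fp F 3 b * Fpz F 1 b * b 3
      - 6 * Fp F 1 b * Fp F 3 b ^ 2 * Fpz F 1 b * b 3
      + 2 * Fp F 1 b * Fp F 2 b * Fp F 4 b * Fpz F 1 b * b 3)

/-- The coefficient `r_y`. -/
def ry (F : (Fin 4 → ℝ) → ℝ) (b : Fin 4 → ℝ) : ℝ :=
  1 / (3 * Fp F 2 b ^ 4) *
    (- (ΔFp F 4 b * F b * Fp F 2 b ^ 2)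
      + ΔFp F 3 b * Fp F 1 b * Fp F 2 b ^ 2
      - ΔFp F 2 b * Fp F 2 b ^ 3
      + 3 * ΔFp F 3 b * F b * Fp F 2 b * Fp F 3 b
      - ΔFp F 2 b * Fp F 1 b * Fp F 2 b * Fp F 3 b
      - 3 * ΔFp F 2 b * F b * Fp F 3 b ^ 2
      + ΔFp F 2 b * F b * Fp F 2 b * Fp F 4 b
      - 4 * F b * Fp F 1 b * Fp F 2 b ^ 2 * Fpz F 3 b
      + 3 * Fp F 1 b ^ 2 * Fp F 2 b ^ 2 * Fpz F 2 b
      - 2 * F b * Fp F 2 b ^ 3 * Fpz F 2 b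
      + 9 * F b * Fp F 1 b * Fp F 2 b * Fp F 3 b * Fpz F 2 b
      - 3 * Fp F 1 b * Fp F 2 b ^ 3 * Fpz F 1 b
      - 2 * Fp F 1 b ^ 2 * Fp F 2 b * Fp F 3 b * Fpz F 1 b
      + F b * Fp F 2 b ^ 2 * Fp F 3 b * Fpz F 1 b
      - 6 * F b * Fp F 1 b * Fp F 3 b ^ 2 * Fpz F 1 b
      + 2 * F b * Fp F 1 b * Fp F 2 b * Fp F 4 b * Fpz F 1 b
      + 3 * Fp F 2 b ^ 4 * Fpz F 0 b)

/-- The coefficient `r_z`. -/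
def rz (F : (Fin 4 → ℝ) → ℝ) (b : Fin 4 → ℝ) : ℝ :=
  1 / (3 * Fp F 2 b ^ 4) *
    (ΔFp F 4 b * Fp F 2 b ^ 2
      - 3 * ΔFp F 3 b * Fp F 2 b * Fp F 3 b
      + 3 * ΔFp F 2 b * Fp F 3 b ^ 2
      - ΔFp F 2 b * Fp F 2 b * Fp F 4 b
      + 4 * Fp F 1 b * Fp F 2 b ^ 2 * Fpz F 3 b
      + 2 * Fp F 2 b ^ 3 * Fpz F 2 b
      - 9 * Fp F 1 b * Fp F 2 b * Fp F 3 b * Fpz F 2 b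
      - Fp F 2 b ^ 2 * Fp F 3 b * Fpz F 1 b
      + 6 * Fp F 1 b * Fp F 3 b ^ 2 * Fpz F 1 b
      - 2 * Fp F 1 b * Fp F 2 b * Fp F 4 b * Fpz F 1 b)

/-! ## The bundle `P₇`, the forms `θ¹, θ³, θ⁴`, `g̃`, `Ω₃` and the distribution `𝒟₄` -/

/-- The projection `P₇ → J₄`. -/
def base (q : Fin 7 → ℝ) : Fin 4 → ℝ := ![q 0, q 1, q 2, q 3]

/-- The projection `(x, y, z, p, u₃, u₅, u₈) ↦ (x, y, z)`. -/
def xyz (q : Fin 7 → ℝ) : Fin 3 → ℝ := ![q 0, q 1, q 2]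

/-- The total space `P₇ = U × ℝ^* × ℝ^* × ℝ` over the domain `U ⊆ J₄` of `F`. -/
def P7 (U : Opens (Fin 4 → ℝ)) : Set (Fin 7 → ℝ) :=
  {q | base q ∈ U ∧ q 4 ≠ 0 ∧ q 5 ≠ 0}

/-- The coordinate 1-forms `dx, dy, dz, dp, du₃, du₅, du₈`. -/
def dq (i : Fin 7) : (Fin 7 → ℝ) →L[ℝ] ℝ := ContinuousLinearMap.proj i

/-- `ω¹ = dz - p dx - F dy`. -/
def ω1 (F : (Fin 4 → ℝ) → ℝ) (q : Fin 7 → ℝ) : (Fin 7 → ℝ) →L[ℝ] ℝ :=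
  dq 2 - q 3 • dq 0 - F (base q) • dq 1

/-- `ω³ = dx + F_p dy - (1/3) (F_{ppp}/F_{pp}) ω¹`. -/
def ω3 (F : (Fin 4 → ℝ) → ℝ) (q : Fin 7 → ℝ) : (Fin 7 → ℝ) →L[ℝ] ℝ :=
  dq 0 + Fp F 1 (base q) • dq 1
    - ((1 / 3) * (Fp F 3 (base q) / Fp F 2 (base q))) • ω1 F q

/-- `ω⁴ = F_{pp} dy + (4 F_{ppp}² - 3 F_{pp} F_{pppp}) / (18 F_{pp}²) ω¹`. -/
def ω4 (F : (Fin 4 → ℝ) → ℝ) (q : Fin 7 → ℝ) : (Fin 7 → ℝ) →L[ℝ] ℝ :=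
  Fp F 2 (base q) • dq 1
    + ((4 * Fp F 3 (base q) ^ 2 - 3 * Fp F 2 (base q) * Fp F 4 (base q))
        / (18 * Fp F 2 (base q) ^ 2)) • ω1 F q

/-- `θ¹ = u₃ u₅ ω¹`. -/
def θ1 (F : (Fin 4 → ℝ) → ℝ) (q : Fin 7 → ℝ) : (Fin 7 → ℝ) →L[ℝ] ℝ :=
  (q 4 * q 5) • ω1 F q

/-- `θ³ = - u₃ u₈ ω¹ + u₅ ω³`. -/
def θ3 (F : (Fin 4 → ℝ) → ℝ) (q : Fin 7 → ℝ) : (Fin 7 → ℝ) →L[ℝ] ℝ :=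
  (-(q 4 * q 6)) • ω1 F q + q 5 • ω3 F q

/-- `θ⁴ = - (u₃ u₈² / (2 u₅)) ω¹ + u₈ ω³ + (u₅ / u₃) ω⁴`. -/
def θ4 (F : (Fin 4 → ℝ) → ℝ) (q : Fin 7 → ℝ) : (Fin 7 → ℝ) →L[ℝ] ℝ :=
  (-(q 4 * q 6 ^ 2 / (2 * q 5))) • ω1 F q + q 6 • ω3 F q + (q 5 / q 4) • ω4 F q

/-- `g̃ = θ³ ⊗ θ³ + θ¹ ⊗ θ⁴ + θ⁴ ⊗ θ¹` at the point `q`. -/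
def gTilde (F : (Fin 4 → ℝ) → ℝ) (q : Fin 7 → ℝ) : LinearMap.BilinForm ℝ (Fin 7 → ℝ) :=
  LinearMap.BilinForm.linMulLin (θ3 F q).toLinearMap (θ3 F q).toLinearMap
    + LinearMap.BilinForm.linMulLin (θ1 F q).toLinearMap (θ4 F q).toLinearMap
    + LinearMap.BilinForm.linMulLin (θ4 F q).toLinearMap (θ1 F q).toLinearMap

/-- `Ω₃ = r_x dx + r_y dy + r_z dz + (1/3) d log(u₅³ F_{pp})` at the point `q`
(`Real.log t` is `log |t|`). -/
def Ω3 (F : (Fin 4 → ℝ) → ℝ) (q : Fin 7 → ℝ) : (Fin 7 → ℝ) →L[ℝ] ℝ :=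
  rx F (base q) • dq 0 + ry F (base q) • dq 1 + rz F (base q) • dq 2
    + (1 / 3 : ℝ) • fderiv ℝ (fun q' : Fin 7 → ℝ => Real.log (q' 5 ^ 3 * Fp F 2 (base q'))) q

/-- The distribution `𝒟₄`, the annihilator of `θ¹, θ³, θ⁴`. -/
def D4 (F : (Fin 4 → ℝ) → ℝ) (q : Fin 7 → ℝ) : Submodule ℝ (Fin 7 → ℝ) :=
  LinearMap.ker (θ1 F q).toLinearMap ⊓ LinearMap.ker (θ3 F q).toLinearMap
    ⊓ LinearMap.ker (θ4 F q).toLinearMap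

/-- A bilinear form `B` is diagonalised by some basis, with diagonal entries `d`. -/
def HasSignature {n : ℕ} (B : LinearMap.BilinForm ℝ (Fin n → ℝ)) (d : Fin n → ℝ) : Prop :=
  ∃ e : Module.Basis (Fin n) ℝ (Fin n → ℝ), ∀ i j, B (e i) (e j) = if i = j then d i else 0

/-- Frobenius integrability of `𝒟₄` on `P₇`: local smooth sections are closed under brackets. -/
def D4Integrable (F : (Fin 4 → ℝ) → ℝ) (U : Opens (Fin 4 → ℝ)) : Prop :=
  ∀ (W : Set (Fin 7 → ℝ)) (X Y : (Fin 7 → ℝ) → (Fin 7 → ℝ)), IsOpen W → W ⊆ P7 U →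
    ContDiffOn ℝ ∞ X W → ContDiffOn ℝ ∞ Y W →
    (∀ q ∈ W, X q ∈ D4 F q) → (∀ q ∈ W, Y q ∈ D4 F q) →
    ∀ q ∈ W, VectorField.lieBracket ℝ X Y q ∈ D4 F q

/-! ## The leaf space `M₃` -/

/-- Two points of `P₇` are joined by a `C¹` path in `P₇` that is tangent to `𝒟₄`. -/
def LeafStep (F : (Fin 4 → ℝ) → ℝ) (U : Opens (Fin 4 → ℝ)) (q q' : P7 U) : Prop :=
  ∃ γ : ℝ → (Fin 7 → ℝ), ContDiffOn ℝ 1 γ (Icc 0 1) ∧ γ 0 = q ∧ γ 1 = q' ∧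
    ∀ t ∈ Icc (0 : ℝ) 1, γ t ∈ P7 U ∧ derivWithin γ (Icc 0 1) t ∈ D4 F (γ t)

/-- Being on the same leaf of `𝒟₄`: joined by a piecewise `C¹` path tangent to `𝒟₄`. -/
def leafSetoid (F : (Fin 4 → ℝ) → ℝ) (U : Opens (Fin 4 → ℝ)) : Setoid (P7 U) :=
  Relation.EqvGen.setoid (LeafStep F U)

/-- The leaf space `M₃`, with the quotient topology. -/
abbrev LeafSpace (F : (Fin 4 → ℝ) → ℝ) (U : Opens (Fin 4 → ℝ)) : Type :=
  Quotient (leafSetoid F U)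

section LeafSpace

variable {F : (Fin 4 → ℝ) → ℝ} {U : Opens (Fin 4 → ℝ)}

/-- The projection `P₇ → M₃` to the leaf space. -/
def leaf (F : (Fin 4 → ℝ) → ℝ) (U : Opens (Fin 4 → ℝ)) (q : P7 U) : LeafSpace F U :=
  Quotient.mk (leafSetoid F U) q

open Classical in
/-- The pullback to `P₇` of a function on `M₃` (extended by zero outside the open set `P₇`). -/
def pull (f : LeafSpace F U → ℝ) (q : Fin 7 → ℝ) : ℝ :=
  if h : q ∈ P7 U then f (leaf F U ⟨q, h⟩) else 0

/-- Smooth functions on `M₃`: those whose pullback to `P₇` is smooth (this is the smooth structure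
on `M₃` that makes the projection `P₇ → M₃` a submersion). -/
def LeafSmooth (f : LeafSpace F U → ℝ) : Prop := ContDiffOn ℝ ∞ (pull f) (P7 U)

/-- The derivative of a function `f` on `M₃` with respect to the local coordinates
`(x, y, z) = (x⁰, x¹, x²)` of `M₃`, at the leaf of `q`: near `q` the pullback of `f` is a function
of `(x, y, z)` alone. -/
def dM (f : LeafSpace F U → ℝ) (i : Fin 3) (q : P7 U) : ℝ :=
  pd (Fin.castLE (by norm_num) i) (pull f) (q : Fin 7 → ℝ)

/-- A smooth Lorentzian metric on `M₃`, of signature `(+,+,-)`, through its coefficients in the coordinates `(x, y, z)`. -/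
structure LorentzMetric (F : (Fin 4 → ℝ) → ℝ) (U : Opens (Fin 4 → ℝ)) where
  coeff : LeafSpace F U → Matrix (Fin 3) (Fin 3) ℝ
  smooth : ∀ i j, LeafSmooth (fun l => coeff l i j)
  lorentz : ∀ l, HasSignature (Matrix.toBilin' (coeff l)) ![1, 1, -1]

/-- A smooth 1-form on `M₃`, through its coefficients in the coordinates `(x, y, z)`. -/
structure OneForm (F : (Fin 4 → ℝ) → ℝ) (U : Opens (Fin 4 → ℝ)) where
  coeff : LeafSpace F U → Fin 3 → ℝ
  smooth : ∀ i, LeafSmooth (fun l => coeff l i)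

/-- The pullback of a metric on `M₃` to `P₇`, i.e. `∑ g_{ij} dxⁱ dxʲ`. -/
def LorentzMetric.pullback (g : LorentzMetric F U) (q : P7 U) (v w : Fin 7 → ℝ) : ℝ :=
  ∑ i : Fin 3, ∑ j : Fin 3, g.coeff (leaf F U q) i j * xyz v i * xyz w j

/-- The pullback of a 1-form on `M₃` to `P₇`, i.e. `∑ A_i dxⁱ`. -/
def OneForm.pullback (A : OneForm F U) (q : P7 U) (v : Fin 7 → ℝ) : ℝ :=
  ∑ i : Fin 3, A.coeff (leaf F U q) i * xyz v i

/-! ### Helper facts on functions on the leaf space -/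

lemma isOpen_P7 (U : Opens (Fin 4 → ℝ)) : IsOpen (P7 U) := by
  have hb : Continuous base := by
    refine continuous_pi fun i => ?_
    fin_cases i <;> simp [base] <;> fun_prop
  refine (U.isOpen.preimage hb).inter (IsOpen.inter ?_ ?_)
  · exact isOpen_ne_fun (continuous_apply 4) continuous_const
  · exact isOpen_ne_fun (continuous_apply 5) continuous_const

lemma pull_zero : pull (fun _ : LeafSpace F U => (0 : ℝ)) = fun _ => 0 := by
  funext q; simp [pull]

lemma pull_neg (f : LeafSpace F U → ℝ) : pull (fun l => -f l) = fun q => -pull f q := by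
  funext q; by_cases h : q ∈ P7 U <;> simp [pull, h]

lemma pull_add (f h : LeafSpace F U → ℝ) :
    pull (fun l => f l + h l) = fun q => pull f q + pull h q := by
  funext q; by_cases hq : q ∈ P7 U <;> simp [pull, hq]

lemma LeafSmooth.zero : LeafSmooth (fun _ : LeafSpace F U => (0 : ℝ)) := by
  unfold LeafSmooth; rw [pull_zero]; exact contDiffOn_const

lemma LeafSmooth.neg {f : LeafSpace F U → ℝ} (hf : LeafSmooth f) :
    LeafSmooth (fun l => -f l) := by
  unfold LeafSmooth; rw [pull_neg]; exact ContDiffOn.neg hf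

lemma LeafSmooth.add {f h : LeafSpace F U → ℝ} (hf : LeafSmooth f) (hh : LeafSmooth h) :
    LeafSmooth (fun l => f l + h l) := by
  unfold LeafSmooth; rw [pull_add]; exact ContDiffOn.add hf hh

lemma LeafSmooth.differentiableAt {f : LeafSpace F U → ℝ} (hf : LeafSmooth f) (q : P7 U) :
    DifferentiableAt ℝ (pull f) (q : Fin 7 → ℝ) :=
  (ContDiffOn.contDiffAt hf ((isOpen_P7 U).mem_nhds q.2)).differentiableAt (by simp)

lemma dM_zero (i : Fin 3) (q : P7 U) : dM (fun _ : LeafSpace F U => (0 : ℝ)) i q = 0 := by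
  simp [dM, pd, pull_zero]

lemma dM_neg (f : LeafSpace F U → ℝ) (i : Fin 3) (q : P7 U) :
    dM (fun l => -f l) i q = -dM f i q := by
  simp [dM, pd, pull_neg]

lemma dM_add {f h : LeafSpace F U → ℝ} (hf : LeafSmooth f) (hh : LeafSmooth h) (i : Fin 3)
    (q : P7 U) : dM (fun l => f l + h l) i q = dM f i q + dM h i q := by
  simp only [dM, pd, pull_add]
  rw [fderiv_fun_add (hf.differentiableAt q) (hh.differentiableAt q)]
  simp

/-! ### Conformal classes, 1-forms modulo gradients, Weyl structures -/

/-- `ĝ = e^{2ψ} g`. -/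
def IsRescaling (ψ : LeafSpace F U → ℝ) (g g' : LorentzMetric F U) : Prop :=
  ∀ l, g'.coeff l = Real.exp (2 * ψ l) • g.coeff l

/-- `Â = A + dψ`. -/
def IsGradientShift (ψ : LeafSpace F U → ℝ) (A A' : OneForm F U) : Prop :=
  ∀ (q : P7 U) (i : Fin 3), A'.coeff (leaf F U q) i = A.coeff (leaf F U q) i + dM ψ i q

lemma IsRescaling.refl (g : LorentzMetric F U) : IsRescaling (fun _ => 0) g g := by
  intro l; simp

lemma IsRescaling.symm {ψ : LeafSpace F U → ℝ} {g g' : LorentzMetric F U}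
    (h : IsRescaling ψ g g') : IsRescaling (fun l => -ψ l) g' g := by
  intro l
  rw [h l, smul_smul, ← Real.exp_add]
  simp

lemma IsRescaling.trans {ψ χ : LeafSpace F U → ℝ} {g g' g'' : LorentzMetric F U}
    (h : IsRescaling ψ g g') (h' : IsRescaling χ g' g'') :
    IsRescaling (fun l => ψ l + χ l) g g'' := by
  intro l
  rw [h' l, h l, smul_smul, ← Real.exp_add]
  congr 2; ring

lemma IsGradientShift.refl (A : OneForm F U) : IsGradientShift (fun _ => 0) A A := by
  intro q i; simp [dM_zero]

lemma IsGradientShift.symm {ψ : LeafSpace F U → ℝ} {A A' : OneForm F U}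
    (h : IsGradientShift ψ A A') : IsGradientShift (fun l => -ψ l) A' A := by
  intro q i; rw [h q i, dM_neg]; ring

lemma IsGradientShift.trans {ψ χ : LeafSpace F U → ℝ} {A A' A'' : OneForm F U}
    (hψ : LeafSmooth ψ) (hχ : LeafSmooth χ)
    (h : IsGradientShift ψ A A') (h' : IsGradientShift χ A' A'') :
    IsGradientShift (fun l => ψ l + χ l) A A'' := by
  intro q i; rw [h' q i, h q i, dM_add hψ hχ]; ring

/-- Conformal equivalence of Lorentzian metrics on `M₃`. -/
def confSetoid (F : (Fin 4 → ℝ) → ℝ) (U : Opens (Fin 4 → ℝ)) : Setoid (LorentzMetric F U) where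
  r g g' := ∃ ψ, LeafSmooth ψ ∧ IsRescaling ψ g g'
  iseqv :=
    { refl := fun g => ⟨_, LeafSmooth.zero, IsRescaling.refl g⟩
      symm := fun ⟨_, hs, h⟩ => ⟨_, hs.neg, h.symm⟩
      trans := fun ⟨_, hs, h⟩ ⟨_, hs', h'⟩ => ⟨_, hs.add hs', h.trans h'⟩ }

/-- Equality of 1-forms on `M₃` modulo gradients. -/
def gradSetoid (F : (Fin 4 → ℝ) → ℝ) (U : Opens (Fin 4 → ℝ)) : Setoid (OneForm F U) where
  r A A' := ∃ ψ, LeafSmooth ψ ∧ IsGradientShift ψ A A'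
  iseqv :=
    { refl := fun A => ⟨_, LeafSmooth.zero, IsGradientShift.refl A⟩
      symm := fun ⟨_, hs, h⟩ => ⟨_, hs.neg, h.symm⟩
      trans := fun ⟨_, hs, h⟩ ⟨_, hs', h'⟩ => ⟨_, hs.add hs', h.trans hs hs' h'⟩ }

/-- Weyl equivalence `(g, A) ∼ (e^{2ψ} g, A + dψ)`. -/
def weylSetoid (F : (Fin 4 → ℝ) → ℝ) (U : Opens (Fin 4 → ℝ)) :
    Setoid (LorentzMetric F U × OneForm F U) where
  r s s' := ∃ ψ, LeafSmooth ψ ∧ IsRescaling ψ s.1 s'.1 ∧ IsGradientShift ψ s.2 s'.2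
  iseqv :=
    { refl := fun s => ⟨_, LeafSmooth.zero, IsRescaling.refl s.1, IsGradientShift.refl s.2⟩
      symm := fun ⟨_, hs, h, k⟩ => ⟨_, hs.neg, h.symm, k.symm⟩
      trans := fun ⟨_, hs, h, k⟩ ⟨_, hs', h', k'⟩ =>
        ⟨_, hs.add hs', h.trans h', k.trans hs hs' k'⟩ }

/-- Lorentzian conformal classes `[g]` on `M₃`. -/
abbrev ConformalClass (F : (Fin 4 → ℝ) → ℝ) (U : Opens (Fin 4 → ℝ)) : Type :=
  Quotient (confSetoid F U)

/-- 1-forms on `M₃` up to differentials of functions on `M₃`. -/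
abbrev OneFormModGradients (F : (Fin 4 → ℝ) → ℝ) (U : Opens (Fin 4 → ℝ)) : Type :=
  Quotient (gradSetoid F U)

/-- Lorentzian Weyl structures `[(g, A)]` on `M₃`. -/
abbrev WeylStructure (F : (Fin 4 → ℝ) → ℝ) (U : Opens (Fin 4 → ℝ)) : Type :=
  Quotient (weylSetoid F U)

/-! ### Descent to the leaf space -/

/-- `g̃ = e^{2φ} π^* g` on `P₇`, where `π : P₇ → M₃`. -/
def MetricPullsBack (φ : (Fin 7 → ℝ) → ℝ) (g : LorentzMetric F U) : Prop :=
  ∀ (q : P7 U) (v w : Fin 7 → ℝ),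
    gTilde F q v w = Real.exp (2 * φ q) * g.pullback q v w

/-- `Ω₃ = π^* A + dφ` on `P₇`, where `π : P₇ → M₃`. -/
def FormPullsBack (φ : (Fin 7 → ℝ) → ℝ) (A : OneForm F U) : Prop :=
  ∀ (q : P7 U) (v : Fin 7 → ℝ),
    Ω3 F q v = A.pullback q v + fderiv ℝ φ (q : Fin 7 → ℝ) v

/-- `g̃` descends to the conformal class `c`: the metrics in `c` are exactly the metrics on `M₃`
whose pullback to `P₇` is conformal to `g̃`. -/
def DescendsToConformal (c : ConformalClass F U) : Prop :=
  ∀ g : LorentzMetric F U, Quotient.mk (confSetoid F U) g = c ↔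
    ∃ φ : (Fin 7 → ℝ) → ℝ, ContDiffOn ℝ ∞ φ (P7 U) ∧ MetricPullsBack φ g

/-- `Ω₃` descends to the class `a` of 1-forms modulo gradients: the 1-forms in `a` are exactly the
1-forms on `M₃` whose pullback to `P₇` differs from `Ω₃` by the differential of a function. -/
def DescendsToOneForm (a : OneFormModGradients F U) : Prop :=
  ∀ A : OneForm F U, Quotient.mk (gradSetoid F U) A = a ↔
    ∃ φ : (Fin 7 → ℝ) → ℝ, ContDiffOn ℝ ∞ φ (P7 U) ∧ FormPullsBack φ A

/-- The pair `(g̃, Ω₃)` descends to the Weyl structure `s`: its representatives are exactly the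
pairs `(g, A)` on `M₃` whose pullback to `P₇` is Weyl equivalent to `(g̃, Ω₃)`. -/
def DescendsToWeyl (s : WeylStructure F U) : Prop :=
  ∀ (g : LorentzMetric F U) (A : OneForm F U), Quotient.mk (weylSetoid F U) (g, A) = s ↔
    ∃ φ : (Fin 7 → ℝ) → ℝ, ContDiffOn ℝ ∞ φ (P7 U) ∧ MetricPullsBack φ g ∧ FormPullsBack φ A

/-! ### The Einstein--Weyl equations -/

/-- `Γ μ ν σ = Γ^μ_{νσ}` are the coefficients, in the coordinates `(x, y, z)`, of the Weyl
connection of `(g, A)`: the torsion-free connection with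
`dg_{μν} - g_{μρ} Γ^ρ_ν - g_{νρ} Γ^ρ_μ = 2 A g_{μν}`, where `Γ^μ_ν = Γ^μ_{νσ} dx^σ`. -/
structure IsWeylConnection (g : LorentzMetric F U) (A : OneForm F U)
    (Γ : Fin 3 → Fin 3 → Fin 3 → LeafSpace F U → ℝ) : Prop where
  smooth : ∀ μ ν σ, LeafSmooth (Γ μ ν σ)
  torsion_free : ∀ μ ν σ l, Γ μ ν σ l = Γ μ σ ν l
  compatible : ∀ (q : P7 U) (μ ν σ : Fin 3),
    dM (fun l => g.coeff l μ ν) σ q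
      - ∑ ρ, g.coeff (leaf F U q) μ ρ * Γ ρ ν σ (leaf F U q)
      - ∑ ρ, g.coeff (leaf F U q) ν ρ * Γ ρ μ σ (leaf F U q)
      = 2 * A.coeff (leaf F U q) σ * g.coeff (leaf F U q) μ ν

/-- The curvature tensor `R^μ_{νρσ}`, defined by
`dΓ^μ_ν + Γ^μ_τ ∧ Γ^τ_ν = (1/2) R^μ_{νρσ} dx^ρ ∧ dx^σ`. -/
def curvature (Γ : Fin 3 → Fin 3 → Fin 3 → LeafSpace F U → ℝ) (q : P7 U)
    (μ ν ρ σ : Fin 3) : ℝ :=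
  dM (Γ μ ν σ) ρ q - dM (Γ μ ν ρ) σ q
    + ∑ τ, (Γ μ τ ρ (leaf F U q) * Γ τ ν σ (leaf F U q)
        - Γ μ τ σ (leaf F U q) * Γ τ ν ρ (leaf F U q))

/-- The Ricci tensor `R_{μν} = R^ρ_{μρν}`. -/
def ricci (Γ : Fin 3 → Fin 3 → Fin 3 → LeafSpace F U → ℝ) (q : P7 U) (μ ν : Fin 3) : ℝ :=
  ∑ ρ, curvature Γ q ρ μ ρ ν

/-- The scalar curvature `R = g^{μν} R_{μν}`. -/
def scalarCurvature (g : LorentzMetric F U) (Γ : Fin 3 → Fin 3 → Fin 3 → LeafSpace F U → ℝ)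
    (q : P7 U) : ℝ :=
  ∑ μ, ∑ ν, (g.coeff (leaf F U q))⁻¹ μ ν * ricci Γ q μ ν

/-- The Einstein--Weyl equations `R_{(μν)} - (1/3) R g_{μν} = 0` for the Weyl connection
of `(g, A)`. -/
def SatisfiesEinsteinWeyl (g : LorentzMetric F U) (A : OneForm F U) : Prop :=
  ∃ Γ : Fin 3 → Fin 3 → Fin 3 → LeafSpace F U → ℝ, IsWeylConnection g A Γ ∧
    ∀ (q : P7 U) (μ ν : Fin 3),
      (1 / 2) * (ricci Γ q μ ν + ricci Γ q ν μ)
        - (1 / 3) * scalarCurvature g Γ q * g.coeff (leaf F U q) μ ν = 0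

/-- A Weyl structure is Einstein--Weyl: all its representatives satisfy the equations. -/
def IsEinsteinWeyl (s : WeylStructure F U) : Prop :=
  ∀ (g : LorentzMetric F U) (A : OneForm F U),
    Quotient.mk (weylSetoid F U) (g, A) = s → SatisfiesEinsteinWeyl g A

end LeafSpace

end PDEWeyl

end

namespace PDEWeyl

/-! ### Partial derivatives -/

section Calculus

variable {n : ℕ} {V : Set (Fin n → ℝ)} {f g : (Fin n → ℝ) → ℝ} {b : Fin n → ℝ}

/-! Work with the frame `D = ∂_x + p ∂_z`, `N = Δ - F_p D`, `∂_z` of `(x, y, z)`-space, for which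
`∂_p N = -F_pp D` and `∂_p D = ∂_z`. On `P₇` one has `g̃ = e^{2 φ0} g3` and `Ω₃ = r + dφ0` with one
and the same `φ0 = (1/3) log |u₅³ F_pp|`, where `g3` and `r` involve only `dx, dy, dz`, with
coefficients in `(x, y, z, p)`. As `𝒟₄` is cut out by `dx = dy = dz = 0` (`mem_D4_iff`), descent is
a question of dependence on `p`.

Two identities answer it: `∂_p g3` is a nowhere zero multiple of `M(F) ω¹ω¹` (`hasDerivAt_g3`), and
`∂_p r` is a nowhere zero multiple of `K(F) ω¹` (`pd_three_r3`). So `g3` and `r` descend when the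
invariants vanish. Conversely, if `g̃ = e^{2φ} π^* g`, comparing vertical derivatives on `D`, where
`ω¹` vanishes, shows that `φ - φ0` is constant along the leaves; then `M(F) = 0`, and the remaining
freedom is exactly a function on `M₃`. The 1-form is treated in the same way, and sharing `φ0` gives
the Weyl class.

The Einstein–Weyl equations follow from Cartan's argument. `DF = 0` says that `D` and `Δ` commute at
constant `p`, so the planes `ω¹ = 0` integrate to surfaces. These are null with normal direction
`N`, and the choice of `r` makes them totally geodesic for the Weyl connection (`Γc_vD_vD`,
`Γc_vD_vΔ`, `Γc_vΔ_vΔ`). Hence `R(D, Δ)` preserves the plane (`Rm_vD_vΔ`), and with the metric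
symmetry of the curvature this forces `Ric(N, N) = 0` (`ricci_null`). When both invariants vanish,
the Ricci tensor has zero `p`-derivative while `N` moves along the null cone; four `p`-derivatives
of `Ric(N, N) = 0` make the symmetrised Ricci tensor proportional to the metric
(`exists_eq_smul_G3`). -/

lemma fderiv_eq_sum_pd (f : (Fin n → ℝ) → ℝ) (b v : Fin n → ℝ) :
    fderiv ℝ f b v = ∑ i, v i * pd i f b := by
  conv_lhs => rw [pi_eq_sum_univ' v, map_sum]
  refine Finset.sum_congr rfl fun i _ => ?_
  rw [map_smul, smul_eq_mul, pd]

lemma differentiableAt_of_contDiffOn (hV : IsOpen V) (hf : ContDiffOn ℝ ∞ f V) (hb : b ∈ V) :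
    DifferentiableAt ℝ f b :=
  (hf.contDiffAt (hV.mem_nhds hb)).differentiableAt (by simp)

lemma contDiffOn_pd (hV : IsOpen V) (hf : ContDiffOn ℝ ∞ f V) (i : Fin n) :
    ContDiffOn ℝ ∞ (pd i f) V :=
  (hf.fderiv_of_isOpen hV (by simp)).clm_apply contDiffOn_const

lemma pd_congr (hV : IsOpen V) (h : ∀ b ∈ V, f b = g b) (hb : b ∈ V) (i : Fin n) :
    pd i f b = pd i g b := by
  have : f =ᶠ[nhds b] g := Filter.eventually_of_mem (hV.mem_nhds hb) h
  rw [pd, this.fderiv_eq, pd]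

lemma pd_comm (hV : IsOpen V) (hf : ContDiffOn ℝ ∞ f V) (hb : b ∈ V) (i j : Fin n) :
    pd i (pd j f) b = pd j (pd i f) b := by
  have hc : ContDiffAt ℝ ∞ f b := hf.contDiffAt (hV.mem_nhds hb)
  have hs : IsSymmSndFDerivAt ℝ f b := hc.isSymmSndFDerivAt (by simpa using WithTop.coe_le_coe.2 (le_top : (2 : ℕ∞) ≤ ⊤))
  have hd : DifferentiableAt ℝ (fderiv ℝ f) b :=
    ((hf.fderiv_of_isOpen hV (m := ∞) (by simp)).contDiffAt (hV.mem_nhds hb)).differentiableAt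
      (by simp)
  have key : ∀ k l : Fin n, pd k (pd l f) b
      = fderiv ℝ (fderiv ℝ f) b (Pi.single k 1) (Pi.single l 1) := by
    intro k l
    have : pd l f = fun b => fderiv ℝ f b (Pi.single l 1) := rfl
    rw [pd, this, fderiv_clm_apply hd (differentiableAt_const _)]
    simp
  rw [key, key, hs.eq]

lemma hasDerivAt_line (hf : DifferentiableAt ℝ f b) (v : Fin n → ℝ) :
    HasDerivAt (fun t : ℝ => f (b + t • v)) (∑ i, v i * pd i f b) 0 := by
  rw [← fderiv_eq_sum_pd]
  exact hf.hasFDerivAt.hasLineDerivAt v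

lemma hasDerivAt_line_pd (hf : DifferentiableAt ℝ f b) (i : Fin n) :
    HasDerivAt (fun t : ℝ => f (b + t • Pi.single i 1)) (pd i f b) 0 :=
  hf.hasFDerivAt.hasLineDerivAt _

lemma pd_eq_of_hasDerivAt (hf : DifferentiableAt ℝ f b) {i : Fin n} {c : ℝ}
    (h : HasDerivAt (fun t : ℝ => f (b + t • Pi.single i 1)) c 0) : pd i f b = c :=
  (hasDerivAt_line_pd hf i).unique h

lemma pd_const (i : Fin n) (c : ℝ) : pd i (fun _ => c) b = 0 := by simp [pd]

lemma pd_add (hf : DifferentiableAt ℝ f b) (hg : DifferentiableAt ℝ g b) (i : Fin n) :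
    pd i (fun b => f b + g b) b = pd i f b + pd i g b := by
  simp [pd, fderiv_fun_add hf hg]

lemma pd_mul (hf : DifferentiableAt ℝ f b) (hg : DifferentiableAt ℝ g b) (i : Fin n) :
    pd i (fun b => f b * g b) b = pd i f b * g b + f b * pd i g b := by
  simp [pd, fderiv_fun_mul hf hg]; ring

lemma pd_sum {ι : Type*} {s : Finset ι} {f : ι → (Fin n → ℝ) → ℝ}
    (hf : ∀ k ∈ s, DifferentiableAt ℝ (f k) b) (i : Fin n) :
    pd i (fun b => ∑ k ∈ s, f k b) b = ∑ k ∈ s, pd i (f k) b := by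
  simp [pd, fderiv_fun_sum hf]

end Calculus

/-! ### Jets of the right-hand side -/

section Jets

variable {U : Opens (Fin 4 → ℝ)} {F : (Fin 4 → ℝ) → ℝ}

lemma Fp_succ (F : (Fin 4 → ℝ) → ℝ) (k : ℕ) : Fp F (k + 1) = pd 3 (Fp F k) :=
  Function.iterate_succ_apply' _ _ _

lemma contDiffOn_Fp (hF : ContDiffOn ℝ ∞ F U) (k : ℕ) : ContDiffOn ℝ ∞ (Fp F k) U := by
  induction k with
  | zero => exact hF
  | succ k ih => rw [Fp_succ]; exact contDiffOn_pd U.isOpen ih 3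

lemma contDiffOn_Fpz (hF : ContDiffOn ℝ ∞ F U) (k : ℕ) : ContDiffOn ℝ ∞ (Fpz F k) U :=
  contDiffOn_pd U.isOpen (contDiffOn_Fp hF k) 2

lemma contDiffOn_ΔFp (hF : ContDiffOn ℝ ∞ F U) (k : ℕ) : ContDiffOn ℝ ∞ (ΔFp F k) U :=
  (contDiffOn_pd U.isOpen (contDiffOn_Fp hF k) 1).add
    (hF.mul (contDiffOn_pd U.isOpen (contDiffOn_Fp hF k) 2))

lemma differentiableAt_Fp (hF : ContDiffOn ℝ ∞ F U) {b : Fin 4 → ℝ} (hb : b ∈ U) (k : ℕ) :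
    DifferentiableAt ℝ (Fp F k) b :=
  differentiableAt_of_contDiffOn U.isOpen (contDiffOn_Fp hF k) hb

lemma hasDerivAt_Fp (hF : ContDiffOn ℝ ∞ F U) {b : Fin 4 → ℝ} (hb : b ∈ U) (k : ℕ) :
    HasDerivAt (fun t : ℝ => Fp F k (b + t • Pi.single 3 1)) (Fp F (k + 1) b) 0 := by
  rw [Fp_succ]
  exact hasDerivAt_line_pd (differentiableAt_Fp hF hb k) 3

lemma hasDerivAt_Fpz (hF : ContDiffOn ℝ ∞ F U) {b : Fin 4 → ℝ} (hb : b ∈ U) (k : ℕ) :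
    HasDerivAt (fun t : ℝ => Fpz F k (b + t • Pi.single 3 1)) (Fpz F (k + 1) b) 0 := by
  have h := hasDerivAt_line_pd
    (differentiableAt_of_contDiffOn U.isOpen (contDiffOn_Fpz hF k) hb) 3
  rw [show Fpz F (k + 1) b = pd 3 (Fpz F k) b by
    rw [Fpz, Fp_succ, Fpz, pd_comm U.isOpen (contDiffOn_Fp hF k) hb]]
  exact h

/-- The operator `Δ` has the coefficient `F`, so `∂_p Δ = Δ ∂_p + F_p ∂_z`. -/
lemma hasDerivAt_ΔFp (hF : ContDiffOn ℝ ∞ F U) {b : Fin 4 → ℝ} (hb : b ∈ U) (k : ℕ) :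
    HasDerivAt (fun t : ℝ => ΔFp F k (b + t • Pi.single 3 1))
      (ΔFp F (k + 1) b + Fp F 1 b * Fpz F k b) 0 := by
  have hk := contDiffOn_Fp hF k
  have h1 := hasDerivAt_line_pd
    (differentiableAt_of_contDiffOn U.isOpen (contDiffOn_pd U.isOpen hk 1) hb) 3
  have h2 := hasDerivAt_Fpz hF hb k
  have h0 := hasDerivAt_Fp hF hb 0
  rw [pd_comm U.isOpen hk hb, ← Fp_succ] at h1
  refine (h1.add (h0.mul h2)).congr_deriv ?_
  simp [ΔFp, Fpz, Fp]; ring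

lemma hasDerivAt_coord (b : Fin 4 → ℝ) :
    HasDerivAt (fun t : ℝ => (b + t • Pi.single (3 : Fin 4) (1 : ℝ) : Fin 4 → ℝ) 3) 1 0 := by
  simpa using (hasDerivAt_id (0 : ℝ)).const_add (b 3)

end Jets

section Coefficients

variable {U : Opens (Fin 4 → ℝ)} {F : (Fin 4 → ℝ) → ℝ} {b : Fin 4 → ℝ}

/-! ### The 1-form `r_x dx + r_y dy + r_z dz` -/

/-- The value of `r_x dx + r_y dy + r_z dz` on `D = ∂_x + p ∂_z`. -/
noncomputable def rD (F : (Fin 4 → ℝ) → ℝ) (b : Fin 4 → ℝ) : ℝ :=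
  (ΔFp F 3 b * Fp F 2 b - ΔFp F 2 b * Fp F 3 b + 3 * Fp F 1 b * Fp F 2 b * Fpz F 2 b
    - Fp F 2 b ^ 2 * Fpz F 1 b - 2 * Fp F 1 b * Fp F 3 b * Fpz F 1 b) / (3 * Fp F 2 b ^ 3)

/-- The value of `r_x dx + r_y dy + r_z dz` on `N = Δ - F_p D`. -/
noncomputable def rN (F : (Fin 4 → ℝ) → ℝ) (b : Fin 4 → ℝ) : ℝ :=
  Fpz F 0 b - (ΔFp F 2 b + 2 * Fp F 1 b * Fpz F 1 b) / (3 * Fp F 2 b)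

/-- The coframe dual to `(D, N, ∂_z)` is `(dx + F_p dy, dy, ω¹)`; this lemma and `ry_eq` read off
the `dx` and `dy` coefficients of `rD (dx + F_p dy) + rN dy + rz ω¹`. -/
lemma rx_eq (h2 : Fp F 2 b ≠ 0) : rx F b = rD F b - b 3 * rz F b := by
  unfold rx rD rz; field_simp; ring

lemma ry_eq (h2 : Fp F 2 b ≠ 0) : ry F b = rN F b - F b * rz F b + Fp F 1 b * rD F b := by
  unfold ry rD rz rN; field_simp; ring

variable (hF : ContDiffOn ℝ ∞ F U) (hb : b ∈ U) (h2 : Fp F 2 b ≠ 0)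
include hF hb h2

/-- Since `∂_p N = -F_pp D` and `∂_p D = ∂_z`, a 1-form free of `p` with value `rN` on `N` is forced
to have the values `rD` on `D` and `rz` on `∂_z`. This lemma and `hasDerivAt_rD` are these two
steps. -/
lemma hasDerivAt_rN :
    HasDerivAt (fun t : ℝ => rN F (b + t • Pi.single 3 1)) (-(Fp F 2 b * rD F b)) 0 := by
  have f1 := hasDerivAt_Fp hF hb 1
  have f2 := hasDerivAt_Fp hF hb 2
  have d2 := hasDerivAt_ΔFp hF hb 2
  have z0 := hasDerivAt_Fpz hF hb 0
  have z1 := hasDerivAt_Fpz hF hb 1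
  refine (z0.fun_sub ((d2.fun_add ((f1.const_mul 2).fun_mul z1)).fun_div (f2.const_mul 3)
    (by simpa using h2))).congr_deriv ?_
  simp only [zero_smul, add_zero, rD]
  field_simp
  ring

lemma hasDerivAt_rD :
    HasDerivAt (fun t : ℝ => rD F (b + t • Pi.single 3 1)) (rz F b) 0 := by
  have f1 := hasDerivAt_Fp hF hb 1
  have f2 := hasDerivAt_Fp hF hb 2
  have f3 := hasDerivAt_Fp hF hb 3
  have d2 := hasDerivAt_ΔFp hF hb 2
  have d3 := hasDerivAt_ΔFp hF hb 3
  have z1 := hasDerivAt_Fpz hF hb 1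
  have z2 := hasDerivAt_Fpz hF hb 2
  refine ((((((d3.fun_mul f2).fun_sub (d2.fun_mul f3)).fun_add
    (((f1.const_mul 3).fun_mul f2).fun_mul z2)).fun_sub ((f2.fun_pow 2).fun_mul z1)).fun_sub
    (((f1.const_mul 2).fun_mul f3).fun_mul z1)).fun_div ((f2.fun_pow 3).const_mul 3)
    (by simpa using h2)).congr_deriv ?_
  simp only [zero_smul, add_zero, rz]
  field_simp
  ring

/-- The value on `∂_z` would have to be free of `p`; the failure is the invariant `K`. -/
lemma hasDerivAt_rz :
    HasDerivAt (fun t : ℝ => rz F (b + t • Pi.single 3 1)) (KInv F b / (3 * Fp F 2 b ^ 5)) 0 := by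
  have f1 := hasDerivAt_Fp hF hb 1
  have f2 := hasDerivAt_Fp hF hb 2
  have f3 := hasDerivAt_Fp hF hb 3
  have f4 := hasDerivAt_Fp hF hb 4
  have d2 := hasDerivAt_ΔFp hF hb 2
  have d3 := hasDerivAt_ΔFp hF hb 3
  have d4 := hasDerivAt_ΔFp hF hb 4
  have z1 := hasDerivAt_Fpz hF hb 1
  have z2 := hasDerivAt_Fpz hF hb 2
  have z3 := hasDerivAt_Fpz hF hb 3
  have num := (((((((((d4.fun_mul (f2.fun_pow 2)).fun_sub
    (((d3.const_mul 3).fun_mul f2).fun_mul f3)).fun_add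
    ((d2.const_mul 3).fun_mul (f3.fun_pow 2))).fun_sub
    ((d2.fun_mul f2).fun_mul f4)).fun_add
    (((f1.const_mul 4).fun_mul (f2.fun_pow 2)).fun_mul z3)).fun_add
    (((f2.fun_pow 3).const_mul 2).fun_mul z2)).fun_sub
    ((((f1.const_mul 9).fun_mul f2).fun_mul f3).fun_mul z2)).fun_sub
    (((f2.fun_pow 2).fun_mul f3).fun_mul z1)).fun_add
    (((f1.const_mul 6).fun_mul (f3.fun_pow 2)).fun_mul z1)).fun_sub
    ((((f1.const_mul 2).fun_mul f2).fun_mul f4).fun_mul z1)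
  refine (((hasDerivAt_const (0 : ℝ) (1 : ℝ)).fun_div ((f2.fun_pow 4).const_mul 3)
    (by simpa using h2)).fun_mul num).congr_deriv ?_
  simp only [zero_smul, add_zero, KInv]
  field_simp
  ring

/-- In `rD - p rz` the two copies of `rz` produced by differentiation cancel, leaving only the
derivative of `rz`; the same happens for `ry`. -/
lemma hasDerivAt_rx (hev : ∀ b ∈ U, Fp F 2 b ≠ 0) :
    HasDerivAt (fun t : ℝ => rx F (b + t • Pi.single 3 1))
      (-(b 3 * (KInv F b / (3 * Fp F 2 b ^ 5)))) 0 := by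
  have hd := (hasDerivAt_rD hF hb h2).fun_sub
    ((hasDerivAt_coord b).fun_mul (hasDerivAt_rz hF hb h2))
  have hU : ∀ᶠ t in nhds (0 : ℝ), b + t • Pi.single (3 : Fin 4) (1 : ℝ) ∈ U :=
    (Continuous.tendsto' (by fun_prop) 0 b (by simp)).eventually (U.isOpen.mem_nhds hb)
  refine (hd.congr_of_eventuallyEq ?_).congr_deriv ?_
  · filter_upwards [hU] with t ht using rx_eq (hev _ ht)
  · simp

lemma hasDerivAt_ry (hev : ∀ b ∈ U, Fp F 2 b ≠ 0) :
    HasDerivAt (fun t : ℝ => ry F (b + t • Pi.single 3 1))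
      (-(F b * (KInv F b / (3 * Fp F 2 b ^ 5)))) 0 := by
  have hd := ((hasDerivAt_rN hF hb h2).fun_sub
    ((hasDerivAt_Fp hF hb 0).fun_mul (hasDerivAt_rz hF hb h2))).fun_add
    ((hasDerivAt_Fp hF hb 1).fun_mul (hasDerivAt_rD hF hb h2))
  have hU : ∀ᶠ t in nhds (0 : ℝ), b + t • Pi.single (3 : Fin 4) (1 : ℝ) ∈ U :=
    (Continuous.tendsto' (by fun_prop) 0 b (by simp)).eventually (U.isOpen.mem_nhds hb)
  refine (hd.congr_of_eventuallyEq ?_).congr_deriv ?_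
  · filter_upwards [hU] with t ht using ry_eq (hev _ ht)
  · simp [Fp]; ring

end Coefficients

/-! ### The adapted frame and the normalised metric -/

section Metric

variable {U : Opens (Fin 4 → ℝ)} {F : (Fin 4 → ℝ) → ℝ} {b : Fin 4 → ℝ}

/-- The vector `D = ∂_x + p ∂_z`. -/
def vD (b : Fin 4 → ℝ) : Fin 3 → ℝ := ![1, 0, b 3]

/-- The vector `N = ∂_y + F ∂_z - F_p D`. -/
noncomputable def vN (F : (Fin 4 → ℝ) → ℝ) (b : Fin 4 → ℝ) : Fin 3 → ℝ :=
  ![-Fp F 1 b, 1, F b - b 3 * Fp F 1 b]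

/-- The vector `∂_z`. -/
def vZ : Fin 3 → ℝ := ![0, 0, 1]

/-- The covector `ω¹ = dz - p dx - F dy`. -/
def cω (F : (Fin 4 → ℝ) → ℝ) (b : Fin 4 → ℝ) : Fin 3 → ℝ := ![-b 3, -F b, 1]

/-- The covector `dx + F_p dy`. -/
noncomputable def cα (F : (Fin 4 → ℝ) → ℝ) (b : Fin 4 → ℝ) : Fin 3 → ℝ := ![1, Fp F 1 b, 0]

/-- The covector `dy`. -/
def cy : Fin 3 → ℝ := ![0, 1, 0]

/-- The coefficients of `ω³ω³ + ω¹ω⁴ + ω⁴ω¹` in the coordinates `(x, y, z)`. -/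
noncomputable def G3 (F : (Fin 4 → ℝ) → ℝ) (b : Fin 4 → ℝ) : Matrix (Fin 3) (Fin 3) ℝ :=
  Matrix.of fun i j => cα F b i * cα F b j
    - Fp F 3 b / (3 * Fp F 2 b) * (cα F b i * cω F b j + cω F b i * cα F b j)
    + Fp F 2 b * (cω F b i * cy j + cy i * cω F b j)
    + (5 * Fp F 3 b ^ 2 - 3 * Fp F 2 b * Fp F 4 b) / (9 * Fp F 2 b ^ 2) * (cω F b i * cω F b j)

/-- The conformal factor `|F_{pp}|^{-2/3}`. -/
noncomputable def hfac (F : (Fin 4 → ℝ) → ℝ) (b : Fin 4 → ℝ) : ℝ :=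
  Real.exp (-(2 / 3) * Real.log (Fp F 2 b))

/-- The representative of determinant `-1`. -/
noncomputable def g3 (F : (Fin 4 → ℝ) → ℝ) (b : Fin 4 → ℝ) : Matrix (Fin 3) (Fin 3) ℝ :=
  hfac F b • G3 F b

/-- The value of a bilinear form with matrix `M`. -/
def bil (M : Matrix (Fin 3) (Fin 3) ℝ) (v w : Fin 3 → ℝ) : ℝ := ∑ i, ∑ j, M i j * v i * w j

lemma G3_symm (i j : Fin 3) : G3 F b i j = G3 F b j i := by simp [G3]; ring

lemma g3_symm (i j : Fin 3) : g3 F b i j = g3 F b j i := by simp [g3, G3_symm i j]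

lemma hfac_pos : 0 < hfac F b := Real.exp_pos _

lemma hfac_cube (h2 : Fp F 2 b ≠ 0) : hfac F b ^ 3 * Fp F 2 b ^ 2 = 1 := by
  have h : hfac F b ^ 3 = (Fp F 2 b ^ 2)⁻¹ := by
    rw [hfac, ← Real.exp_nat_mul, show ((3 : ℕ) : ℝ) * (-(2 / 3) * Real.log (Fp F 2 b))
      = -Real.log (Fp F 2 b ^ 2) by rw [Real.log_pow]; push_cast; ring, Real.exp_neg,
      Real.exp_log (by positivity)]
  rw [h, inv_mul_cancel₀ (pow_ne_zero 2 h2)]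

/-- With determinant `-1` the inverse is minus the adjugate, hence polynomial in the entries, and
inherits independence of `p` from them. -/
lemma det_g3 (h2 : Fp F 2 b ≠ 0) : (g3 F b).det = -1 := by
  rw [g3, Matrix.det_smul, Fintype.card_fin]
  have : (G3 F b).det = -Fp F 2 b ^ 2 := by
    rw [Matrix.det_fin_three]
    simp [G3, cα, cω, cy]
    field_simp
    ring
  rw [this]
  linear_combination -hfac_cube (F := F) (b := b) h2

lemma g3_vN_vN : bil (g3 F b) (vN F b) (vN F b) = 0 := by
  simp [bil, g3, G3, vN, cα, cω, cy, Fin.sum_univ_three]; ring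

lemma g3_vD_vN : bil (g3 F b) (vD b) (vN F b) = 0 := by
  simp [bil, g3, G3, vN, vD, cα, cω, cy, Fin.sum_univ_three]; ring

lemma g3_vD_vD : bil (g3 F b) (vD b) (vD b) = hfac F b := by
  simp [bil, g3, G3, vD, cα, cω, cy, Fin.sum_univ_three]; ring

lemma g3_vN_vZ : bil (g3 F b) (vN F b) vZ = hfac F b * Fp F 2 b := by
  simp [bil, g3, G3, vN, vZ, cα, cω, cy, Fin.sum_univ_three]; ring

/-- A symmetric bilinear form is `s` times the fundamental form as soon as its values on the frame
are. -/
lemma eq_smul_G3 {M : Matrix (Fin 3) (Fin 3) ℝ} (h2 : Fp F 2 b ≠ 0) (hM : ∀ i j, M i j = M j i)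
    (hNN : bil M (vN F b) (vN F b) = 0) (hDN : bil M (vD b) (vN F b) = 0)
    (hNZ : bil M (vN F b) vZ = Fp F 2 b * bil M (vD b) (vD b))
    (hDZ : Fp F 3 b * bil M (vD b) (vD b) + 3 * Fp F 2 b * bil M (vD b) vZ = 0)
    (hZZ : Fp F 4 b * bil M (vD b) (vD b) + 5 * Fp F 3 b * bil M (vD b) vZ
      + 3 * Fp F 2 b * bil M vZ vZ = 0) :
    M = bil M (vD b) (vD b) • G3 F b := by
  set s := bil M (vD b) (vD b) with hs
  have hDZ' : bil M (vD b) vZ = -(Fp F 3 b / (3 * Fp F 2 b)) * s := by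
    field_simp; linear_combination hDZ
  have hZZ' : bil M vZ vZ =
      (5 * Fp F 3 b ^ 2 - 3 * Fp F 2 b * Fp F 4 b) / (9 * Fp F 2 b ^ 2) * s := by
    rw [hDZ'] at hZZ
    field_simp at hZZ ⊢
    linear_combination hZZ
  -- Expansion of `M` in the coframe `(cα, cy, cω)` dual to `(vD, vN, vZ)`; the hypotheses determine
  -- every coefficient from `s`.
  have expand : ∀ i j, M i j = s * (cα F b i * cα F b j)
      + bil M (vD b) vZ * (cα F b i * cω F b j + cω F b i * cα F b j)
      + bil M (vN F b) vZ * (cω F b i * cy j + cy i * cω F b j)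
      + bil M vZ vZ * (cω F b i * cω F b j)
      + bil M (vD b) (vN F b) * (cα F b i * cy j + cy i * cα F b j)
      + bil M (vN F b) (vN F b) * (cy i * cy j) := by
    have h10 := hM 1 0
    have h20 := hM 2 0
    have h21 := hM 2 1
    intro i j
    rw [hs]
    fin_cases i <;> fin_cases j <;>
      simp [bil, vD, vN, vZ, cα, cω, cy, Fin.sum_univ_three, h10, h20, h21] <;> ring
  ext i j
  rw [expand i j, hNN, hDN, hNZ, hDZ', hZZ']
  simp [G3]
  ring

/-! ### Dependence on `p` -/

lemma hasDerivAt_cω (hF : ContDiffOn ℝ ∞ F U) (hb : b ∈ U) (i : Fin 3) :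
    HasDerivAt (fun t : ℝ => cω F (b + t • Pi.single 3 1) i) (-cα F b i) 0 := by
  fin_cases i
  · exact (hasDerivAt_coord b).fun_neg
  · exact (hasDerivAt_Fp hF hb 0).fun_neg
  · simpa [cω, cα] using hasDerivAt_const (0 : ℝ) (1 : ℝ)

lemma hasDerivAt_cα (hF : ContDiffOn ℝ ∞ F U) (hb : b ∈ U) (i : Fin 3) :
    HasDerivAt (fun t : ℝ => cα F (b + t • Pi.single 3 1) i) (Fp F 2 b * cy i) 0 := by
  fin_cases i
  · simpa [cα, cy] using hasDerivAt_const (0 : ℝ) (1 : ℝ)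
  · simpa [cα, cy] using hasDerivAt_Fp hF hb 1
  · simpa [cα, cy] using hasDerivAt_const (0 : ℝ) (0 : ℝ)

lemma hasDerivAt_hfac (hF : ContDiffOn ℝ ∞ F U) (hb : b ∈ U) (h2 : Fp F 2 b ≠ 0) :
    HasDerivAt (fun t : ℝ => hfac F (b + t • Pi.single 3 1))
      (-(2 / 3) * (Fp F 3 b / Fp F 2 b) * hfac F b) 0 := by
  refine (((hasDerivAt_Fp hF hb 2).log (by simpa using h2)).const_mul (-(2 / 3))).exp.congr_deriv ?_
  simp [hfac]; ring

/-- By `∂_p ω¹ = -(dx + F_p dy)` and `∂_p (dx + F_p dy) = F_pp dy`, the coefficients of `G3` and the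
factor `hfac` make every component cancel except `ω¹ω¹`. What is left there is Monge's equation,
which says that at fixed `(x, y, z)` the curve `p ↦ F` is an arc of a conic. -/
lemma hasDerivAt_g3 (hF : ContDiffOn ℝ ∞ F U) (hb : b ∈ U) (h2 : Fp F 2 b ≠ 0) (i j : Fin 3) :
    HasDerivAt (fun t : ℝ => g3 F (b + t • Pi.single 3 1) i j)
      (-(hfac F b * Monge F b / (27 * Fp F 2 b ^ 3) * (cω F b i * cω F b j))) 0 := by
  have f2 := hasDerivAt_Fp hF hb 2
  have f3 := hasDerivAt_Fp hF hb 3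
  have f4 := hasDerivAt_Fp hF hb 4
  have hi := hasDerivAt_cω hF hb i
  have hj := hasDerivAt_cω hF hb j
  have ai := hasDerivAt_cα hF hb i
  have aj := hasDerivAt_cα hF hb j
  refine ((hasDerivAt_hfac hF hb h2).fun_mul ((((ai.fun_mul aj).fun_sub
    ((f3.fun_div (f2.const_mul 3) (by simpa using h2)).fun_mul
      ((ai.fun_mul hj).fun_add (hi.fun_mul aj)))).fun_add
    (f2.fun_mul ((hi.mul_const (cy j)).fun_add (hj.const_mul (cy i))))).fun_add
    (((((f3.fun_pow 2).const_mul 5).fun_sub ((f2.const_mul 3).fun_mul f4)).fun_div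
      ((f2.fun_pow 2).const_mul 9) (by simpa using h2)).fun_mul (hi.fun_mul hj)))).congr_deriv ?_
  simp only [zero_smul, add_zero, Monge]
  field_simp
  ring

/-! ### Smoothness -/

variable (hF : ContDiffOn ℝ ∞ F U) (h2 : ∀ b ∈ U, Fp F 2 b ≠ 0)

lemma contDiffOn_coord (i : Fin 4) : ContDiffOn ℝ ∞ (fun b : Fin 4 → ℝ => b i) U :=
  (contDiff_apply ℝ ℝ i).contDiffOn

include hF in
lemma contDiffOn_cω (i : Fin 3) : ContDiffOn ℝ ∞ (fun b => cω F b i) U := by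
  fin_cases i
  · exact (contDiffOn_coord 3).neg
  · exact hF.neg
  · exact contDiffOn_const

include hF in
lemma contDiffOn_cα (i : Fin 3) : ContDiffOn ℝ ∞ (fun b => cα F b i) U := by
  fin_cases i
  · exact contDiffOn_const
  · exact contDiffOn_Fp hF 1
  · exact contDiffOn_const

include hF h2

lemma contDiffOn_g3 (i j : Fin 3) : ContDiffOn ℝ ∞ (fun b => g3 F b i j) U := by
  have f2 := contDiffOn_Fp hF 2
  have f3 := contDiffOn_Fp hF 3
  have f4 := contDiffOn_Fp hF 4
  have hi := contDiffOn_cω hF i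
  have hj := contDiffOn_cω hF j
  have ai := contDiffOn_cα hF i
  have aj := contDiffOn_cα hF j
  refine ContDiffOn.mul ((contDiffOn_const.mul (f2.log h2)).exp) ?_
  refine (((ai.mul aj).sub ((f3.div (contDiffOn_const.mul f2) ?_).mul
    ((ai.mul hj).add (hi.mul aj)))).add
    (f2.mul ((hi.mul contDiffOn_const).add (contDiffOn_const.mul hj)))).add
    (((((contDiffOn_const.mul (f3.pow 2)).sub ((contDiffOn_const.mul f2).mul f4)).div
      (contDiffOn_const.mul (f2.pow 2)) ?_).mul (hi.mul hj)))
  · intro b hb; simpa using h2 b hb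
  · intro b hb; simpa using h2 b hb

lemma contDiffOn_rz : ContDiffOn ℝ ∞ (rz F) U := by
  have f := contDiffOn_Fp hF
  have d := contDiffOn_ΔFp hF
  have z := contDiffOn_Fpz hF
  refine (contDiffOn_const.div (contDiffOn_const.mul ((f 2).pow 4)) ?_).mul ?_
  · intro b hb; simpa using h2 b hb
  · fun_prop

lemma contDiffOn_rx : ContDiffOn ℝ ∞ (rx F) U := by
  have f := contDiffOn_Fp hF
  have d := contDiffOn_ΔFp hF
  have z := contDiffOn_Fpz hF
  refine (contDiffOn_const.div (contDiffOn_const.mul ((f 2).pow 4)) ?_).mul ?_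
  · intro b hb; simpa using h2 b hb
  · fun_prop

lemma contDiffOn_ry : ContDiffOn ℝ ∞ (ry F) U := by
  have f := contDiffOn_Fp hF
  have d := contDiffOn_ΔFp hF
  have z := contDiffOn_Fpz hF
  refine (contDiffOn_const.div (contDiffOn_const.mul ((f 2).pow 4)) ?_).mul ?_
  · intro b hb; simpa using h2 b hb
  · fun_prop

end Metric

/-! ### Functions that do not depend on `p` -/

section Basic

variable {U : Opens (Fin 4 → ℝ)} {f g : (Fin 4 → ℝ) → ℝ}

/-- Smooth functions on `U` with vanishing `p`-derivative. -/
structure IsBasic (U : Opens (Fin 4 → ℝ)) (f : (Fin 4 → ℝ) → ℝ) : Prop where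
  smooth : ContDiffOn ℝ ∞ f U
  pd_three : ∀ b ∈ U, pd 3 f b = 0

lemma differentiableAt_of_smooth (hf : ContDiffOn ℝ ∞ f U) {b : Fin 4 → ℝ} (hb : b ∈ U) :
    DifferentiableAt ℝ f b :=
  differentiableAt_of_contDiffOn U.isOpen hf hb

lemma IsBasic.differentiableAt (hf : IsBasic U f) {b : Fin 4 → ℝ} (hb : b ∈ U) :
    DifferentiableAt ℝ f b :=
  differentiableAt_of_smooth hf.smooth hb

lemma isBasic_const (c : ℝ) : IsBasic U fun _ => c :=
  ⟨contDiffOn_const, fun _ _ => pd_const _ _⟩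

lemma IsBasic.add (hf : IsBasic U f) (hg : IsBasic U g) : IsBasic U fun b => f b + g b :=
  ⟨hf.smooth.add hg.smooth, fun b hb => by
    rw [pd_add (hf.differentiableAt hb) (hg.differentiableAt hb), hf.pd_three b hb,
      hg.pd_three b hb, add_zero]⟩

lemma IsBasic.mul (hf : IsBasic U f) (hg : IsBasic U g) : IsBasic U fun b => f b * g b :=
  ⟨hf.smooth.mul hg.smooth, fun b hb => by
    rw [pd_mul (hf.differentiableAt hb) (hg.differentiableAt hb), hf.pd_three b hb,
      hg.pd_three b hb]; ring⟩

lemma IsBasic.neg (hf : IsBasic U f) : IsBasic U fun b => -f b := by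
  simpa using (isBasic_const (-1)).mul hf

lemma IsBasic.sub (hf : IsBasic U f) (hg : IsBasic U g) : IsBasic U fun b => f b - g b := by
  simpa [sub_eq_add_neg] using hf.add hg.neg

lemma IsBasic.sum {ι : Type*} {s : Finset ι} {f : ι → (Fin 4 → ℝ) → ℝ}
    (hf : ∀ k ∈ s, IsBasic U (f k)) : IsBasic U fun b => ∑ k ∈ s, f k b :=
  ⟨ContDiffOn.sum fun k hk => (hf k hk).smooth, fun b hb => by
    rw [pd_sum fun k hk => (hf k hk).differentiableAt hb]
    exact Finset.sum_eq_zero fun k hk => (hf k hk).pd_three b hb⟩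

/-- The derivative with respect to one of the coordinates `(x, y, z)`. -/
noncomputable def dd (i : Fin 3) (f : (Fin 4 → ℝ) → ℝ) (b : Fin 4 → ℝ) : ℝ := pd i.castSucc f b

lemma contDiffOn_dd (hf : ContDiffOn ℝ ∞ f U) (i : Fin 3) : ContDiffOn ℝ ∞ (dd i f) U :=
  contDiffOn_pd U.isOpen hf _

lemma dd_comm (hf : ContDiffOn ℝ ∞ f U) {b : Fin 4 → ℝ} (hb : b ∈ U) (i j : Fin 3) :
    dd i (dd j f) b = dd j (dd i f) b :=
  pd_comm U.isOpen hf hb _ _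

lemma IsBasic.dd (hf : IsBasic U f) (i : Fin 3) : IsBasic U (dd i f) :=
  ⟨contDiffOn_dd hf.smooth i, fun b hb => by
    have : pd 3 (pd i.castSucc f) b = 0 := by
      rw [pd_comm U.isOpen hf.smooth hb, pd_congr U.isOpen hf.pd_three hb, pd_const]
    exact this⟩

end Basic

/-! ### The Weyl connection of the normalised metric -/

section Connection

variable {U : Opens (Fin 4 → ℝ)} {F : (Fin 4 → ℝ) → ℝ} {b : Fin 4 → ℝ}

/-- The coefficients `r_x, r_y, r_z`. -/
noncomputable def r3 (F : (Fin 4 → ℝ) → ℝ) (i : Fin 3) : (Fin 4 → ℝ) → ℝ := ![rx F, ry F, rz F] i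

/-- The inverse of the normalised metric. -/
noncomputable def gi (F : (Fin 4 → ℝ) → ℝ) (b : Fin 4 → ℝ) : Matrix (Fin 3) (Fin 3) ℝ :=
  -(g3 F b).adjugate

/-- The Christoffel symbols of the first kind of the normalised metric. -/
noncomputable def chr (F : (Fin 4 → ℝ) → ℝ) (l i j : Fin 3) (b : Fin 4 → ℝ) : ℝ :=
  1 / 2 * (dd i (fun b => g3 F b j l) b + dd j (fun b => g3 F b i l) b
    - dd l (fun b => g3 F b i j) b)

/-- The coefficients of the Weyl connection of the normalised metric and `r`. -/
noncomputable def Γ3 (F : (Fin 4 → ℝ) → ℝ) (k i j : Fin 3) (b : Fin 4 → ℝ) : ℝ :=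
  ∑ l, gi F b k l * (chr F l i j b + g3 F b i j * r3 F l b)
    - (1 : Matrix (Fin 3) (Fin 3) ℝ) k i * r3 F j b
    - (1 : Matrix (Fin 3) (Fin 3) ℝ) k j * r3 F i b

lemma g3_mul_gi (h2 : Fp F 2 b ≠ 0) : g3 F b * gi F b = 1 := by
  rw [gi, mul_neg, Matrix.mul_adjugate, det_g3 h2]; simp

lemma chr_symm (l i j : Fin 3) : chr F l i j b = chr F l j i b := by
  have : (fun b => g3 F b i j) = fun b => g3 F b j i := funext fun b => g3_symm i j
  rw [chr, chr, this]; ring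

lemma Γ3_symm (k i j : Fin 3) : Γ3 F k i j b = Γ3 F k j i b := by
  simp only [Γ3, chr_symm _ i j, g3_symm i j]; ring

/-- Lowering the index removes the inverse metric; compatibility, the Koszul formula and the
curvature symmetry only need this form. -/
lemma g3_mul_Γ3 (h2 : Fp F 2 b ≠ 0) (m i j : Fin 3) :
    ∑ k, g3 F b m k * Γ3 F k i j b = chr F m i j b + g3 F b i j * r3 F m b
      - g3 F b m i * r3 F j b - g3 F b m j * r3 F i b := by
  have h1 : ∀ l, ∑ k, g3 F b m k * gi F b k l = (1 : Matrix (Fin 3) (Fin 3) ℝ) m l := fun l => by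
    rw [← g3_mul_gi h2, Matrix.mul_apply]
  have h3 : ∀ a, ∑ k, g3 F b m k * (1 : Matrix (Fin 3) (Fin 3) ℝ) k a = g3 F b m a := fun a => by
    rw [← Matrix.mul_apply, mul_one]
  simp only [Γ3, mul_sub, Finset.sum_sub_distrib, Finset.mul_sum, ← mul_assoc]
  rw [Finset.sum_comm]
  simp only [← Finset.sum_mul, h1, h3]
  simp [Matrix.one_apply]

lemma Γ3_compatible (h2 : Fp F 2 b ≠ 0) (m n s : Fin 3) :
    dd s (fun b => g3 F b m n) b - ∑ k, g3 F b m k * Γ3 F k n s b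
      - ∑ k, g3 F b n k * Γ3 F k m s b = 2 * r3 F s b * g3 F b m n := by
  have hs : ∀ i j, (fun b => g3 F b i j) = fun b => g3 F b j i :=
    fun i j => funext fun b => g3_symm i j
  rw [g3_mul_Γ3 h2, g3_mul_Γ3 h2, chr, chr, hs s m, hs n m, hs s n, g3_symm n m]
  ring

/-! ### Smoothness and `p`-derivatives of the metric, the 1-form and the connection -/

section Smooth

variable (hF : ContDiffOn ℝ ∞ F U) (h2 : ∀ b ∈ U, Fp F 2 b ≠ 0)
include hF h2

lemma contDiffOn_r3 (i : Fin 3) : ContDiffOn ℝ ∞ (r3 F i) U := by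
  fin_cases i
  · exact contDiffOn_rx hF h2
  · exact contDiffOn_ry hF h2
  · exact contDiffOn_rz hF h2

lemma pd_three_r3 (hb : b ∈ U) (i : Fin 3) :
    pd 3 (r3 F i) b = KInv F b / (3 * Fp F 2 b ^ 5) * cω F b i := by
  refine pd_eq_of_hasDerivAt (differentiableAt_of_smooth (contDiffOn_r3 hF h2 i) hb) ?_
  fin_cases i
  · exact (hasDerivAt_rx hF hb (h2 b hb) h2).congr_deriv (by simp [cω]; ring)
  · exact (hasDerivAt_ry hF hb (h2 b hb) h2).congr_deriv (by simp [cω]; ring)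
  · exact (hasDerivAt_rz hF hb (h2 b hb)).congr_deriv (by simp [cω])

lemma pd_three_g3 (hb : b ∈ U) (i j : Fin 3) :
    pd 3 (fun b => g3 F b i j) b
      = -(hfac F b * Monge F b / (27 * Fp F 2 b ^ 3) * (cω F b i * cω F b j)) :=
  pd_eq_of_hasDerivAt (differentiableAt_of_smooth (contDiffOn_g3 hF h2 i j) hb)
    (hasDerivAt_g3 hF hb (h2 b hb) i j)

lemma isBasic_r3 (hK : ∀ b ∈ U, KInv F b = 0) (i : Fin 3) : IsBasic U (r3 F i) :=
  ⟨contDiffOn_r3 hF h2 i, fun b hb => by rw [pd_three_r3 hF h2 hb, hK b hb]; simp⟩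

lemma isBasic_g3 (hM : ∀ b ∈ U, Monge F b = 0) (i j : Fin 3) : IsBasic U fun b => g3 F b i j :=
  ⟨contDiffOn_g3 hF h2 i j, fun b hb => by rw [pd_three_g3 hF h2 hb, hM b hb]; simp⟩

/-- The `dz` coefficient of `ω¹` is `1`, so this single component detects `K`. -/
lemma kInv_eq_zero_of_pd (hr : ∀ b ∈ U, pd 3 (r3 F 2) b = 0) : ∀ b ∈ U, KInv F b = 0 := by
  intro b hb
  have := hr b hb
  rw [pd_three_r3 hF h2 hb] at this
  simpa [cω, h2 b hb] using this

lemma isBasic_gi (hM : ∀ b ∈ U, Monge F b = 0) (i j : Fin 3) : IsBasic U fun b => gi F b i j := by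
  have hg := isBasic_g3 hF h2 hM
  simp only [gi, Matrix.adjugate_fin_three]
  fin_cases i <;> fin_cases j <;>
    simp only [Matrix.neg_apply, Matrix.of_apply, Matrix.cons_val', Matrix.cons_val,
      Fin.reduceFinMk, Fin.isValue, Fin.zero_eta, Fin.mk_one] <;>
    apply IsBasic.neg <;>
    first
      | exact ((hg _ _).mul (hg _ _)).sub ((hg _ _).mul (hg _ _))
      | exact ((hg _ _).mul (hg _ _)).neg.add ((hg _ _).mul (hg _ _))

lemma isBasic_Γ3 (hM : ∀ b ∈ U, Monge F b = 0) (hK : ∀ b ∈ U, KInv F b = 0) (k i j : Fin 3) :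
    IsBasic U (Γ3 F k i j) := by
  have hg := isBasic_g3 hF h2 hM
  have hr := isBasic_r3 hF h2 hK
  exact ((IsBasic.sum fun l _ => (isBasic_gi hF h2 hM k l).mul
    (((isBasic_const _).mul ((((hg j l).dd i).add ((hg i l).dd j)).sub ((hg i j).dd l))).add
      ((hg i j).mul (hr l)))).sub ((isBasic_const _).mul (hr j))).sub
    ((isBasic_const _).mul (hr i))

end Smooth

end Connection

/-! ### Derivatives along lines with constant `p` -/

section Lines

variable {U : Opens (Fin 4 → ℝ)} {F f : (Fin 4 → ℝ) → ℝ} {b : Fin 4 → ℝ}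

/-- The lift of a vector in `(x, y, z)`-space with vanishing `p`-component. -/
def emb (v : Fin 3 → ℝ) : Fin 4 → ℝ := ![v 0, v 1, v 2, 0]

/-- The derivative at constant `p` in the direction `v`. -/
noncomputable def dv (v : Fin 3 → ℝ) (f : (Fin 4 → ℝ) → ℝ) (b : Fin 4 → ℝ) : ℝ :=
  ∑ i, v i * dd i f b

lemma hasDerivAt_emb (hf : DifferentiableAt ℝ f b) (v : Fin 3 → ℝ) :
    HasDerivAt (fun t : ℝ => f (b + t • emb v)) (dv v f b) 0 := by
  refine (hasDerivAt_line hf (emb v)).congr_deriv ?_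
  simp [Fin.sum_univ_four, Fin.sum_univ_three, emb, dv, dd]

lemma eventually_emb_mem (hb : b ∈ U) (v : Fin 3 → ℝ) :
    ∀ᶠ t in nhds (0 : ℝ), b + t • emb v ∈ U :=
  (Continuous.tendsto' (by fun_prop) 0 b (by simp)).eventually (U.isOpen.mem_nhds hb)

@[simp] lemma emb_three (v : Fin 3 → ℝ) : emb v 3 = 0 := rfl

lemma hasDerivAt_bil {M : ℝ → Matrix (Fin 3) (Fin 3) ℝ} {v w : ℝ → Fin 3 → ℝ}
    {M' : Matrix (Fin 3) (Fin 3) ℝ} {v' w' : Fin 3 → ℝ} {t : ℝ}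
    (hM : ∀ i j, HasDerivAt (fun t => M t i j) (M' i j) t)
    (hv : ∀ i, HasDerivAt (fun t => v t i) (v' i) t)
    (hw : ∀ i, HasDerivAt (fun t => w t i) (w' i) t) :
    HasDerivAt (fun t => bil (M t) (v t) (w t))
      (bil M' (v t) (w t) + bil (M t) v' (w t) + bil (M t) (v t) w') t := by
  refine (HasDerivAt.fun_sum fun i _ => HasDerivAt.fun_sum fun j _ =>
    ((hM i j).fun_mul (hv i)).fun_mul (hw j)).congr_deriv ?_
  simp only [bil, ← Finset.sum_add_distrib]
  refine Finset.sum_congr rfl fun i _ => Finset.sum_congr rfl fun j _ => ?_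
  ring

lemma bil_add_right (M : Matrix (Fin 3) (Fin 3) ℝ) (v w w' : Fin 3 → ℝ) :
    bil M v (w + w') = bil M v w + bil M v w' := by
  simp [bil, Fin.sum_univ_three]; ring

lemma bil_smul_right (M : Matrix (Fin 3) (Fin 3) ℝ) (v w : Fin 3 → ℝ) (c : ℝ) :
    bil M v (c • w) = c * bil M v w := by
  simp [bil, Fin.sum_univ_three]; ring

lemma bil_symm {M : Matrix (Fin 3) (Fin 3) ℝ} (hM : ∀ i j, M i j = M j i) (v w : Fin 3 → ℝ) :
    bil M v w = bil M w v := by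
  have h10 := hM 1 0
  have h20 := hM 2 0
  have h21 := hM 2 1
  simp only [bil, Fin.sum_univ_three, h10, h20, h21]; ring

lemma hasDerivAt_vD_emb (v : Fin 3 → ℝ) (i : Fin 3) :
    HasDerivAt (fun t : ℝ => vD (b + t • emb v) i) ((0 : Fin 3 → ℝ) i) 0 := by
  simpa [vD] using hasDerivAt_const (0 : ℝ) (vD b i)

lemma hasDerivAt_vN_emb (hF : ContDiffOn ℝ ∞ F U) (hb : b ∈ U) (v : Fin 3 → ℝ) (i : Fin 3) :
    HasDerivAt (fun t : ℝ => vN F (b + t • emb v) i)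
      ((-dv v (Fp F 1) b • vD b + dv v F b • vZ) i) 0 := by
  have f0 := hasDerivAt_emb (differentiableAt_of_smooth hF hb) v
  have f1 := hasDerivAt_emb (differentiableAt_Fp hF hb 1) v
  fin_cases i
  · exact f1.fun_neg.congr_deriv (by simp [vD, vZ])
  · exact (hasDerivAt_const (0 : ℝ) (1 : ℝ)).congr_deriv (by simp [vD, vZ])
  · have := f0.fun_sub (f1.const_mul (b 3))
    refine (this.congr_of_eventuallyEq (.of_forall fun t => ?_)).congr_deriv ?_
    · simp [vN]
    · simp [vD, vZ]; ring

lemma hasDerivAt_cω_emb (hF : ContDiffOn ℝ ∞ F U) (hb : b ∈ U) (v : Fin 3 → ℝ) (i : Fin 3) :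
    HasDerivAt (fun t : ℝ => cω F (b + t • emb v) i) ((-dv v F b • cy) i) 0 := by
  fin_cases i
  · simpa [cω, cy] using hasDerivAt_const (0 : ℝ) (-b 3)
  · simpa [cω, cy] using (hasDerivAt_emb (differentiableAt_of_smooth hF hb) v).fun_neg
  · simpa [cω, cy] using hasDerivAt_const (0 : ℝ) (1 : ℝ)

end Lines

/-! ### Consequences of `DF = 0` -/

section DF

variable {U : Opens (Fin 4 → ℝ)} {F f : (Fin 4 → ℝ) → ℝ} {b : Fin 4 → ℝ}
  (hF : ContDiffOn ℝ ∞ F U) (hDF : ∀ b ∈ U, DF F b = 0)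

lemma dv_vD (f : (Fin 4 → ℝ) → ℝ) : dv (vD b) f b = pd 0 f b + b 3 * pd 2 f b := by
  simp [dv, Fin.sum_univ_three, vD, dd]

lemma dv_vN (k : ℕ) :
    dv (vN F b) (Fp F k) b = ΔFp F k b - Fp F 1 b * dv (vD b) (Fp F k) b := by
  simp [dv, Fin.sum_univ_three, vD, vN, dd, ΔFp]; ring

include hDF in
lemma dv_vD_F (hb : b ∈ U) : dv (vD b) F b = 0 := by rw [dv_vD]; exact hDF b hb

include hF in
-- The coefficient `p` of `D` contributes a term: `∂_p D = D ∂_p + ∂_z`.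
lemma pd_three_D (hb : b ∈ U) (k : ℕ) :
    HasDerivAt (fun t : ℝ => pd 0 (Fp F k) (b + t • Pi.single 3 1)
      + (b + t • Pi.single (3 : Fin 4) (1 : ℝ) : Fin 4 → ℝ) 3 * Fpz F k (b + t • Pi.single 3 1))
      (dv (vD b) (Fp F (k + 1)) b + Fpz F k b) 0 := by
  have hk := contDiffOn_Fp hF k
  have h0 := hasDerivAt_line_pd
    (differentiableAt_of_smooth (contDiffOn_pd U.isOpen hk 0) hb) 3
  rw [pd_comm U.isOpen hk hb, ← Fp_succ] at h0
  refine (h0.fun_add ((hasDerivAt_coord b).fun_mul (hasDerivAt_Fpz hF hb k))).congr_deriv ?_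
  simp [dv_vD, Fpz]; ring

include hF hDF

/-- The `p`-derivative of `DF = 0`. It is stated on all of `U` because the next lemma differentiates
it once more. -/
lemma dv_vD_Fp_one : ∀ b ∈ U, dv (vD b) (Fp F 1) b = -Fpz F 0 b := by
  intro b hb
  have hU : ∀ᶠ t in nhds (0 : ℝ), b + t • Pi.single (3 : Fin 4) (1 : ℝ) ∈ U :=
    (Continuous.tendsto' (by fun_prop) 0 b (by simp)).eventually (U.isOpen.mem_nhds hb)
  have h := ((pd_three_D hF hb 0).congr_of_eventuallyEq (f₁ := fun _ => 0) (by
    filter_upwards [hU] with t ht using (hDF _ ht).symm)).unique (hasDerivAt_const _ _)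
  linear_combination h

lemma dv_vD_Fp_two (hb : b ∈ U) : dv (vD b) (Fp F 2) b = -2 * Fpz F 1 b := by
  have hU : ∀ᶠ t in nhds (0 : ℝ), b + t • Pi.single (3 : Fin 4) (1 : ℝ) ∈ U :=
    (Continuous.tendsto' (by fun_prop) 0 b (by simp)).eventually (U.isOpen.mem_nhds hb)
  have h := ((pd_three_D hF hb 1).congr_of_eventuallyEq
    (f₁ := fun t => -Fpz F 0 (b + t • Pi.single 3 1)) (by
    filter_upwards [hU] with t ht
    rw [← dv_vD_Fp_one hF hDF _ ht, dv_vD]; rfl)).unique (hasDerivAt_Fpz hF hb 0).fun_neg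
  linear_combination h

omit hF in
lemma dv_vN_F (hb : b ∈ U) : dv (vN F b) F b = ΔFp F 0 b := by
  have := dv_vN (F := F) (b := b) 0
  rw [show Fp F 0 = F from rfl, dv_vD_F hDF hb] at this
  simpa using this

/-- At constant `p` the commutator `[D, Δ]` is `(DF) ∂_z = 0`, so `D(ΔF) = Δ(DF) = 0`. -/
lemma dv_vD_ΔF (hb : b ∈ U) : dv (vD b) (ΔFp F 0) b = 0 := by
  have hd : ∀ {g : (Fin 4 → ℝ) → ℝ}, ContDiffOn ℝ ∞ g U → DifferentiableAt ℝ g b :=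
    fun h => differentiableAt_of_smooth h hb
  have hp := fun i => contDiffOn_pd U.isOpen hF i
  have expand : ∀ i, pd i (ΔFp F 0) b
      = pd i (pd 1 F) b + (pd i F b * pd 2 F b + F b * pd i (pd 2 F) b) := by
    intro i
    rw [← pd_mul (hd hF) (hd (hp 2)), ← pd_add (hd (hp 1)) ((hd hF).fun_mul (hd (hp 2)))]
    rfl
  -- Derivatives of `DF = 0` in directions that keep `p` fixed, so the coefficient `p` passes
  -- through.
  have hD : ∀ i : Fin 4, i ≠ 3 → pd i (pd 0 F) b + b 3 * pd i (pd 2 F) b = 0 := by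
    intro i hi
    have h0 : pd i (DF F) b = 0 := by rw [pd_congr U.isOpen hDF hb, pd_const]
    have hc : pd i (fun b : Fin 4 → ℝ => b 3) b = 0 := by
      have : (fun b : Fin 4 → ℝ => b 3)
        = (ContinuousLinearMap.proj 3 : (Fin 4 → ℝ) →L[ℝ] ℝ) := rfl
      rw [pd, this, ContinuousLinearMap.fderiv]
      simp [hi.symm]
    have hcd : DifferentiableAt ℝ (fun b : Fin 4 → ℝ => b 3) b := by fun_prop
    have h1 : pd i (DF F) b = pd i (pd 0 F) b + b 3 * pd i (pd 2 F) b := by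
      have : DF F = fun b => pd 0 F b + b 3 * pd 2 F b := rfl
      rw [this, pd_add (hd (hp 0)) (hcd.fun_mul (hd (hp 2))), pd_mul hcd (hd (hp 2)), hc]
      ring
    rw [← h1, h0]
  have h1 := hD 1 (by decide)
  have h2 := hD 2 (by decide)
  have h0 := hDF b hb
  rw [pd_comm U.isOpen hF hb] at h1 h2
  rw [pd_comm U.isOpen hF hb 1 2] at h1
  rw [dv_vD, expand, expand]
  simp only [DF] at h0
  linear_combination h1 + F b * h2 + pd 2 F b * h0

end DF

/-! ### The surfaces `ω¹ = 0`, `p = const` are totally geodesic -/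

section Geodesic

variable {U : Opens (Fin 4 → ℝ)} {F f : (Fin 4 → ℝ) → ℝ} {b : Fin 4 → ℝ}

/-- The vector `Δ = ∂_y + F ∂_z`. -/
def vΔ (F : (Fin 4 → ℝ) → ℝ) (b : Fin 4 → ℝ) : Fin 3 → ℝ := ![0, 1, F b]

/-- The connection matrix in the direction `v`. -/
noncomputable def Γc (F : (Fin 4 → ℝ) → ℝ) (v : Fin 3 → ℝ) (b : Fin 4 → ℝ) :
    Matrix (Fin 3) (Fin 3) ℝ :=
  Matrix.of fun k j => ∑ s, v s * Γ3 F k j s b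

/-- The derivative at constant `p` of the normalised metric. -/
noncomputable def dg (F : (Fin 4 → ℝ) → ℝ) (v : Fin 3 → ℝ) (b : Fin 4 → ℝ) :
    Matrix (Fin 3) (Fin 3) ℝ :=
  Matrix.of fun i j => dv v (fun b => g3 F b i j) b

/-- Lowering the index of `N` gives a multiple of `ω¹`: the plane `ω¹ = 0` is null, with `N` as its
normal. -/
lemma sum_vN_g3 (j : Fin 3) :
    ∑ i, vN F b i * g3 F b i j = hfac F b * Fp F 2 b * cω F b j := by
  fin_cases j <;> simp [Fin.sum_univ_three, vN, g3, G3, cω, cα, cy] <;> ring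

/-- `bil (Γc F X b) (cω F b) Y` is `ω¹(Γ(X, Y))`. By `sum_vN_g3` it is a metric product with `N`, so
the Koszul formula with the Weyl correction computes it. For `X, Y` tangent to the plane only `r(N)`
survives. -/
lemma koszul (h2 : Fp F 2 b ≠ 0) (X Y : Fin 3 → ℝ) :
    hfac F b * Fp F 2 b * bil (Γc F X b) (cω F b) Y
      = 1 / 2 * (bil (dg F Y b) X (vN F b) + bil (dg F X b) Y (vN F b)
          - bil (dg F (vN F b) b) X Y)
        + bil (g3 F b) X Y * (∑ i, vN F b i * r3 F i b)
        - bil (g3 F b) Y (vN F b) * (∑ i, X i * r3 F i b)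
        - bil (g3 F b) X (vN F b) * (∑ i, Y i * r3 F i b) := by
  have h1 : hfac F b * Fp F 2 b * bil (Γc F X b) (cω F b) Y
      = ∑ m, ∑ j, ∑ s, vN F b m * Y j * X s * ∑ k, g3 F b m k * Γ3 F k j s b := by
    have : hfac F b * Fp F 2 b * bil (Γc F X b) (cω F b) Y
      = ∑ k, (hfac F b * Fp F 2 b * cω F b k) * ∑ j, ∑ s, Y j * X s * Γ3 F k j s b := by
      simp only [bil, Γc, Matrix.of_apply, Fin.sum_univ_three]; ring
    rw [this]
    simp only [← sum_vN_g3, Fin.sum_univ_three]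
    ring
  rw [h1]
  simp only [g3_mul_Γ3 h2]
  simp only [chr, dg, dv, bil, Fin.sum_univ_three, Matrix.of_apply,
    g3_symm 1 0, g3_symm 2 0, g3_symm 2 1]
  ring

end Geodesic

/-! ### Second fundamental form of the null surfaces -/

section TotallyGeodesic

variable {U : Opens (Fin 4 → ℝ)} {F : (Fin 4 → ℝ) → ℝ} {b : Fin 4 → ℝ}
  (hF : ContDiffOn ℝ ∞ F U) (hDF : ∀ b ∈ U, DF F b = 0) (h2 : ∀ b ∈ U, Fp F 2 b ≠ 0)

lemma g3_vN_vD : bil (g3 F b) (vN F b) (vD b) = 0 := by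
  rw [bil_symm g3_symm, g3_vD_vN]

lemma r3_vN (h2 : Fp F 2 b ≠ 0) : ∑ i, vN F b i * r3 F i b = rN F b := by
  simp [Fin.sum_univ_three, vN, r3, rx_eq h2, ry_eq h2]; ring

include hF h2

lemma hasDerivAt_bil_g3 (hb : b ∈ U) (v : Fin 3 → ℝ) {X Y : (Fin 4 → ℝ) → Fin 3 → ℝ}
    {X' Y' : Fin 3 → ℝ} (hX : ∀ i, HasDerivAt (fun t : ℝ => X (b + t • emb v) i) (X' i) 0)
    (hY : ∀ i, HasDerivAt (fun t : ℝ => Y (b + t • emb v) i) (Y' i) 0) :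
    HasDerivAt (fun t : ℝ => bil (g3 F (b + t • emb v)) (X (b + t • emb v)) (Y (b + t • emb v)))
      (bil (dg F v b) (X b) (Y b) + bil (g3 F b) X' (Y b) + bil (g3 F b) (X b) Y') 0 := by
  have := hasDerivAt_bil (M := fun t : ℝ => g3 F (b + t • emb v)) (M' := dg F v b)
    (fun i j => hasDerivAt_emb (differentiableAt_of_smooth (contDiffOn_g3 hF h2 i j) hb) v) hX hY
  simpa only [zero_smul, add_zero] using this

lemma dg_vD_vN (hb : b ∈ U) (v : Fin 3 → ℝ) :
    bil (dg F v b) (vD b) (vN F b)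
      = dv v (Fp F 1) b * hfac F b - dv v F b * bil (g3 F b) (vD b) vZ := by
  have h := (hasDerivAt_bil_g3 hF h2 hb v (hasDerivAt_vD_emb v)
    (hasDerivAt_vN_emb hF hb v)).unique
    ((hasDerivAt_const (0 : ℝ) (0 : ℝ)).congr_of_eventuallyEq (.of_forall fun t => g3_vD_vN))
  have h0 : bil (g3 F b) 0 (vN F b) = 0 := by simp [bil]
  rw [h0, bil_add_right, bil_smul_right, bil_smul_right, g3_vD_vD] at h
  linear_combination h

lemma dg_vN_vN (hb : b ∈ U) (v : Fin 3 → ℝ) :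
    bil (dg F v b) (vN F b) (vN F b) = -2 * dv v F b * (hfac F b * Fp F 2 b) := by
  have h := (hasDerivAt_bil_g3 hF h2 hb v (hasDerivAt_vN_emb hF hb v)
    (hasDerivAt_vN_emb hF hb v)).unique
    ((hasDerivAt_const (0 : ℝ) (0 : ℝ)).congr_of_eventuallyEq (.of_forall fun t => g3_vN_vN))
  rw [bil_symm (M := g3 F b) g3_symm _ (vN F b), bil_add_right, bil_smul_right, bil_smul_right,
    g3_vN_vD, g3_vN_vZ] at h
  linear_combination h

lemma dv_hfac (hb : b ∈ U) (v : Fin 3 → ℝ) : HasDerivAt (fun t : ℝ => hfac F (b + t • emb v))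
    (-(2 / 3) * (dv v (Fp F 2) b / Fp F 2 b) * hfac F b) 0 := by
  refine (((hasDerivAt_emb (differentiableAt_Fp hF hb 2) v).log
    (by simpa using h2 b hb)).const_mul (-(2 / 3))).exp.congr_deriv ?_
  simp [hfac]; ring

lemma dg_vD_vD (hb : b ∈ U) (v : Fin 3 → ℝ) :
    bil (dg F v b) (vD b) (vD b) = -(2 / 3) * (dv v (Fp F 2) b / Fp F 2 b) * hfac F b := by
  have h := (hasDerivAt_bil_g3 hF h2 hb v (hasDerivAt_vD_emb v) (hasDerivAt_vD_emb v)).unique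
    ((dv_hfac hF h2 hb v).congr_of_eventuallyEq (.of_forall fun t => g3_vD_vD))
  rw [← h]; simp [bil]

include hDF

/-- This is the equation that dictates the formula for `rN`: `g(D, D) ≠ 0`, so it can be solved for
`r(N)`. -/
lemma Γc_vD_vD (hb : b ∈ U) : bil (Γc F (vD b) b) (cω F b) (vD b) = 0 := by
  have hne := h2 b hb
  have hpos := (hfac_pos (F := F) (b := b)).ne'
  have h := koszul hne (vD b) (vD b)
  rw [dg_vD_vN hF h2 hb, dg_vD_vD hF h2 hb, g3_vD_vN, g3_vD_vD, r3_vN hne, dv_vD_F hDF hb,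
    dv_vD_Fp_one hF hDF b hb, dv_vN, dv_vD_Fp_two hF hDF hb, rN] at h
  refine (mul_eq_zero.1 (h.trans ?_)).resolve_left (mul_ne_zero hpos hne)
  field_simp
  ring

/-- No condition on `r` arises here, since `N` is null and orthogonal to `D`, and `DF = 0` kills the
derivative term. -/
lemma Γc_vD_vN (hb : b ∈ U) : bil (Γc F (vD b) b) (cω F b) (vN F b) = 0 := by
  have hne := h2 b hb
  have hpos := (hfac_pos (F := F) (b := b)).ne'
  have h := koszul hne (vD b) (vN F b)
  rw [dg_vN_vN hF h2 hb, g3_vD_vN, g3_vN_vN, dv_vD_F hDF hb] at h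
  refine (mul_eq_zero.1 (h.trans ?_)).resolve_left (mul_ne_zero hpos hne)
  ring

lemma Γc_vN_vN (hb : b ∈ U) : bil (Γc F (vN F b) b) (cω F b) (vN F b) = -ΔFp F 0 b := by
  have hne := h2 b hb
  have hpos := (hfac_pos (F := F) (b := b)).ne'
  have h := koszul hne (vN F b) (vN F b)
  rw [dg_vN_vN hF h2 hb, g3_vN_vN, dv_vN_F hDF hb] at h
  refine mul_left_cancel₀ (mul_ne_zero hpos hne) (h.trans ?_)
  ring

omit hF hDF h2 in
lemma vN_eq : vN F b = vΔ F b + (-Fp F 1 b) • vD b := by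
  ext i; fin_cases i <;> simp [vN, vΔ, vD]; ring

omit hF hDF h2 in
lemma Γc_swap (X Y n : Fin 3 → ℝ) : bil (Γc F X b) n Y = bil (Γc F Y b) n X := by
  simp only [bil, Γc, Matrix.of_apply, Fin.sum_univ_three, Γ3_symm _ 1 0, Γ3_symm _ 2 0,
    Γ3_symm _ 2 1]
  ring

lemma Γc_vD_vΔ (hb : b ∈ U) : bil (Γc F (vD b) b) (cω F b) (vΔ F b) = 0 := by
  have h := Γc_vD_vN hF hDF h2 hb
  rw [vN_eq, bil_add_right, bil_smul_right, Γc_vD_vD hF hDF h2 hb] at h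
  simpa using h

/-- The components of `Δ` vary along `Δ`, contributing `ΔF ∂_z` to `∇_Δ Δ`; the value `-ΔF`
compensates this, so `ω¹(∇_Δ Δ) = 0`. -/
lemma Γc_vΔ_vΔ (hb : b ∈ U) : bil (Γc F (vΔ F b) b) (cω F b) (vΔ F b) = -ΔFp F 0 b := by
  have h := Γc_vN_vN hF hDF h2 hb
  have h' := Γc_vD_vΔ hF hDF h2 hb
  have h'' := (Γc_swap (vΔ F b) (vD b) (cω F b)).trans h'
  rw [vN_eq, bil_add_right, bil_smul_right, Γc_swap, bil_add_right, bil_smul_right, h'',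
    Γc_swap _ (vD b), bil_add_right, bil_smul_right, Γc_vD_vD hF hDF h2 hb, h'] at h
  simpa using h

end TotallyGeodesic

/-! ### Curvature -/

section Curvature

variable {U : Opens (Fin 4 → ℝ)} {F : (Fin 4 → ℝ) → ℝ} {b : Fin 4 → ℝ}

/-- The connection matrices. -/
noncomputable def ΓM (F : (Fin 4 → ℝ) → ℝ) (s : Fin 3) (b : Fin 4 → ℝ) :
    Matrix (Fin 3) (Fin 3) ℝ :=
  Matrix.of fun k j => Γ3 F k j s b

/-- The partial derivatives of the connection matrices. -/
noncomputable def dΓM (F : (Fin 4 → ℝ) → ℝ) (i s : Fin 3) (b : Fin 4 → ℝ) :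
    Matrix (Fin 3) (Fin 3) ℝ :=
  Matrix.of fun k j => dd i (Γ3 F k j s) b

/-- The curvature matrices of the Weyl connection. -/
noncomputable def Rm (F : (Fin 4 → ℝ) → ℝ) (ρ σ : Fin 3) (b : Fin 4 → ℝ) :
    Matrix (Fin 3) (Fin 3) ℝ :=
  dΓM F ρ σ b - dΓM F σ ρ b + ΓM F ρ b * ΓM F σ b - ΓM F σ b * ΓM F ρ b

/-- Cartan's commutator computation: two covector equations along commuting directions restrict
the curvature. -/
lemma bil_curvature_vD {P Q P' Q' : Matrix (Fin 3) (Fin 3) ℝ} {p f e : ℝ}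
    (hPD : bil P ![-p, -f, 1] ![1, 0, p] = 0) (hPΔ : bil P ![-p, -f, 1] ![0, 1, f] = 0)
    (hQD : bil Q ![-p, -f, 1] ![1, 0, p] = 0) (hQΔ : bil Q ![-p, -f, 1] ![0, 1, f] = -e)
    (hQ' : bil Q' ![-p, -f, 1] ![1, 0, p] = 0)
    (hP' : bil P' ![-p, -f, 1] ![1, 0, p] - e * bil P cy ![1, 0, p] = 0) :
    bil (Q' - P' + P * Q - Q * P) ![-p, -f, 1] ![1, 0, p] = 0 := by
  simp [bil, cy, Fin.sum_univ_three, Matrix.mul_apply] at *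
  -- The coefficients are the components of `Q D` and `P D` along `D` and `Δ`; the last two terms
  -- are the parts along `∂_z`, measured by `ω¹`.
  linear_combination hQ' - hP' + (Q 0 0 + p * Q 0 2) * hPD + (Q 1 0 + p * Q 1 2) * hPΔ
    - (P 0 0 + p * P 0 2) * hQD - (P 1 0 + p * P 1 2) * hQΔ
    + (-p * P 0 2 - f * P 1 2 + P 2 2) * hQD - (-p * Q 0 2 - f * Q 1 2 + Q 2 2) * hPD

lemma bil_curvature_vΔ {P Q P' Q' : Matrix (Fin 3) (Fin 3) ℝ} {p f e : ℝ}
    (hPD : bil P ![-p, -f, 1] ![1, 0, p] = 0) (hPΔ : bil P ![-p, -f, 1] ![0, 1, f] = 0)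
    (hQD : bil Q ![-p, -f, 1] ![1, 0, p] = 0) (hQΔ : bil Q ![-p, -f, 1] ![0, 1, f] = -e)
    (hQ' : bil Q' ![-p, -f, 1] ![0, 1, f] = 0)
    (hP' : bil P' ![-p, -f, 1] ![0, 1, f] - e * bil P cy ![0, 1, f]
      + e * bil P ![-p, -f, 1] vZ = 0) :
    bil (Q' - P' + P * Q - Q * P) ![-p, -f, 1] ![0, 1, f] = 0 := by
  simp [bil, cy, vZ, Fin.sum_univ_three, Matrix.mul_apply] at *
  linear_combination hQ' - hP' + (Q 0 1 + f * Q 0 2) * hPD + (Q 1 1 + f * Q 1 2) * hPΔ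
    - (P 0 1 + f * P 0 2) * hQD - (P 1 1 + f * P 1 2) * hQΔ
    + (-p * P 0 2 - f * P 1 2 + P 2 2) * hQΔ - (-p * Q 0 2 - f * Q 1 2 + Q 2 2) * hPΔ

lemma bil_mul {g M : Matrix (Fin 3) (Fin 3) ℝ} {u v : Fin 3 → ℝ}
    (h : ∀ j, ∑ i, v i * g i j = u j) (w : Fin 3 → ℝ) : bil (g * M) v w = bil M u w := by
  simp only [bil, Matrix.mul_apply, ← h, Fin.sum_univ_three]; ring

lemma bil_add_bil_of_add_transpose {g M : Matrix (Fin 3) (Fin 3) ℝ} {a : ℝ}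
    (h : g * M + (g * M).transpose = a • g) (v w : Fin 3 → ℝ) :
    bil (g * M) v w + bil (g * M) w v = a * bil g v w := by
  have : a * bil g v w = bil (g * M + (g * M).transpose) v w := by
    rw [h]; simp [bil, Fin.sum_univ_three]; ring
  rw [this]
  simp only [bil, Matrix.add_apply, Matrix.transpose_apply, Fin.sum_univ_three]; ring

/-- The normal direction of a null plane whose second fundamental form vanishes to first order is
a null direction of the Ricci tensor. -/
lemma ricci_null {g : Matrix (Fin 3) (Fin 3) ℝ} {R : Fin 3 → Fin 3 → Matrix (Fin 3) (Fin 3) ℝ}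
    {p f q c h e : ℝ} (hc : c ≠ 0) (hh : h ≠ 0) (hR : ∀ ρ σ, R ρ σ = -R σ ρ)
    (hg : ∀ ρ σ, ∃ a : ℝ, g * R ρ σ + (g * R ρ σ).transpose = a • g)
    (hN : ∀ j, ∑ i, ![-q, 1, f - p * q] i * g i j = c * ![-p, -f, 1] j)
    (hD : ∀ j, ∑ i, ![1, 0, p] i * g i j = h * ![1, q, 0] j + e * ![-p, -f, 1] j)
    (hRD : bil (R 0 1 + f • R 0 2 - p • R 1 2) ![-p, -f, 1] ![1, 0, p] = 0)
    (hRΔ : bil (R 0 1 + f • R 0 2 - p • R 1 2) ![-p, -f, 1] ![0, 1, f] = 0) :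
    bil (Matrix.of fun μ ν => ∑ ρ, R ρ ν ρ μ) ![-q, 1, f - p * q] ![-q, 1, f - p * q] = 0 := by
  obtain ⟨a, hA⟩ := hg 0 1
  obtain ⟨a', hB⟩ := hg 0 2
  obtain ⟨a'', hC⟩ := hg 1 2
  have hdiag : ∀ ρ i j, R ρ ρ i j = 0 := fun ρ i j =>
    self_eq_neg.1 (congrFun (congrFun (hR ρ ρ) i) j)
  have h10 := hR 1 0
  have h20 := hR 2 0
  have h21 := hR 2 1
  generalize h01 : R 0 1 = A at *
  generalize h02 : R 0 2 = B at *
  generalize h12 : R 1 2 = C at *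
  set N : Fin 3 → ℝ := ![-q, 1, f - p * q] with hNdef
  set D : Fin 3 → ℝ := ![1, 0, p] with hDdef
  set n : Fin 3 → ℝ := ![-p, -f, 1] with hn
  -- The trace in the frame `(D, N, ∂_z)`: the `N` term vanishes by antisymmetry, `R(D, N) = R(D,
  -- Δ)` because `N = Δ - q D`, and `R(∂_z, N) = q B - C`.
  have htr : bil (Matrix.of fun μ ν => ∑ ρ, R ρ ν ρ μ) N N
      = bil (A + f • B - p • C) ![1, q, 0] N + bil (q • B - C) n N := by
    simp [bil, Fin.sum_univ_three, hdiag, h01, h02, h12, h10, h20, h21, hNdef, hn]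
    ring
  have hM : g * (A + f • B - p • C) + (g * (A + f • B - p • C)).transpose
      = (a + f * a' - p * a'') • g := by
    have : g * (A + f • B - p • C) + (g * (A + f • B - p • C)).transpose
      = (g * A + (g * A).transpose) + f • (g * B + (g * B).transpose)
        - p • (g * C + (g * C).transpose) := by
      simp only [mul_add, mul_sub, Matrix.mul_smul, Matrix.transpose_add, Matrix.transpose_sub,
        Matrix.transpose_smul, smul_add]
      abel
    rw [this, hA, hB, hC]; module
  have hMz : g * (q • B - C) + (g * (q • B - C)).transpose = (q * a' - a'') • g := by
    have : g * (q • B - C) + (g * (q • B - C)).transpose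
      = q • (g * B + (g * B).transpose) - (g * C + (g * C).transpose) := by
      simp only [mul_sub, Matrix.mul_smul, Matrix.transpose_sub, Matrix.transpose_smul, smul_add]
      abel
    rw [this, hB, hC]; module
  have gN : ∀ w, bil g N w = c * ∑ j, n j * w j := by
    intro w
    simp only [Fin.sum_univ_three, bil] at hN ⊢
    linear_combination w 0 * hN 0 + w 1 * hN 1 + w 2 * hN 2
  have gNN : bil g N N = 0 := by
    rw [gN, hNdef, hn]; simp [Fin.sum_univ_three]; ring_nf; simp
  have gDN : bil g D N = 0 := by
    have : bil g D N = ∑ j, (h * ![1, q, 0] j + e * n j) * N j := by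
      simp only [← hD, bil, Fin.sum_univ_three]; ring
    rw [this, hNdef, hn]; simp [Fin.sum_univ_three]; ring
  have hn' : ∀ M w, bil M (fun j => c * n j) w = c * bil M n w := by
    intro M w; simp [bil, Fin.sum_univ_three]; ring
  have hnN : bil (A + f • B - p • C) n N = 0 := by
    have : N = ![0, 1, f] + (-q) • D := by
      ext i; fin_cases i <;> simp [hNdef, hDdef]; ring
    rw [this, bil_add_right, bil_smul_right, hRD, hRΔ]; ring
  -- Up to the factor `c` this is `g(N, R(∂_z, N) N)`, which is proportional to `g(N, N) = 0`.
  have hz : bil (q • B - C) n N = 0 := by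
    have h1 := bil_add_bil_of_add_transpose hMz N N
    rw [bil_mul hN, hn', gNN] at h1
    refine (mul_eq_zero.1 ?_).resolve_left hc
    linear_combination h1 / 2
  -- Metric symmetry trades `g(D, R(D, Δ) N)` for `-g(N, R(D, Δ) D)`, a multiple of `ω¹(R(D, Δ) D) =
  -- 0`, because `g(D, N) = 0`.
  have hα : bil (A + f • B - p • C) ![1, q, 0] N = 0 := by
    have h1 := bil_add_bil_of_add_transpose hM D N
    have h3 : bil (A + f • B - p • C) (fun j => h * ![1, q, 0] j + e * n j) N
        = h * bil (A + f • B - p • C) ![1, q, 0] N + e * bil (A + f • B - p • C) n N := by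
      simp only [bil, Fin.sum_univ_three]; ring
    rw [bil_mul hN, hn', bil_mul hD, gDN, h3, hnN, hRD] at h1
    refine (mul_eq_zero.1 ?_).resolve_left hh
    linear_combination h1
  rw [htr, hz, hα, add_zero]

end Curvature

section EinsteinWeyl

variable {U : Opens (Fin 4 → ℝ)} {F : (Fin 4 → ℝ) → ℝ} {b : Fin 4 → ℝ}

/-! ### Symmetric forms that are null along the fundamental directions -/

lemma eventually_line_mem (hb : b ∈ U) (v : Fin 4 → ℝ) :
    ∀ᶠ t in nhds (0 : ℝ), b + t • v ∈ U :=
  (Continuous.tendsto' (by fun_prop) 0 b (by simp)).eventually (U.isOpen.mem_nhds hb)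

lemma hasDerivAt_vD (i : Fin 3) :
    HasDerivAt (fun t : ℝ => vD (b + t • Pi.single 3 1) i) (vZ i) 0 := by
  fin_cases i
  · simpa [vD, vZ] using hasDerivAt_const (0 : ℝ) (1 : ℝ)
  · simpa [vD, vZ] using hasDerivAt_const (0 : ℝ) (0 : ℝ)
  · exact hasDerivAt_coord b

lemma hasDerivAt_vN (hF : ContDiffOn ℝ ∞ F U) (hb : b ∈ U) (i : Fin 3) :
    HasDerivAt (fun t : ℝ => vN F (b + t • Pi.single 3 1) i) ((-Fp F 2 b • vD b) i) 0 := by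
  have f0 := hasDerivAt_Fp hF hb 0
  have f1 := hasDerivAt_Fp hF hb 1
  fin_cases i
  · exact f1.fun_neg.congr_deriv (by simp [vD])
  · simpa [vN, vD] using hasDerivAt_const (0 : ℝ) (1 : ℝ)
  · refine (f0.fun_sub ((hasDerivAt_coord b).fun_mul f1)).congr_deriv ?_
    simp [vD]; ring

/-- A symmetric matrix of basic functions which vanishes on the null directions `N` is
proportional to the fundamental form. -/
lemma exists_eq_smul_G3 (hF : ContDiffOn ℝ ∞ F U) (h2 : ∀ b ∈ U, Fp F 2 b ≠ 0)
    {S : (Fin 4 → ℝ) → Matrix (Fin 3) (Fin 3) ℝ} (hS : ∀ i j, IsBasic U fun b => S b i j)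
    (hsymm : ∀ b i j, S b i j = S b j i)
    (hN : ∀ b ∈ U, bil (S b) (vN F b) (vN F b) = 0) (hb : b ∈ U) :
    S b = bil (S b) (vD b) (vD b) • G3 F b := by
  have dS : ∀ b ∈ U, ∀ i j, HasDerivAt (fun t : ℝ => S (b + t • Pi.single 3 1) i j)
      ((0 : Matrix (Fin 3) (Fin 3) ℝ) i j) 0 := fun b hb i j => by
    have := hasDerivAt_line_pd ((hS i j).differentiableAt hb) 3
    rwa [(hS i j).pd_three b hb] at this
  have bil_zero : ∀ v w : Fin 3 → ℝ, bil 0 v w = 0 := fun v w => by simp [bil]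
  have bs : ∀ b v w, bil (S b) v w = bil (S b) w v := fun b => bil_symm (hsymm b)
  have unique : ∀ {f : (Fin 4 → ℝ) → ℝ} {c : ℝ} {b}, b ∈ U → (∀ b ∈ U, f b = 0) →
      HasDerivAt (fun t : ℝ => f (b + t • Pi.single 3 1)) c 0 → c = 0 := by
    intro f c b hb hf hc
    refine hc.unique ((hasDerivAt_const (0 : ℝ) (0 : ℝ)).congr_of_eventuallyEq ?_)
    filter_upwards [eventually_line_mem hb _] with t ht using hf _ ht
  have dDD := fun b hb => hasDerivAt_bil (dS b hb) (hasDerivAt_vD (b := b)) (hasDerivAt_vD (b := b))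
  have dDZ := fun b hb => hasDerivAt_bil (dS b hb) (hasDerivAt_vD (b := b))
    (w := fun _ => vZ) (w' := 0) fun i => hasDerivAt_const _ _
  simp only [zero_smul, add_zero, bil_zero, zero_add, bs _ vZ] at dDD dDZ
  have bz : ∀ b (v : Fin 3 → ℝ), bil (S b) v 0 = 0 := fun b v => by simp [bil]
  -- From here each relation is the `p`-derivative of the preceding one, with `S` treated as
  -- constant, `∂_p N = -F_pp D` and `∂_p D = ∂_z`.
  have hDN : ∀ b ∈ U, bil (S b) (vD b) (vN F b) = 0 := by
    intro b hb
    have h := unique (f := fun b => bil (S b) (vN F b) (vN F b)) hb hN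
      (hasDerivAt_bil (dS b hb) (hasDerivAt_vN hF hb) (hasDerivAt_vN hF hb))
    simp only [zero_smul, add_zero, bil_zero] at h
    rw [bs b (-Fp F 2 b • vD b) (vN F b), bil_smul_right, bs b (vN F b) (vD b)] at h
    have := h2 b hb
    have h' : Fp F 2 b * bil (S b) (vD b) (vN F b) = 0 := by linarith
    exact (mul_eq_zero.1 h').resolve_left this
  have hNZ : ∀ b ∈ U, bil (S b) (vN F b) vZ - Fp F 2 b * bil (S b) (vD b) (vD b) = 0 := by
    intro b hb
    have h := unique (f := fun b => bil (S b) (vD b) (vN F b)) hb hDN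
      (hasDerivAt_bil (dS b hb) hasDerivAt_vD (hasDerivAt_vN hF hb))
    simp only [zero_smul, add_zero, bil_zero, bil_smul_right, bs b vZ] at h
    linear_combination h
  have hDZ : ∀ b ∈ U, Fp F 3 b * bil (S b) (vD b) (vD b)
      + 3 * Fp F 2 b * bil (S b) (vD b) vZ = 0 := by
    intro b hb
    have h := unique (f := fun b => bil (S b) (vN F b) vZ - Fp F 2 b * bil (S b) (vD b) (vD b))
      hb hNZ ((hasDerivAt_bil (dS b hb) (hasDerivAt_vN hF hb) (w := fun _ => vZ) (w' := 0)
        fun i => hasDerivAt_const _ _).fun_sub ((hasDerivAt_Fp hF hb 2).fun_mul (dDD b hb)))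
    simp only [zero_smul, add_zero, bil_zero, bs b _ vZ, bil_smul_right, bz] at h
    simp only [bs b vZ] at h
    linear_combination -h
  have hZZ : ∀ b ∈ U, Fp F 4 b * bil (S b) (vD b) (vD b) + 5 * Fp F 3 b * bil (S b) (vD b) vZ
      + 3 * Fp F 2 b * bil (S b) vZ vZ = 0 := by
    intro b hb
    have h := unique (f := fun b => Fp F 3 b * bil (S b) (vD b) (vD b)
      + 3 * Fp F 2 b * bil (S b) (vD b) vZ) hb hDZ
      (((hasDerivAt_Fp hF hb 3).fun_mul (dDD b hb)).fun_add
        (((hasDerivAt_Fp hF hb 2).const_mul 3).fun_mul (dDZ b hb)))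
    simp only [zero_smul, add_zero, bz] at h
    linear_combination h
  exact eq_smul_G3 (h2 b hb) (hsymm b) (hN b hb) (hDN b hb)
    (by linear_combination hNZ b hb) (hDZ b hb) (hZZ b hb)

/-! ### The Einstein--Weyl equations for the normalised representative -/

variable (hF : ContDiffOn ℝ ∞ F U) (hDF : ∀ b ∈ U, DF F b = 0) (h2 : ∀ b ∈ U, Fp F 2 b ≠ 0)
  (hM : ∀ b ∈ U, Monge F b = 0) (hK : ∀ b ∈ U, KInv F b = 0)

include hF h2 hM hK

lemma isBasic_dΓM (i s k j : Fin 3) : IsBasic U fun b => dΓM F i s b k j :=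
  (isBasic_Γ3 hF h2 hM hK k j s).dd i

lemma isBasic_Rm (ρ σ μ ν : Fin 3) : IsBasic U fun b => Rm F ρ σ b μ ν := by
  have h := isBasic_Γ3 hF h2 hM hK
  exact (((isBasic_dΓM hF h2 hM hK ρ σ μ ν).sub (isBasic_dΓM hF h2 hM hK σ ρ μ ν)).add
    (IsBasic.sum (s := Finset.univ) fun k _ => (h μ k ρ).mul (h k ν σ))).sub
    (IsBasic.sum (s := Finset.univ) fun k _ => (h μ k σ).mul (h k ν ρ))

lemma dd_dd_g3 (hb : b ∈ U) (s t m n : Fin 3) :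
    dd t (dd s fun b => g3 F b m n) b
      = ∑ k, (dd t (fun b => g3 F b m k) b * Γ3 F k n s b + g3 F b m k * dd t (Γ3 F k n s) b)
        + ∑ k, (dd t (fun b => g3 F b n k) b * Γ3 F k m s b + g3 F b n k * dd t (Γ3 F k m s) b)
        + 2 * (dd t (r3 F s) b * g3 F b m n + r3 F s b * dd t (fun b => g3 F b m n) b) := by
  have hd : ∀ {f : (Fin 4 → ℝ) → ℝ}, IsBasic U f →
      HasDerivAt (fun τ : ℝ => f (b + τ • Pi.single t.castSucc 1)) (dd t f b) 0 :=
    fun hf => hasDerivAt_line_pd (hf.differentiableAt hb) _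
  have hg := fun i j => hd (isBasic_g3 hF h2 hM i j)
  have hΓ := fun i j k => hd (isBasic_Γ3 hF h2 hM hK i j k)
  have hr := fun i => hd (isBasic_r3 hF h2 hK i)
  have h := ((HasDerivAt.fun_sum (u := Finset.univ) fun k _ => (hg m k).fun_mul (hΓ k n s)).fun_add
    (HasDerivAt.fun_sum (u := Finset.univ) fun k _ => (hg n k).fun_mul (hΓ k m s))).fun_add
    (((hr s).fun_mul (hg m n)).const_mul 2)
  simp only [zero_smul, add_zero] at h
  refine (hd ((isBasic_g3 hF h2 hM m n).dd s)).unique (h.congr_of_eventuallyEq ?_)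
  filter_upwards [eventually_line_mem hb _] with τ hτ
  linear_combination Γ3_compatible (h2 _ hτ) m n s

lemma g3_mul_Rm (hb : b ∈ U) (ρ σ : Fin 3) :
    g3 F b * Rm F ρ σ b + (g3 F b * Rm F ρ σ b).transpose
      = (-2 * (dd ρ (r3 F σ) b - dd σ (r3 F ρ) b)) • g3 F b := by
  ext m n
  have e1 := dd_dd_g3 hF h2 hM hK hb σ ρ m n
  have e2 := dd_dd_g3 hF h2 hM hK hb ρ σ m n
  rw [dd_comm (isBasic_g3 hF h2 hM m n).smooth hb ρ σ, e2] at e1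
  have hdg : ∀ s m n, dd s (fun b => g3 F b m n) b = ∑ k, g3 F b m k * Γ3 F k n s b
      + ∑ k, g3 F b n k * Γ3 F k m s b + 2 * r3 F s b * g3 F b m n := fun s m n => by
    linear_combination Γ3_compatible (h2 b hb) m n s
  simp only [hdg, Fin.sum_univ_three, g3_symm 1 0, g3_symm 2 0, g3_symm 2 1] at e1
  simp only [Matrix.add_apply, Matrix.transpose_apply, Matrix.mul_apply, Fin.sum_univ_three, Rm,
    Matrix.sub_apply, Matrix.smul_apply, smul_eq_mul, dΓM, ΓM, Matrix.of_apply]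
  rw [g3_symm m 0, g3_symm m 1, g3_symm m 2, g3_symm n 0, g3_symm n 1, g3_symm n 2] at e1 ⊢
  linear_combination -e1

lemma hasDerivAt_Γc_emb (hb : b ∈ U) (v : Fin 3 → ℝ) {X : (Fin 4 → ℝ) → Fin 3 → ℝ}
    (hX : ∀ i, HasDerivAt (fun t : ℝ => X (b + t • emb v) i) 0 0) (k j : Fin 3) :
    HasDerivAt (fun t : ℝ => Γc F (X (b + t • emb v)) (b + t • emb v) k j)
      ((Matrix.of fun k j => ∑ s, X b s * dv v (Γ3 F k j s) b : Matrix _ _ ℝ) k j) 0 := by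
  have hΓ := fun s => hasDerivAt_emb ((isBasic_Γ3 hF h2 hM hK k j s).differentiableAt hb) v
  refine (HasDerivAt.fun_sum (u := Finset.univ) fun s _ => (hX s).fun_mul (hΓ s)).congr_deriv ?_
  simp

include hDF

omit h2 hM hK in
lemma hasDerivAt_vΔ_emb (hb : b ∈ U) (i : Fin 3) :
    HasDerivAt (fun t : ℝ => vΔ F (b + t • emb (vD b)) i) 0 0 := by
  fin_cases i
  · simpa [vΔ] using hasDerivAt_const (0 : ℝ) (0 : ℝ)
  · simpa [vΔ] using hasDerivAt_const (0 : ℝ) (1 : ℝ)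
  · have := hasDerivAt_emb (differentiableAt_of_smooth hF hb) (vD b)
    rwa [dv_vD_F hDF hb] at this

lemma Rm_vD_vΔ (hb : b ∈ U) :
    bil (Rm F 0 1 b + F b • Rm F 0 2 b - b 3 • Rm F 1 2 b) (cω F b) (vD b) = 0 ∧
    bil (Rm F 0 1 b + F b • Rm F 0 2 b - b 3 • Rm F 1 2 b) (cω F b) (vΔ F b) = 0 := by
  have hQ := hasDerivAt_Γc_emb hF h2 hM hK hb (vD b) (X := vΔ F) (hasDerivAt_vΔ_emb hF hDF hb)
  have hP := hasDerivAt_Γc_emb hF h2 hM hK hb (vΔ F b) (X := vD) (hasDerivAt_vD_emb (vΔ F b))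
  set P' : Matrix (Fin 3) (Fin 3) ℝ := Matrix.of fun k j => ∑ s, vD b s * dv (vΔ F b) (Γ3 F k j s) b
    with hP'
  set Q' : Matrix (Fin 3) (Fin 3) ℝ := Matrix.of fun k j => ∑ s, vΔ F b s * dv (vD b) (Γ3 F k j s) b
    with hQ'
  -- This combination is `R(D, Δ)`, from expanding `(∂_x + p ∂_z) ∧ (∂_y + F ∂_z)`. There is no
  -- bracket term, and the components of `Δ` are constant along `D` by `DF = 0`.
  have hR : Rm F 0 1 b + F b • Rm F 0 2 b - b 3 • Rm F 1 2 b
      = Q' - P' + Γc F (vD b) b * Γc F (vΔ F b) b - Γc F (vΔ F b) b * Γc F (vD b) b := by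
    ext i j
    simp only [Matrix.add_apply, Matrix.mul_apply, Fin.sum_univ_three, Rm, Matrix.sub_apply,
      Matrix.smul_apply, smul_eq_mul, dΓM, ΓM, Matrix.of_apply, hP', hQ', Γc, dv]
    simp [vD, vΔ]
    ring
  have hnD := hasDerivAt_cω_emb hF hb (vD b)
  have hnΔ := hasDerivAt_cω_emb hF hb (vΔ F b)
  have zero_of : ∀ {f : (Fin 4 → ℝ) → ℝ} {c d : ℝ} {v : Fin 3 → ℝ} {g : ℝ → ℝ},
      HasDerivAt g c 0 → HasDerivAt (fun t : ℝ => f (b + t • emb v)) d 0 →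
      (∀ b' ∈ U, ∀ t : ℝ, b' = b + t • emb v → g t = f b') → c = d := by
    intro f c d v g hg hf hgf
    refine (hg.congr_of_eventuallyEq (f₁ := fun t : ℝ => f (b + t • emb v)) ?_).unique hf
    filter_upwards [eventually_emb_mem hb v] with t ht using (hgf _ ht t rfl).symm
  have hFΔ : dv (vΔ F b) F b = ΔFp F 0 b := by
    simp [dv, Fin.sum_univ_three, vΔ, dd, ΔFp, Fp]
  -- The four relations differentiate the totally geodesic identities: those involving `Γ_Δ` along
  -- `D`, those involving `Γ_D` along `Δ`.
  have h1 := zero_of (f := fun _ => 0) (hasDerivAt_bil hQ hnD (hasDerivAt_vD_emb (vD b)))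
    (hasDerivAt_const _ _) (by rintro b' hb' t rfl; exact (Γc_swap _ _ _).trans (Γc_vD_vΔ hF hDF h2 hb'))
  have h3 := zero_of (f := fun _ => 0) (hasDerivAt_bil hP hnΔ (hasDerivAt_vD_emb (vΔ F b)))
    (hasDerivAt_const _ _) (by rintro b' hb' t rfl; exact Γc_vD_vD hF hDF h2 hb')
  have h4 := zero_of (f := fun b => -ΔFp F 0 b)
    (hasDerivAt_bil hQ hnD (w' := 0) (hasDerivAt_vΔ_emb hF hDF hb))
    (hasDerivAt_emb (differentiableAt_of_smooth (contDiffOn_ΔFp hF 0) hb) (vD b)).fun_neg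
    (by rintro b' hb' t rfl; exact Γc_vΔ_vΔ hF hDF h2 hb')
  have hΔΔ : ∀ i, HasDerivAt (fun t : ℝ => vΔ F (b + t • emb (vΔ F b)) i)
      ((ΔFp F 0 b • vZ) i) 0 := by
    intro i
    fin_cases i
    · simpa [vΔ, vZ] using hasDerivAt_const (0 : ℝ) (0 : ℝ)
    · simpa [vΔ, vZ] using hasDerivAt_const (0 : ℝ) (1 : ℝ)
    · have := hasDerivAt_emb (differentiableAt_of_smooth hF hb) (vΔ F b)
      rw [hFΔ] at this
      simpa [vΔ, vZ] using this
  have h5 := zero_of (f := fun _ => 0) (hasDerivAt_bil hP hnΔ hΔΔ)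
    (hasDerivAt_const _ _) (by rintro b' hb' t rfl; exact Γc_vD_vΔ hF hDF h2 hb')
  have bz : ∀ (M : Matrix (Fin 3) (Fin 3) ℝ) v, bil M v 0 = 0 := fun M v => by simp [bil]
  have bs : ∀ (M : Matrix (Fin 3) (Fin 3) ℝ) v w (c : ℝ), bil M (c • v) w = c * bil M v w :=
    fun M v w c => by simp [bil, Fin.sum_univ_three]; ring
  have bzl : ∀ (M : Matrix (Fin 3) (Fin 3) ℝ) v, bil M 0 v = 0 := fun M v => by simp [bil]
  simp only [zero_smul, add_zero, bz, bzl, bs, bil_smul_right, dv_vD_F hDF hb, hFΔ, neg_zero,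
    dv_vD_ΔF hF hDF hb] at h1 h3 h4 h5
  rw [hR]
  have a1 := Γc_vD_vD hF hDF h2 hb
  have a2 := Γc_vD_vΔ hF hDF h2 hb
  have a3 := (Γc_swap (vΔ F b) (vD b) (cω F b)).trans a2
  have a4 := Γc_vΔ_vΔ hF hDF h2 hb
  rw [neg_mul, ← sub_eq_add_neg] at h3 h5
  exact ⟨bil_curvature_vD a1 a2 a3 a4 h1 h3, bil_curvature_vΔ a1 a2 a3 a4 h4 h5⟩

/-- The symmetrised Ricci tensor of the Weyl connection. -/
noncomputable def Ric3 (F : (Fin 4 → ℝ) → ℝ) (b : Fin 4 → ℝ) : Matrix (Fin 3) (Fin 3) ℝ :=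
  Matrix.of fun μ ν => ∑ ρ, Rm F ρ ν b ρ μ

lemma Ric3_vN_vN (hb : b ∈ U) : bil (Ric3 F b) (vN F b) (vN F b) = 0 := by
  obtain ⟨hD, hΔ⟩ := Rm_vD_vΔ hF hDF h2 hM hK hb
  -- The constants `h` and `e` are the coefficients in `g3(D, ·) = h (dx + F_p dy) + e ω¹`.
  refine ricci_null (g := g3 F b) (R := fun ρ σ => Rm F ρ σ b) (h := hfac F b)
    (e := -(hfac F b * Fp F 3 b / (3 * Fp F 2 b)))
    (mul_ne_zero (hfac_pos (F := F) (b := b)).ne' (h2 b hb)) hfac_pos.ne' ?_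
    (fun ρ σ => ⟨_, g3_mul_Rm hF h2 hM hK hb ρ σ⟩) sum_vN_g3 ?_ hD hΔ
  · intro ρ σ; simp only [Rm]; abel
  · intro j
    have := h2 b hb
    fin_cases j <;> simp [Fin.sum_univ_three, g3, G3, cω, cα, cy] <;> field_simp <;> ring

/-- The symmetrised Ricci tensor is annihilated by `∂_p` and vanishes on every `N`, so
`exists_eq_smul_G3` applies to it. -/
lemma exists_ricci_eq (hb : b ∈ U) :
    ∃ s : ℝ, ∀ μ ν, Ric3 F b μ ν + Ric3 F b ν μ = s * g3 F b μ ν := by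
  have hRic : ∀ μ ν, IsBasic U fun b => Ric3 F b μ ν := fun μ ν =>
    IsBasic.sum (s := Finset.univ) fun ρ _ => isBasic_Rm hF h2 hM hK ρ ν ρ μ
  have h := exists_eq_smul_G3 hF h2 (S := fun b => Matrix.of fun μ ν => Ric3 F b μ ν + Ric3 F b ν μ)
    (fun i j => (hRic i j).add (hRic j i)) (fun b i j => add_comm _ _) (fun b hb => by
      have h0 := Ric3_vN_vN hF hDF h2 hM hK hb
      have : bil (Matrix.of fun μ ν => Ric3 F b μ ν + Ric3 F b ν μ) (vN F b) (vN F b)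
          = 2 * bil (Ric3 F b) (vN F b) (vN F b) := by
        simp only [bil, Matrix.of_apply, Fin.sum_univ_three]; ring
      rw [this, h0, mul_zero]) hb
  refine ⟨bil (Matrix.of fun μ ν => Ric3 F b μ ν + Ric3 F b ν μ) (vD b) (vD b) / hfac F b,
    fun μ ν => ?_⟩
  have hpos := (hfac_pos (F := F) (b := b)).ne'
  have := congrFun (congrFun h μ) ν
  rw [Matrix.of_apply, Matrix.smul_apply, smul_eq_mul] at this
  rw [this, g3, Matrix.smul_apply, smul_eq_mul]
  field_simp

end EinsteinWeyl

/-! ### The leaves of `𝒟₄` -/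

section Leaves

variable {U : Opens (Fin 4 → ℝ)} {F : (Fin 4 → ℝ) → ℝ}

/-- `base` as a continuous linear map. -/
def baseL : (Fin 7 → ℝ) →L[ℝ] (Fin 4 → ℝ) :=
  ContinuousLinearMap.pi fun i => ContinuousLinearMap.proj (Fin.castLE (by norm_num) i)

/-- `xyz` as a continuous linear map. -/
def xyzL : (Fin 7 → ℝ) →L[ℝ] (Fin 3 → ℝ) :=
  ContinuousLinearMap.pi fun i => ContinuousLinearMap.proj (Fin.castLE (by norm_num) i)

lemma base_eq (q : Fin 7 → ℝ) : base q = baseL q := by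
  funext i; fin_cases i <;> rfl

lemma xyz_eq (q : Fin 7 → ℝ) : xyz q = xyzL q := by
  funext i; fin_cases i <;> rfl

lemma xyz_add (v w : Fin 7 → ℝ) : xyz (v + w) = xyz v + xyz w := by simp [xyz_eq]

lemma xyz_smul (c : ℝ) (v : Fin 7 → ℝ) : xyz (c • v) = c • xyz v := by simp [xyz_eq]

/-- The vector with the given horizontal components. -/
def horiz (s : Fin 3 → ℝ) : Fin 7 → ℝ := ![s 0, s 1, s 2, 0, 0, 0, 0]

@[simp] lemma xyz_horiz (s : Fin 3 → ℝ) : xyz (horiz s) = s := by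
  funext i; fin_cases i <;> rfl

lemma xyz_eq_zero_iff {v : Fin 7 → ℝ} : xyz v = 0 ↔ v 0 = 0 ∧ v 1 = 0 ∧ v 2 = 0 := by
  constructor
  · intro h; exact ⟨congrFun h 0, congrFun h 1, congrFun h 2⟩
  · rintro ⟨h0, h1, h2⟩; funext i; fin_cases i <;> assumption

/-- The passage from `dx, dy, dz` to `θ¹, θ³, θ⁴` is invertible because `u₃`, `u₅` and `F_pp` do not
vanish. -/
lemma mem_D4_iff (h2 : ∀ b ∈ U, Fp F 2 b ≠ 0) {q : Fin 7 → ℝ} (hq : q ∈ P7 U)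
    {v : Fin 7 → ℝ} : v ∈ D4 F q ↔ xyz v = 0 := by
  obtain ⟨hb, h4, h5⟩ := hq
  have hne := h2 _ hb
  have hmem : v ∈ D4 F q ↔ θ1 F q v = 0 ∧ θ3 F q v = 0 ∧ θ4 F q v = 0 := by
    simp [D4, and_assoc]
  rw [hmem, xyz_eq_zero_iff]
  constructor
  · rintro ⟨a1, a3, a4⟩
    have e1 : ω1 F q v = 0 := by simpa [θ1, h4, h5] using a1
    have e3 : ω3 F q v = 0 := by simpa [θ3, e1, h5] using a3
    have e4 : ω4 F q v = 0 := by simpa [θ4, e1, e3, h4, h5] using a4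
    have y : v 1 = 0 := by simpa [ω4, e1, hne, dq] using e4
    have x : v 0 = 0 := by simpa [ω3, e1, y, dq] using e3
    have z : v 2 = 0 := by simpa [ω1, x, y, dq] using e1
    exact ⟨x, y, z⟩
  · rintro ⟨x, y, z⟩
    have e1 : ω1 F q v = 0 := by simp [ω1, dq, x, y, z]
    have e3 : ω3 F q v = 0 := by simp [ω3, e1, dq, x, y]
    have e4 : ω4 F q v = 0 := by simp [ω4, e1, dq, y]
    simp [θ1, θ3, θ4, e1, e3, e4]

variable (h2 : ∀ b ∈ U, Fp F 2 b ≠ 0)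
include h2

lemma leafStep_of_segment {q q' : P7 U} (hs : segment ℝ (q : Fin 7 → ℝ) q' ⊆ P7 U)
    (hv : xyz (q : Fin 7 → ℝ) = xyz q') : LeafStep F U q q' := by
  refine ⟨AffineMap.lineMap (q : Fin 7 → ℝ) (q' : Fin 7 → ℝ), ?_, by simp, by simp, ?_⟩
  · have : ContDiff ℝ 1 fun t : ℝ => t • ((q' : Fin 7 → ℝ) - q) + q := by fun_prop
    exact this.contDiffOn.congr fun t _ => AffineMap.lineMap_apply _ _ _
  · intro t ht
    have hm : AffineMap.lineMap (q : Fin 7 → ℝ) (q' : Fin 7 → ℝ) t ∈ P7 U :=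
      hs (by rw [segment_eq_image_lineMap]; exact ⟨t, ht, rfl⟩)
    refine ⟨hm, ?_⟩
    rw [mem_D4_iff h2 hm, (AffineMap.hasDerivWithinAt_lineMap).derivWithin
      (uniqueDiffOn_Icc_zero_one t ht)]
    rw [xyz_eq, map_sub, ← xyz_eq, ← xyz_eq, hv, sub_self]

lemma leaf_eq_of_segment {q q' : P7 U} (hs : segment ℝ (q : Fin 7 → ℝ) q' ⊆ P7 U)
    (hv : xyz (q : Fin 7 → ℝ) = xyz q') : leaf F U q = leaf F U q' :=
  Quotient.sound (Relation.EqvGen.rel _ _ (leafStep_of_segment h2 hs hv))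

/-- Along a tangent path the chain rule gives `H ∘ γ` zero derivative. -/
lemma eq_of_leafStep {E : Type*} [NormedAddCommGroup E] [NormedSpace ℝ E] {H : (Fin 7 → ℝ) → E}
    (hH : ∀ q ∈ P7 U, DifferentiableAt ℝ H q)
    (hv : ∀ q ∈ P7 U, ∀ v, xyz v = 0 → fderiv ℝ H q v = 0) {q q' : P7 U}
    (h : LeafStep F U q q') : H q = H q' := by
  obtain ⟨γ, hγ, h0, h1, ht⟩ := h
  have hd : ∀ t ∈ Icc (0 : ℝ) 1, HasDerivWithinAt (H ∘ γ) 0 (Icc 0 1) t := by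
    intro t hti
    have e1 := ((hγ.differentiableOn (by simp)) t hti).hasDerivWithinAt
    have e2 := ((hH _ (ht t hti).1).hasFDerivAt).comp_hasDerivWithinAt t e1
    rwa [hv _ (ht t hti).1 _ ((mem_D4_iff h2 (ht t hti).1).1 (ht t hti).2)] at e2
  have := constant_of_derivWithin_zero (fun t hti => (hd t hti).differentiableWithinAt)
    (fun t hti => (hd t ⟨hti.1, hti.2.le⟩).derivWithin
      (uniqueDiffOn_Icc_zero_one t ⟨hti.1, hti.2.le⟩)) 1 (by simp)
  simpa [h0, h1] using this.symm

lemma eq_of_leaf_eq {E : Type*} [NormedAddCommGroup E] [NormedSpace ℝ E] {H : (Fin 7 → ℝ) → E}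
    (hH : ∀ q ∈ P7 U, DifferentiableAt ℝ H q)
    (hv : ∀ q ∈ P7 U, ∀ v, xyz v = 0 → fderiv ℝ H q v = 0) {q q' : P7 U}
    (h : leaf F U q = leaf F U q') : H q = H q' := by
  have h' : Relation.EqvGen (LeafStep F U) q q' := Quotient.exact h
  clear h
  induction h' with
  | rel _ _ h => exact eq_of_leafStep h2 hH hv h
  | refl _ => rfl
  | symm _ _ _ ih => exact ih.symm
  | trans _ _ _ _ _ iha ihb => exact iha.trans ihb

lemma eq_of_leafStep_xyz {q q' : P7 U} (h : leaf F U q = leaf F U q') :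
    xyz (q : Fin 7 → ℝ) = xyz q' := by
  refine eq_of_leaf_eq h2 (H := xyz) ?_ ?_ h
  · intro q _; rw [show xyz = xyzL from funext xyz_eq]; fun_prop
  · intro q _ v hv
    rw [show xyz = xyzL from funext xyz_eq] at *
    rw [ContinuousLinearMap.fderiv, hv]

/-! ### Functions on the leaf space -/

omit h2 in
lemma pull_apply (f : LeafSpace F U → ℝ) (q : P7 U) : pull f q = f (leaf F U q) := by
  simp [pull]

/-- Short vertical segments stay in one leaf, where the pullback is constant. -/
lemma fderiv_pull_vertical {f : LeafSpace F U → ℝ} (hf : LeafSmooth f) (q : P7 U)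
    {v : Fin 7 → ℝ} (hv : xyz v = 0) : fderiv ℝ (pull f) (q : Fin 7 → ℝ) v = 0 := by
  have hd : HasDerivAt (fun t : ℝ => pull f (q + t • v)) (fderiv ℝ (pull f) (q : Fin 7 → ℝ) v) 0 :=
    (hf.differentiableAt q).hasFDerivAt.hasLineDerivAt v
  refine hd.unique ((hasDerivAt_const (0 : ℝ) (f (leaf F U q))).congr_of_eventuallyEq ?_)
  obtain ⟨ε, hε, hball⟩ := Metric.isOpen_iff.1 (isOpen_P7 U) q q.2
  have hev : ∀ᶠ t in nhds (0 : ℝ), (q : Fin 7 → ℝ) + t • v ∈ Metric.ball (q : Fin 7 → ℝ) ε :=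
    (Continuous.tendsto' (by fun_prop) 0 (q : Fin 7 → ℝ) (by simp)).eventually
      (Metric.ball_mem_nhds _ hε)
  filter_upwards [hev] with t ht
  rw [pull, dif_pos (hball ht)]
  congr 1
  refine (leaf_eq_of_segment h2 (((convex_ball _ ε).segment_subset
    (Metric.mem_ball_self hε) ht).trans hball) ?_).symm
  rw [xyz_add, xyz_smul, hv]; simp

omit h2 in
lemma fderiv_eq_of_vertical {H : (Fin 7 → ℝ) → ℝ} {q : Fin 7 → ℝ}
    (hv : ∀ v, xyz v = 0 → fderiv ℝ H q v = 0) (v : Fin 7 → ℝ) :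
    fderiv ℝ H q v = ∑ i : Fin 3, pd (Fin.castLE (by norm_num) i) H q * xyz v i := by
  have h0 := hv (v - horiz (xyz v)) (by
    rw [xyz_eq, map_sub, ← xyz_eq, ← xyz_eq, xyz_horiz, sub_self])
  rw [map_sub, sub_eq_zero] at h0
  rw [h0, fderiv_eq_sum_pd, Fin.sum_univ_three]
  simp [Fin.sum_univ_succ, horiz, Fin.succ_zero_eq_one]
  simp [xyz]
  ring

lemma fderiv_pull {f : LeafSpace F U → ℝ} (hf : LeafSmooth f) (q : P7 U) (v : Fin 7 → ℝ) :
    fderiv ℝ (pull f) (q : Fin 7 → ℝ) v = ∑ i : Fin 3, dM f i q * xyz v i :=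
  fderiv_eq_of_vertical (fun _ => fderiv_pull_vertical h2 hf q) v

omit h2 in
lemma dM_eq {f : LeafSpace F U → ℝ} {H : (Fin 7 → ℝ) → ℝ} (h : ∀ q : P7 U, f (leaf F U q) = H q)
    (i : Fin 3) (q : P7 U) : dM f i q = pd (Fin.castLE (by norm_num) i) H q :=
  pd_congr (isOpen_P7 U) (fun q' hq' => by rw [pull_apply f ⟨q', hq'⟩, h]) q.2 _

/-- A smooth function on `P₇` whose differential vanishes on `𝒟₄` is the pullback of a smooth
function on the leaf space. -/
lemma exists_leafSmooth {H : (Fin 7 → ℝ) → ℝ} (hH : ContDiffOn ℝ ∞ H (P7 U))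
    (hv : ∀ q ∈ P7 U, ∀ v, xyz v = 0 → fderiv ℝ H q v = 0) :
    ∃ ψ : LeafSpace F U → ℝ, LeafSmooth ψ ∧ ∀ q : P7 U, ψ (leaf F U q) = H q := by
  have key : ∀ q : P7 U, H (Quotient.out (leaf F U q) : P7 U) = H q := fun q =>
    eq_of_leaf_eq h2 (fun q hq => differentiableAt_of_contDiffOn (isOpen_P7 U) hH hq) hv
      (Quotient.out_eq (leaf F U q))
  refine ⟨fun l => H (Quotient.out l : P7 U), ?_, key⟩
  refine ContDiffOn.congr hH fun q hq => ?_
  rw [pull_apply _ ⟨q, hq⟩, key]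

omit h2 in
lemma hasFDerivAt_comp_base {f : (Fin 4 → ℝ) → ℝ} {q : Fin 7 → ℝ}
    (hf : DifferentiableAt ℝ f (base q)) :
    HasFDerivAt (fun q => f (base q)) ((fderiv ℝ f (base q)).comp baseL) q := by
  have hb : HasFDerivAt base baseL q := by
    rw [show base = baseL from funext base_eq]; exact baseL.hasFDerivAt
  exact hf.hasFDerivAt.comp q hb

/-- The function on the leaf space induced by a basic function. -/
noncomputable def desc (F f : (Fin 4 → ℝ) → ℝ) (l : LeafSpace F U) : ℝ :=
  f (base (Quotient.out l : P7 U))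

omit h2 in
lemma contDiffOn_comp_base {f : (Fin 4 → ℝ) → ℝ} (hf : ContDiffOn ℝ ∞ f U) :
    ContDiffOn ℝ ∞ (fun q => f (base q)) (P7 U) := by
  refine ContDiffOn.comp (t := (U : Set (Fin 4 → ℝ))) hf ?_ fun q hq => hq.1
  rw [show base = baseL from funext base_eq]
  exact baseL.contDiff.contDiffOn

omit h2 in
lemma fderiv_comp_base_vertical {f : (Fin 4 → ℝ) → ℝ} (hf : IsBasic U f) {q : Fin 7 → ℝ}
    (hq : q ∈ P7 U) {v : Fin 7 → ℝ} (hv : xyz v = 0) :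
    fderiv ℝ (fun q => f (base q)) q v = 0 := by
  rw [(hasFDerivAt_comp_base (hf.differentiableAt hq.1)).fderiv,
    ContinuousLinearMap.comp_apply, fderiv_eq_sum_pd, ← base_eq]
  obtain ⟨x, y, z⟩ := xyz_eq_zero_iff.1 hv
  rw [Fin.sum_univ_four, hf.pd_three _ hq.1]
  simp [base, x, y, z]

/-- The representative `Quotient.out` is arbitrary on the leaf; a basic function takes the same
value at each of its points. -/
lemma desc_leaf {f : (Fin 4 → ℝ) → ℝ} (hf : IsBasic U f) (q : P7 U) :
    desc F f (leaf F U q) = f (base q) :=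
  eq_of_leaf_eq h2 (H := fun q => f (base q))
    (fun _ hq => differentiableAt_of_contDiffOn (isOpen_P7 U) (contDiffOn_comp_base hf.smooth) hq)
    (fun _ hq _ hv => fderiv_comp_base_vertical hf hq hv) (Quotient.out_eq (leaf F U q))

lemma leafSmooth_desc {f : (Fin 4 → ℝ) → ℝ} (hf : IsBasic U f) :
    LeafSmooth (desc F f : LeafSpace F U → ℝ) :=
  (contDiffOn_comp_base hf.smooth).congr fun q hq => by
    rw [pull_apply _ ⟨q, hq⟩, desc_leaf h2 hf]

omit h2 in
lemma pd_comp_base {f : (Fin 4 → ℝ) → ℝ} {q : Fin 7 → ℝ} (hf : DifferentiableAt ℝ f (base q))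
    (i : Fin 3) :
    pd (Fin.castLE (by norm_num) i) (fun q => f (base q)) q = dd i f (base q) := by
  rw [pd, (hasFDerivAt_comp_base hf).fderiv, ContinuousLinearMap.comp_apply, dd, pd]
  congr 1
  funext j
  fin_cases i <;> fin_cases j <;> simp [← base_eq, base]

lemma dM_desc {f : (Fin 4 → ℝ) → ℝ} (hf : IsBasic U f) (i : Fin 3) (q : P7 U) :
    dM (desc F f : LeafSpace F U → ℝ) i q = dd i f (base q) := by
  rw [dM_eq (H := fun q => f (base q)) (desc_leaf h2 hf), pd_comp_base (hf.differentiableAt q.2.1)]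

end Leaves

/-! ### The quadratic form on `P₇` -/

section Form

variable {U : Opens (Fin 4 → ℝ)} {F : (Fin 4 → ℝ) → ℝ}

/-- The change from `ω` to `θ` preserves `ω³ω³ + ω¹ω⁴ + ω⁴ω¹` up to `u₅²`, so `u₃` and `u₈` cancel.
-/
lemma gTilde_eq (h2 : ∀ b ∈ U, Fp F 2 b ≠ 0) {q : Fin 7 → ℝ} (hq : q ∈ P7 U) (v w : Fin 7 → ℝ) :
    gTilde F q v w = q 5 ^ 2 * bil (G3 F (base q)) (xyz v) (xyz w) := by
  obtain ⟨hb, h4, h5⟩ := hq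
  have hne := h2 _ hb
  have hp : base q 3 = q 3 := rfl
  simp only [gTilde, LinearMap.BilinForm.linMulLin, LinearMap.add_apply, θ1, θ3, θ4,
    ω1, ω3, ω4, bil, G3, Fin.sum_univ_three, Matrix.of_apply]
  simp [dq, xyz, cα, cω, cy, hp]
  field_simp
  ring

lemma hasSignature_toBilin' {M : Matrix (Fin 3) (Fin 3) ℝ} {D N Z : Fin 3 → ℝ} {h c : ℝ}
    (hM : ∀ i j, M i j = M j i) (hh : 0 < h) (hc : c ≠ 0) (hDD : bil M D D = h)
    (hNN : bil M N N = 0) (hDN : bil M D N = 0) (hNZ : bil M N Z = c) :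
    HasSignature (Matrix.toBilin' M) ![1, 1, -1] := by
  have hB : ∀ v w, Matrix.toBilin' M v w = bil M v w := by
    intro v w
    rw [Matrix.toBilin'_apply]
    simp only [bil]
    refine Finset.sum_congr rfl fun i _ => Finset.sum_congr rfl fun j _ => by ring
  have hND : bil M N D = 0 := by rw [bil_symm hM, hDN]
  have hZN : bil M Z N = c := by rw [bil_symm hM, hNZ]
  have hZD : bil M Z D = bil M D Z := bil_symm hM _ _
  rw [← hB] at hDD hNN hDN hNZ hND hZN
  rw [← hB, ← hB] at hZD
  generalize Matrix.toBilin' M = B at *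
  obtain ⟨k, hDZ⟩ : ∃ k, B D Z = k := ⟨_, rfl⟩
  obtain ⟨m, hZZ⟩ : ∃ m, B Z Z = m := ⟨_, rfl⟩
  rw [hDZ] at hZD
  obtain ⟨s, hs, rfl⟩ : ∃ s : ℝ, s ≠ 0 ∧ s ^ 2 = h :=
    ⟨Real.sqrt h, (Real.sqrt_pos.2 hh).ne', Real.sq_sqrt hh.le⟩
  -- `Z` is corrected by multiples of `D` and `N` to a null vector `Z'` orthogonal to `D` with `B N
  -- Z' = c`; then `N / (2c) ± Z'` have squares `±1`.
  set e : Fin 3 → Fin 3 → ℝ := ![s⁻¹ • D,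
    (2 * c)⁻¹ • N + (Z - (k / s ^ 2) • D - ((m - k ^ 2 / s ^ 2) / (2 * c)) • N),
    (2 * c)⁻¹ • N - (Z - (k / s ^ 2) • D - ((m - k ^ 2 / s ^ 2) / (2 * c)) • N)] with he
  have gram : ∀ i j, B (e i) (e j) = if i = j then (![1, 1, -1] : Fin 3 → ℝ) i else 0 := by
    intro i j
    fin_cases i <;> fin_cases j <;>
      simp [he, hDD, hNN, hDN, hNZ, hND, hZN, hDZ, hZZ, hZD, -mul_eq_zero] <;> field_simp <;> ring
  have li : LinearIndependent ℝ e := by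
    refine LinearMap.BilinForm.linearIndependent_of_iIsOrtho (B := B)
      (LinearMap.BilinForm.iIsOrtho_def.2 fun i j hij => by rw [gram, if_neg hij]) fun i => ?_
    rw [gram]
    fin_cases i <;> simp
  refine ⟨basisOfLinearIndependentOfCardEqFinrank li (by simp), fun i j => ?_⟩
  simp only [coe_basisOfLinearIndependentOfCardEqFinrank, gram]

lemma hasSignature_horizontal {M : Matrix (Fin 3) (Fin 3) ℝ}
    {B : LinearMap.BilinForm ℝ (Fin 7 → ℝ)} (hM : HasSignature (Matrix.toBilin' M) ![1, 1, -1])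
    (hB : ∀ v w, B v w = Matrix.toBilin' M (xyz v) (xyz w)) :
    HasSignature B ![1, 1, -1, 0, 0, 0, 0] := by
  obtain ⟨e, he⟩ := hM
  let φ : ((Fin 3 → ℝ) × (Fin 4 → ℝ)) ≃ₗ[ℝ] (Fin 7 → ℝ) :=
    (LinearEquiv.sumArrowLequivProdArrow (Fin 3) (Fin 4) ℝ ℝ).symm.trans
      (LinearEquiv.funCongrLeft ℝ ℝ (finSumFinEquiv (m := 3) (n := 4)).symm)
  let E : Module.Basis (Fin 7) ℝ (Fin 7 → ℝ) :=
    ((e.prod (Pi.basisFun ℝ (Fin 4))).map φ).reindex (finSumFinEquiv (m := 3) (n := 4))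
  have hφ : ∀ s t, xyz (φ (s, t)) = s := by
    intro s t; funext i; fin_cases i <;> rfl
  have h1 : ∀ i : Fin 3, xyz (E (Fin.castAdd 4 i)) = e i := by
    intro i
    have h : (finSumFinEquiv (m := 3) (n := 4)).symm (Fin.castAdd 4 i) = Sum.inl i :=
      finSumFinEquiv_symm_apply_castAdd i
    rw [show E (Fin.castAdd 4 i) = ((e.prod (Pi.basisFun ℝ (Fin 4))).map φ) (Sum.inl i) from
      (Module.Basis.reindex_apply _ _ _).trans (congrArg _ h)]
    simp [hφ]
  have h2 : ∀ i : Fin 4, xyz (E (Fin.natAdd 3 i)) = 0 := by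
    intro i
    have h : (finSumFinEquiv (m := 3) (n := 4)).symm (Fin.natAdd 3 i) = Sum.inr i :=
      finSumFinEquiv_symm_apply_natAdd i
    rw [show E (Fin.natAdd 3 i) = ((e.prod (Pi.basisFun ℝ (Fin 4))).map φ) (Sum.inr i) from
      (Module.Basis.reindex_apply _ _ _).trans (congrArg _ h)]
    simp [hφ]
  refine ⟨E, fun i j => ?_⟩
  rw [hB]
  refine Fin.addCases (m := 3) (n := 4) (fun i => ?_) (fun i => ?_) i <;>
    refine Fin.addCases (m := 3) (n := 4) (fun j => ?_) (fun j => ?_) j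
  · rw [h1, h1, he]
    fin_cases i <;> fin_cases j <;> simp
  · rw [h2]
    have : (Fin.castAdd 4 i : Fin 7) ≠ Fin.natAdd 3 j := by
      fin_cases i <;> fin_cases j <;> decide
    simp [this]
  · rw [h2]
    have : (Fin.natAdd 3 i : Fin 7) ≠ Fin.castAdd 4 j := by
      fin_cases i <;> fin_cases j <;> decide
    simp [this]
  · rw [h2]
    fin_cases i <;> fin_cases j <;> simp

lemma hasSignature_g3 {b : Fin 4 → ℝ} (h2 : Fp F 2 b ≠ 0) :
    HasSignature (Matrix.toBilin' (g3 F b)) ![1, 1, -1] :=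
  hasSignature_toBilin' g3_symm hfac_pos (mul_ne_zero hfac_pos.ne' h2) g3_vD_vD g3_vN_vN g3_vD_vN
    g3_vN_vZ

/-- The logarithm of the conformal factor between `g̃` and the normalised metric. -/
noncomputable def φ0 (F : (Fin 4 → ℝ) → ℝ) (q : Fin 7 → ℝ) : ℝ :=
  1 / 3 * Real.log (q 5 ^ 3 * Fp F 2 (base q))

/-- `Real.log` is `log |·|`, so no sign of `u₅` or `F_pp` matters. -/
lemma exp_φ0 {q : Fin 7 → ℝ} (h5 : q 5 ≠ 0) (h2 : Fp F 2 (base q) ≠ 0) :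
    Real.exp (2 * φ0 F q) * hfac F (base q) = q 5 ^ 2 := by
  rw [φ0, hfac, ← Real.exp_add, Real.log_mul (pow_ne_zero 3 h5) h2, Real.log_pow,
    ← Real.exp_log (show 0 < q 5 ^ 2 by positivity), Real.log_pow]
  congr 1; push_cast; ring

variable (h2 : ∀ b ∈ U, Fp F 2 b ≠ 0)
include h2

lemma gTilde_eq_exp {q : Fin 7 → ℝ} (hq : q ∈ P7 U) (v w : Fin 7 → ℝ) :
    gTilde F q v w = Real.exp (2 * φ0 F q) * bil (g3 F (base q)) (xyz v) (xyz w) := by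
  rw [gTilde_eq h2 hq, ← exp_φ0 hq.2.2 (h2 _ hq.1)]
  simp only [bil, g3, Matrix.smul_apply, smul_eq_mul, Fin.sum_univ_three]
  ring

lemma hasSignature_gTilde {q : Fin 7 → ℝ} (hq : q ∈ P7 U) :
    HasSignature (gTilde F q) ![1, 1, -1, 0, 0, 0, 0] := by
  have hpos := Real.exp_pos (2 * φ0 F q)
  have hs : ∀ v w, bil (Real.exp (2 * φ0 F q) • g3 F (base q)) v w
      = Real.exp (2 * φ0 F q) * bil (g3 F (base q)) v w := by
    intro v w
    simp only [bil, Matrix.smul_apply, smul_eq_mul, Fin.sum_univ_three]; ring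
  refine hasSignature_horizontal (M := Real.exp (2 * φ0 F q) • g3 F (base q))
    (hasSignature_toBilin' (D := vD (base q)) (N := vN F (base q)) (Z := vZ) ?_
      (mul_pos hpos (hfac_pos (F := F) (b := base q)))
      (mul_ne_zero hpos.ne' (mul_ne_zero (hfac_pos (F := F) (b := base q)).ne' (h2 _ hq.1)))
      ?_ ?_ ?_ ?_) ?_
  · intro i j; simp [g3_symm i j]
  · rw [hs, g3_vD_vD]
  · rw [hs, g3_vN_vN, mul_zero]
  · rw [hs, g3_vD_vN, mul_zero]
  · rw [hs, g3_vN_vZ]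
  · intro v w
    rw [gTilde_eq_exp h2 hq, ← hs, Matrix.toBilin'_apply]
    exact Finset.sum_congr rfl fun i _ => Finset.sum_congr rfl fun j _ => by ring

lemma mem_D4_iff_radical {q : Fin 7 → ℝ} (hq : q ∈ P7 U) (v : Fin 7 → ℝ) :
    v ∈ D4 F q ↔ ∀ w, gTilde F q v w = 0 := by
  rw [mem_D4_iff h2 hq]
  constructor
  · intro hv w
    rw [gTilde_eq h2 hq, hv]; simp [bil]
  · intro h
    have hne := h2 _ hq.1
    have h' : ∀ u, bil (G3 F (base q)) (xyz v) u = 0 := fun u => by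
      have := h (horiz u)
      rw [gTilde_eq h2 hq, xyz_horiz] at this
      exact (mul_eq_zero.1 this).resolve_left (pow_ne_zero 2 hq.2.2)
    generalize xyz v = s at h'
    generalize base q = b at h' hne
    have eN := h' (vN F b)
    have eD := h' (vD b)
    have eZ := h' vZ
    simp [bil, G3, vN, vD, vZ, cα, cω, cy, Fin.sum_univ_three] at eN eD eZ
    have n0 : -b 3 * s 0 - F b * s 1 + s 2 = 0 := by
      refine (mul_eq_zero.1 (?_ : Fp F 2 b * _ = 0)).resolve_left hne
      linear_combination eN
    have a0 : s 0 + Fp F 1 b * s 1 = 0 := by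
      linear_combination eD + Fp F 3 b / (3 * Fp F 2 b) * n0
    have y0 : s 1 = 0 := by
      refine (mul_eq_zero.1 (?_ : Fp F 2 b * _ = 0)).resolve_left hne
      linear_combination eZ + Fp F 3 b / (3 * Fp F 2 b) * a0
        - (5 * Fp F 3 b ^ 2 - 3 * Fp F 2 b * Fp F 4 b) / (9 * Fp F 2 b ^ 2) * n0
    have x0 : s 0 = 0 := by simpa [y0] using a0
    have z0 : s 2 = 0 := by simpa [x0, y0] using n0
    funext i; fin_cases i <;> assumption

lemma finrank_D4 {q : Fin 7 → ℝ} (hq : q ∈ P7 U) : Module.finrank ℝ (D4 F q) = 4 := by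
  have hker : D4 F q = LinearMap.ker (xyzL : (Fin 7 → ℝ) →ₗ[ℝ] (Fin 3 → ℝ)) := by
    ext v
    rw [mem_D4_iff h2 hq, xyz_eq]; rfl
  have hsurj : Function.Surjective (xyzL : (Fin 7 → ℝ) →ₗ[ℝ] (Fin 3 → ℝ)) := fun s =>
    ⟨horiz s, (xyz_eq _).symm.trans (xyz_horiz s)⟩
  have := LinearMap.finrank_range_add_finrank_ker (xyzL : (Fin 7 → ℝ) →ₗ[ℝ] (Fin 3 → ℝ))
  rw [LinearMap.range_eq_top.2 hsurj, finrank_top] at this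
  rw [hker]
  simp at this
  omega

lemma d4Integrable : D4Integrable F U := by
  intro W X Y hW hWU hX hY hXD hYD q hq
  -- Sections of `𝒟₄` lie in the constant kernel of `xyz`, so all their derivatives do too.
  have key : ∀ Z : (Fin 7 → ℝ) → (Fin 7 → ℝ), ContDiffOn ℝ ∞ Z W → (∀ q ∈ W, Z q ∈ D4 F q) →
      ∀ v, xyz (fderiv ℝ Z q v) = 0 := by
    intro Z hZ hZD v
    have hd : HasFDerivAt Z (fderiv ℝ Z q) q :=
      ((hZ.contDiffAt (hW.mem_nhds hq)).differentiableAt (by simp)).hasFDerivAt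
    have h1 := xyzL.hasFDerivAt.comp q hd
    have h0 : xyzL ∘ Z =ᶠ[nhds q] fun _ => 0 := by
      filter_upwards [hW.mem_nhds hq] with q' hq'
      rw [Function.comp_apply, ← xyz_eq]
      exact (mem_D4_iff h2 (hWU hq')).1 (hZD q' hq')
    have := h1.unique ((hasFDerivAt_const (0 : Fin 3 → ℝ) q).congr_of_eventuallyEq h0)
    rw [xyz_eq]
    exact congrArg (fun L => L v) this
  rw [mem_D4_iff h2 (hWU hq), VectorField.lieBracket, xyz_eq, map_sub, ← xyz_eq, ← xyz_eq,
    key X hX hXD, key Y hY hYD, sub_zero]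

end Form

/-! ### The local coordinates `(x, y, z)` on the leaf space -/

section LocalCoordinates

variable {U : Opens (Fin 4 → ℝ)} {F : (Fin 4 → ℝ) → ℝ} (h2 : ∀ b ∈ U, Fp F 2 b ≠ 0)
include h2

/-- Leaf paths can be translated by small vectors. -/
lemma LeafStep.eventually_translate {q q' : P7 U} (h : LeafStep F U q q') :
    ∀ᶠ ε in nhds (0 : Fin 7 → ℝ), ∃ (hq : (q : Fin 7 → ℝ) + ε ∈ P7 U)
      (hq' : (q' : Fin 7 → ℝ) + ε ∈ P7 U), leaf F U ⟨_, hq⟩ = leaf F U ⟨_, hq'⟩ := by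
  obtain ⟨γ, hγ, h0, h1, ht⟩ := h
  obtain ⟨δ, hδ, hsub⟩ := (isCompact_Icc.image_of_continuousOn
    hγ.continuousOn).exists_thickening_subset_open (isOpen_P7 U)
    (by rintro _ ⟨t, hti, rfl⟩; exact (ht t hti).1)
  filter_upwards [Metric.ball_mem_nhds (0 : Fin 7 → ℝ) hδ] with ε hε
  have hmem : ∀ t ∈ Icc (0 : ℝ) 1, γ t + ε ∈ P7 U := fun t hti =>
    hsub (Metric.mem_thickening_iff.2 ⟨γ t, mem_image_of_mem _ hti, by simpa using hε⟩)
  refine ⟨h0 ▸ hmem 0 (by simp), h1 ▸ hmem 1 (by simp), Quotient.sound (.rel _ _ ?_)⟩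
  refine ⟨fun t => γ t + ε, hγ.add contDiffOn_const, by simp [h0], by simp [h1], fun t hti => ?_⟩
  refine ⟨hmem t hti, ?_⟩
  rw [derivWithin_add_const, mem_D4_iff h2 (hmem t hti)]
  exact (mem_D4_iff h2 (ht t hti).1).1 (ht t hti).2

lemma eventually_translate {q q' : P7 U} (h : leaf F U q = leaf F U q') :
    ∀ᶠ ε in nhds (0 : Fin 7 → ℝ), ∃ (hq : (q : Fin 7 → ℝ) + ε ∈ P7 U)
      (hq' : (q' : Fin 7 → ℝ) + ε ∈ P7 U), leaf F U ⟨_, hq⟩ = leaf F U ⟨_, hq'⟩ := by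
  have h' : Relation.EqvGen (LeafStep F U) q q' := Quotient.exact h
  clear h
  induction h' with
  | rel _ _ h => exact h.eventually_translate h2
  | refl x =>
    have : ∀ᶠ ε in nhds (0 : Fin 7 → ℝ), (x : Fin 7 → ℝ) + ε ∈ P7 U :=
      (Continuous.tendsto' (by fun_prop) 0 (x : Fin 7 → ℝ) (by simp)).eventually
        ((isOpen_P7 U).mem_nhds x.2)
    filter_upwards [this] with ε hε using ⟨hε, hε, rfl⟩
  | symm _ _ _ ih =>
    filter_upwards [ih] with ε ⟨a, b, c⟩ using ⟨b, a, c.symm⟩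
  | trans _ _ _ _ _ iha ihb =>
    filter_upwards [iha, ihb] with ε ⟨a, _, c⟩ ⟨_, b', c'⟩ using ⟨a, b', c.trans c'⟩

/-- `𝒟₄` is invariant under translations of `ℝ⁷`. If `q` and `q'` share a leaf, then so do `q + ε`
and `q' + ε` for small `ε`, and a neighbourhood of `q` sweeps out one of `q'` modulo leaves. -/
lemma isOpenMap_leaf : IsOpenMap (leaf F U) := by
  intro O hO
  refine isOpen_coinduced.2 (isOpen_iff_mem_nhds.2 ?_)
  rintro q' ⟨q, hq, hqq⟩
  have hqq' : leaf F U q = leaf F U q' := hqq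
  obtain ⟨O', hO', rfl⟩ := isOpen_induced_iff.1 hO
  have hev : ∀ᶠ ε in nhds (0 : Fin 7 → ℝ), (q : Fin 7 → ℝ) + ε ∈ O' :=
    (Continuous.tendsto' (by fun_prop) 0 (q : Fin 7 → ℝ) (by simp)).eventually
      (hO'.mem_nhds hq)
  have htend : Filter.Tendsto (fun x : P7 U => (x : Fin 7 → ℝ) - q') (nhds q') (nhds 0) :=
    Continuous.tendsto' (by fun_prop) _ _ (by simp)
  filter_upwards [htend.eventually (hev.and (eventually_translate h2 hqq'))] with x hx
  obtain ⟨hx1, a, b, c⟩ := hx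
  refine ⟨⟨_, a⟩, hx1, c.trans ?_⟩
  change leaf F U _ = leaf F U x
  congr 1
  ext1
  simp

omit h2 in
lemma isOpenMap_xyz : IsOpenMap xyz := by
  rw [show xyz = xyzL from funext xyz_eq]
  exact xyzL.isOpenMap fun s => ⟨horiz s, (xyz_eq _).symm.trans (xyz_horiz s)⟩

lemma exists_localHomeomorph :
    ∃ χ : LeafSpace F U → (Fin 3 → ℝ), IsLocalHomeomorph χ ∧
      ∀ q : P7 U, χ (leaf F U q) = xyz q := by
  have hx : Continuous fun q : P7 U => xyz (q : Fin 7 → ℝ) := by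
    simp only [xyz_eq]; fun_prop
  let χ : LeafSpace F U → (Fin 3 → ℝ) :=
    Quotient.lift (fun q : P7 U => xyz q) fun q q' h => eq_of_leafStep_xyz h2 (Quotient.sound h)
  have hχ : ∀ q : P7 U, χ (leaf F U q) = xyz q := fun _ => rfl
  have hc : Continuous χ := hx.quotient_lift _
  have ho : IsOpenMap χ := by
    intro O hO
    have : χ '' O = (fun q : P7 U => xyz (q : Fin 7 → ℝ)) '' (leaf F U ⁻¹' O) := by
      ext s
      constructor
      · rintro ⟨l, hl, rfl⟩
        obtain ⟨q, rfl⟩ := Quotient.exists_rep l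
        exact ⟨q, hl, rfl⟩
      · rintro ⟨q, hq, rfl⟩
        exact ⟨leaf F U q, hq, rfl⟩
    rw [this]
    exact (isOpenMap_xyz.comp (isOpen_P7 U).isOpenMap_subtype_val) _
      (hO.preimage continuous_quot_mk)
  refine ⟨χ, isLocalHomeomorph_iff_isOpenEmbedding_restrict.2 fun l => ?_, hχ⟩
  obtain ⟨q, rfl⟩ := Quotient.exists_rep l
  obtain ⟨ε, hε, hball⟩ := Metric.isOpen_iff.1 (isOpen_P7 U) q q.2
  set O : Set (P7 U) := Subtype.val ⁻¹' Metric.ball (q : Fin 7 → ℝ) ε with hO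
  have hOo : IsOpen (leaf F U '' O) :=
    isOpenMap_leaf h2 _ (Metric.isOpen_ball.preimage continuous_subtype_val)
  refine ⟨leaf F U '' O, hOo.mem_nhds ⟨q, Metric.mem_ball_self hε, rfl⟩, ?_⟩
  refine .of_continuous_injective_isOpenMap (hc.comp continuous_subtype_val) ?_
    (ho.comp hOo.isOpenMap_subtype_val)
  -- Two points of a ball with equal `(x, y, z)` are joined by a vertical segment inside the ball.
  rintro ⟨_, a, ha, rfl⟩ ⟨_, a', ha', rfl⟩ haa
  ext1
  exact leaf_eq_of_segment h2 (((convex_ball _ ε).segment_subset ha ha').trans hball) haa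

end LocalCoordinates

/-! ### Descent to the leaf space -/

section Descent

variable {U : Opens (Fin 4 → ℝ)} {F : (Fin 4 → ℝ) → ℝ}

lemma bil_single (M : Matrix (Fin 3) (Fin 3) ℝ) (i j : Fin 3) :
    bil M (Pi.single i 1) (Pi.single j 1) = M i j := by
  simp [bil, Pi.single_apply]

/-- A point of `P₇` over a given point of `U`. -/
def lift (b : Fin 4 → ℝ) : Fin 7 → ℝ := ![b 0, b 1, b 2, b 3, 1, 1, 0]

lemma base_lift (b : Fin 4 → ℝ) : base (lift b) = b := by
  funext i; fin_cases i <;> rfl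

lemma lift_mem {b : Fin 4 → ℝ} (hb : b ∈ U) : lift b ∈ P7 U :=
  ⟨by rwa [base_lift], by simp [lift], by simp [lift]⟩

lemma fderiv_comp_base_vertical' {f : (Fin 4 → ℝ) → ℝ} {q : Fin 7 → ℝ}
    (hf : DifferentiableAt ℝ f (base q)) {v : Fin 7 → ℝ} (hv : xyz v = 0) :
    fderiv ℝ (fun q => f (base q)) q v = v 3 * pd 3 f (base q) := by
  rw [(hasFDerivAt_comp_base hf).fderiv, ContinuousLinearMap.comp_apply, fderiv_eq_sum_pd,
    ← base_eq]
  obtain ⟨x, y, z⟩ := xyz_eq_zero_iff.1 hv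
  rw [Fin.sum_univ_four]
  simp [base, x, y, z]

lemma xyz_single_three : xyz (Pi.single 3 1) = 0 := by
  funext i; fin_cases i <;> simp [xyz]

variable (hF : ContDiffOn ℝ ∞ F U) (h2 : ∀ b ∈ U, Fp F 2 b ≠ 0)

include hF h2 in
lemma contDiffOn_φ0 : ContDiffOn ℝ ∞ (φ0 F) (P7 U) := by
  refine contDiffOn_const.mul (ContDiffOn.log (.mul ?_ (contDiffOn_comp_base (contDiffOn_Fp hF 2)))
    fun q hq => mul_ne_zero (pow_ne_zero 3 hq.2.2) (h2 _ hq.1))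
  exact ((contDiff_apply ℝ ℝ (5 : Fin 7)).contDiffOn).pow 3

include hF h2 in
lemma differentiableAt_φ0 {q : Fin 7 → ℝ} (hq : q ∈ P7 U) : DifferentiableAt ℝ (φ0 F) q :=
  differentiableAt_of_contDiffOn (isOpen_P7 U) (contDiffOn_φ0 hF h2) hq

include h2 in
lemma metricPullsBack_iff {φ : (Fin 7 → ℝ) → ℝ} {g : LorentzMetric F U} :
    MetricPullsBack φ g ↔ ∀ (q : P7 U) (i j : Fin 3),
      Real.exp (2 * φ0 F q) * g3 F (base q) i j = Real.exp (2 * φ q) * g.coeff (leaf F U q) i j := by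
  constructor
  · intro h q i j
    have := h q (horiz (Pi.single i 1)) (horiz (Pi.single j 1))
    rw [gTilde_eq_exp h2 q.2, xyz_horiz, xyz_horiz, bil_single] at this
    rw [this]
    congr 1
    rw [← bil_single (g.coeff (leaf F U q)) i j, LorentzMetric.pullback, xyz_horiz, xyz_horiz, bil]
  · intro h q v w
    rw [gTilde_eq_exp h2 q.2]
    simp only [LorentzMetric.pullback, bil, Finset.mul_sum]
    refine Finset.sum_congr rfl fun i _ => Finset.sum_congr rfl fun j _ => ?_
    linear_combination h q i j * xyz v i * xyz w j

include hF h2 in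
-- The exact part of `Ω₃` is the differential of the same `φ0` that scales `g̃`; this is what
-- couples the two descents into a Weyl class.
lemma Ω3_eq {q : Fin 7 → ℝ} (hq : q ∈ P7 U) (v : Fin 7 → ℝ) :
    Ω3 F q v = ∑ i, r3 F i (base q) * xyz v i + fderiv ℝ (φ0 F) q v := by
  have hd : DifferentiableAt ℝ (fun q' : Fin 7 → ℝ => Real.log (q' 5 ^ 3 * Fp F 2 (base q'))) q := by
    have := (differentiableAt_φ0 hF h2 hq).const_mul 3
    refine this.congr_of_eventuallyEq (.of_forall fun q' => ?_)
    simp only [φ0]; ring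
  have : fderiv ℝ (φ0 F) q = (1 / 3 : ℝ) •
      fderiv ℝ (fun q' : Fin 7 → ℝ => Real.log (q' 5 ^ 3 * Fp F 2 (base q'))) q :=
    fderiv_const_mul hd _
  rw [this, Fin.sum_univ_three]
  simp [Ω3, dq, r3, xyz]

include hF h2 in
lemma formPullsBack_iff {φ : (Fin 7 → ℝ) → ℝ} {A : OneForm F U} :
    FormPullsBack φ A ↔ ∀ (q : P7 U) (v : Fin 7 → ℝ),
      ∑ i, r3 F i (base q) * xyz v i + fderiv ℝ (φ0 F) (q : Fin 7 → ℝ) v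
        = ∑ i, A.coeff (leaf F U q) i * xyz v i + fderiv ℝ φ (q : Fin 7 → ℝ) v := by
  refine forall_congr' fun q => forall_congr' fun v => ?_
  rw [Ω3_eq hF h2 q.2, OneForm.pullback]

/-- If `g̃ = e^{2φ} π^* g`, then `φ` agrees with the logarithmic factor `φ0` up to a function with
vanishing derivative along the leaves, and the Monge invariant vanishes. -/
lemma MetricPullsBack.vertical (hF : ContDiffOn ℝ ∞ F U) (h2 : ∀ b ∈ U, Fp F 2 b ≠ 0)
    {φ : (Fin 7 → ℝ) → ℝ} {g : LorentzMetric F U}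
    (hφ : ContDiffOn ℝ ∞ φ (P7 U)) (h : MetricPullsBack φ g) {q : Fin 7 → ℝ} (hq : q ∈ P7 U)
    {v : Fin 7 → ℝ} (hv : xyz v = 0) :
    fderiv ℝ (fun q => φ q - φ0 F q) q v = 0 ∧ v 3 * Monge F (base q) = 0 := by
  rw [metricPullsBack_iff h2] at h
  have dφ := differentiableAt_of_contDiffOn (isOpen_P7 U) hφ hq
  have d0 := differentiableAt_φ0 hF h2 hq
  set χ := fun q => φ q - φ0 F q with hχ
  have dχ : DifferentiableAt ℝ χ q := dφ.fun_sub d0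
  have hne := h2 _ hq.1
  have key : ∀ i j, 2 * fderiv ℝ χ q v * g3 F (base q) i j
      = v 3 * -(hfac F (base q) * Monge F (base q) / (27 * Fp F 2 (base q) ^ 3)
        * (cω F (base q) i * cω F (base q) j)) := by
    intro i j
    have dg := differentiableAt_of_smooth (contDiffOn_g3 hF h2 i j) hq.1
    have e1 : (fun q => g3 F (base q) i j)
        =ᶠ[nhds q] fun q => Real.exp (2 * χ q) * pull (fun l => g.coeff l i j) q := by
      filter_upwards [(isOpen_P7 U).mem_nhds hq] with q' hq'
      rw [pull_apply _ ⟨q', hq'⟩]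
      have := h ⟨q', hq'⟩ i j
      refine mul_left_cancel₀ (Real.exp_pos (2 * φ0 F q')).ne' (this.trans ?_)
      rw [← mul_assoc, ← Real.exp_add, hχ]
      congr 2; ring
    have e2 := e1.fderiv_eq (𝕜 := ℝ)
    have e3 := congrArg (fun L => L v) e2
    have hE : HasFDerivAt (fun q => Real.exp (2 * χ q))
        (Real.exp (2 * χ q) • ((2 : ℝ) • fderiv ℝ χ q)) q := (dχ.hasFDerivAt.const_mul 2).exp
    have hP := ((g.smooth i j).differentiableAt ⟨q, hq⟩).hasFDerivAt
    simp only [(hE.fun_mul hP).fderiv] at e3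
    rw [fderiv_comp_base_vertical' dg hv, pd_three_g3 hF h2 hq.1] at e3
    have hz := fderiv_pull_vertical h2 (g.smooth i j) ⟨q, hq⟩ hv
    simp only [add_apply, smul_apply, smul_eq_mul, hz] at e3
    have e4 := e1.self_of_nhds
    simp only at e4
    rw [e4, e3]
    ring
  -- On `(D, D)` the right-hand side of `key` vanishes, since `ω¹(D) = 0`, while `g3(D, D) = hfac >
  -- 0`.
  have hD : 2 * fderiv ℝ χ q v * hfac F (base q) = 0 := by
    rw [← g3_vD_vD]
    have : 2 * fderiv ℝ χ q v * bil (g3 F (base q)) (vD (base q)) (vD (base q))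
        = ∑ i, ∑ j, (2 * fderiv ℝ χ q v * g3 F (base q) i j) * vD (base q) i * vD (base q) j := by
      simp only [bil, Fin.sum_univ_three]; ring
    rw [this]
    simp only [key]
    simp [Fin.sum_univ_three, cω, vD]
    ring
  have h0 : fderiv ℝ χ q v = 0 := by
    have := hfac_pos (F := F) (b := base q)
    simpa [this.ne'] using hD
  refine ⟨h0, ?_⟩
  -- The `zz` entry isolates the Monge invariant, because the `dz` coefficient of `ω¹` is `1`.
  have := key 2 2
  rw [h0] at this
  have hp := (hfac_pos (F := F) (b := base q)).ne'
  simp [cω, hp, hne] at this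
  simpa using this

include hF h2

lemma MetricPullsBack.monge {φ : (Fin 7 → ℝ) → ℝ} {g : LorentzMetric F U}
    (hφ : ContDiffOn ℝ ∞ φ (P7 U)) (h : MetricPullsBack φ g) : ∀ b ∈ U, Monge F b = 0 := by
  intro b hb
  have := (h.vertical hF h2 hφ (lift_mem hb) xyz_single_three).2
  simpa [base_lift] using this

lemma FormPullsBack.vertical {φ : (Fin 7 → ℝ) → ℝ} {A : OneForm F U}
    (hφ : ContDiffOn ℝ ∞ φ (P7 U)) (h : FormPullsBack φ A) {q : Fin 7 → ℝ} (hq : q ∈ P7 U)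
    {v : Fin 7 → ℝ} (hv : xyz v = 0) : fderiv ℝ (fun q => φ q - φ0 F q) q v = 0 := by
  have := (formPullsBack_iff hF h2).1 h ⟨q, hq⟩ v
  rw [fderiv_fun_sub (differentiableAt_of_contDiffOn (isOpen_P7 U) hφ hq)
    (differentiableAt_φ0 hF h2 hq)]
  simp [hv] at this
  simp [this]

/-- A primitive which agrees with `φ0` to first order along the leaves differs from it by a function
on the leaf space. -/
lemma exists_pull {φ : (Fin 7 → ℝ) → ℝ} (hφ : ContDiffOn ℝ ∞ φ (P7 U))
    (hv : ∀ q ∈ P7 U, ∀ v, xyz v = 0 → fderiv ℝ (fun q => φ q - φ0 F q) q v = 0) :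
    ∃ ψ : LeafSpace F U → ℝ, LeafSmooth ψ ∧ ∀ q ∈ P7 U, φ q = φ0 F q + pull ψ q := by
  obtain ⟨ψ, hψ, h⟩ := exists_leafSmooth h2 (hφ.sub (contDiffOn_φ0 hF h2)) hv
  refine ⟨ψ, hψ, fun q hq => ?_⟩
  rw [pull_apply ψ ⟨q, hq⟩, h]; simp

lemma contDiffOn_φ0_add_pull {ψ : LeafSpace F U → ℝ} (hψ : LeafSmooth ψ) :
    ContDiffOn ℝ ∞ (fun q => φ0 F q + pull ψ q) (P7 U) :=
  (contDiffOn_φ0 hF h2).add hψ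

lemma formPullsBack_add_pull_iff {φ : (Fin 7 → ℝ) → ℝ} {ψ : LeafSpace F U → ℝ}
    (hψ : LeafSmooth ψ) (hφ : ∀ q ∈ P7 U, φ q = φ0 F q + pull ψ q) {A : OneForm F U} :
    FormPullsBack φ A ↔ ∀ (q : P7 U) (i : Fin 3),
      r3 F i (base q) = A.coeff (leaf F U q) i + dM ψ i q := by
  have hd : ∀ (q : P7 U) v, fderiv ℝ φ (q : Fin 7 → ℝ) v
      = fderiv ℝ (φ0 F) (q : Fin 7 → ℝ) v + ∑ i, dM ψ i q * xyz v i := by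
    intro q v
    have e : φ =ᶠ[nhds (q : Fin 7 → ℝ)] fun q => φ0 F q + pull ψ q :=
      Filter.eventually_of_mem ((isOpen_P7 U).mem_nhds q.2) hφ
    rw [e.fderiv_eq, fderiv_fun_add (differentiableAt_φ0 hF h2 q.2) (hψ.differentiableAt q),
      add_apply, fderiv_pull h2 hψ]
  rw [formPullsBack_iff hF h2]
  constructor
  · intro h q i
    have := h q (horiz (Pi.single i 1))
    rw [hd, xyz_horiz] at this
    simp [Pi.single_apply] at this
    linear_combination this
  · intro h q v
    simp only [hd, h, add_mul, Finset.sum_add_distrib]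
    ring

/-- Here `r_z = A_z + ∂_z ψ` with `A_z` and `ψ` coming from the leaf space, so `∂_p r_z = 0`. -/
lemma FormPullsBack.kInv {φ : (Fin 7 → ℝ) → ℝ} {A : OneForm F U}
    (hφ : ContDiffOn ℝ ∞ φ (P7 U)) (h : FormPullsBack φ A) : ∀ b ∈ U, KInv F b = 0 := by
  obtain ⟨ψ, hψ, hφψ⟩ := exists_pull hF h2 hφ fun q hq v hv =>
    FormPullsBack.vertical hF h2 hφ h hq hv
  have hr := (formPullsBack_add_pull_iff hF h2 hψ hφψ).1 h
  refine kInv_eq_zero_of_pd hF h2 fun b hb => ?_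
  have hq := lift_mem hb
  set q := lift b with hqdef
  have d1 := differentiableAt_of_smooth (contDiffOn_r3 hF h2 2) hq.1
  have e1 := fderiv_comp_base_vertical' d1 xyz_single_three
  rw [Pi.single_eq_same, one_mul, hqdef, base_lift, ← hqdef] at e1
  rw [← e1]
  have e2 : (fun q => r3 F 2 (base q))
      =ᶠ[nhds q] fun q => pull (fun l => A.coeff l 2) q + pd 2 (pull ψ) q := by
    filter_upwards [(isOpen_P7 U).mem_nhds hq] with q' hq'
    rw [pull_apply _ ⟨q', hq'⟩]
    exact hr ⟨q', hq'⟩ 2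
  have hp2 : ContDiffOn ℝ ∞ (pd 2 (pull ψ)) (P7 U) := contDiffOn_pd (isOpen_P7 U) hψ 2
  rw [e2.fderiv_eq, fderiv_fun_add ((A.smooth 2).differentiableAt ⟨q, hq⟩)
    (differentiableAt_of_contDiffOn (isOpen_P7 U) hp2 hq), add_apply]
  have e3 := fderiv_pull_vertical h2 (A.smooth 2) ⟨q, hq⟩ xyz_single_three
  have e4 : pd 3 (pd 2 (pull ψ)) q = 0 := by
    rw [pd_comm (isOpen_P7 U) hψ hq, pd_congr (g := fun _ => 0) (isOpen_P7 U) (fun q' hq' =>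
      fderiv_pull_vertical h2 hψ ⟨q', hq'⟩ xyz_single_three) hq, pd_const]
  rw [pd] at e4
  rw [e3, e4, add_zero]

/-- The normalised metric on the leaf space. -/
noncomputable def gBar (hM : ∀ b ∈ U, Monge F b = 0) : LorentzMetric F U where
  coeff l := g3 F (base (Quotient.out l : P7 U))
  smooth i j := leafSmooth_desc h2 (isBasic_g3 hF h2 hM i j)
  lorentz l := hasSignature_g3 (h2 _ (Quotient.out l : P7 U).2.1)

/-- The 1-form `r_x dx + r_y dy + r_z dz` on the leaf space. -/
noncomputable def rBar (hK : ∀ b ∈ U, KInv F b = 0) : OneForm F U where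
  coeff l i := r3 F i (base (Quotient.out l : P7 U))
  smooth i := leafSmooth_desc h2 (isBasic_r3 hF h2 hK i)

lemma gBar_leaf (hM : ∀ b ∈ U, Monge F b = 0) (q : P7 U) :
    (gBar hF h2 hM).coeff (leaf F U q) = g3 F (base q) := by
  ext i j; exact desc_leaf h2 (isBasic_g3 hF h2 hM i j) q

lemma rBar_leaf (hK : ∀ b ∈ U, KInv F b = 0) (q : P7 U) (i : Fin 3) :
    (rBar hF h2 hK).coeff (leaf F U q) i = r3 F i (base q) :=
  desc_leaf h2 (isBasic_r3 hF h2 hK i) q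

lemma metricPullsBack_iff_isRescaling (hM : ∀ b ∈ U, Monge F b = 0) {φ : (Fin 7 → ℝ) → ℝ}
    {ψ : LeafSpace F U → ℝ} (hφ : ∀ q ∈ P7 U, φ q = φ0 F q + pull ψ q) {g : LorentzMetric F U} :
    MetricPullsBack φ g ↔ IsRescaling ψ g (gBar hF h2 hM) := by
  have key : ∀ (q : P7 U) (i j : Fin 3),
      (Real.exp (2 * φ0 F q) * g3 F (base q) i j = Real.exp (2 * φ q) * g.coeff (leaf F U q) i j ↔
      g3 F (base q) i j = Real.exp (2 * ψ (leaf F U q)) * g.coeff (leaf F U q) i j) := by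
    intro q i j
    rw [hφ q q.2, pull_apply, mul_add, Real.exp_add, mul_assoc]
    exact mul_right_inj' (Real.exp_pos _).ne'
  rw [metricPullsBack_iff h2]
  constructor
  · intro h l
    obtain ⟨q, rfl⟩ := Quotient.exists_rep l
    change (gBar hF h2 hM).coeff (leaf F U q) = _
    rw [gBar_leaf]
    ext i j
    exact (key q i j).1 (h q i j)
  · intro h q i j
    rw [key, ← gBar_leaf hF h2 hM, h]
    rfl

lemma formPullsBack_iff_isGradientShift (hK : ∀ b ∈ U, KInv F b = 0) {φ : (Fin 7 → ℝ) → ℝ}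
    {ψ : LeafSpace F U → ℝ} (hψ : LeafSmooth ψ) (hφ : ∀ q ∈ P7 U, φ q = φ0 F q + pull ψ q)
    {A : OneForm F U} : FormPullsBack φ A ↔ IsGradientShift ψ A (rBar hF h2 hK) := by
  rw [formPullsBack_add_pull_iff hF h2 hψ hφ]
  simp only [IsGradientShift, rBar_leaf]

lemma exists_descendsToConformal_iff :
    (∃ c : ConformalClass F U, DescendsToConformal c) ↔ ∀ b ∈ U, Monge F b = 0 := by
  constructor
  · rintro ⟨c, hc⟩
    obtain ⟨g, rfl⟩ := Quotient.exists_rep c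
    obtain ⟨φ, hφ, h⟩ := (hc g).1 rfl
    exact MetricPullsBack.monge hF h2 hφ h
  · intro hM
    refine ⟨Quotient.mk _ (gBar hF h2 hM), fun g => ⟨fun h => ?_, ?_⟩⟩
    · obtain ⟨ψ, hψ, hr⟩ := Quotient.exact h
      exact ⟨_, contDiffOn_φ0_add_pull hF h2 hψ,
        (metricPullsBack_iff_isRescaling hF h2 hM fun _ _ => rfl).2 hr⟩
    · rintro ⟨φ, hφ, h⟩
      obtain ⟨ψ, hψ, hφψ⟩ := exists_pull hF h2 hφ fun q hq v hv => (h.vertical hF h2 hφ hq hv).1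
      exact Quotient.sound ⟨ψ, hψ, (metricPullsBack_iff_isRescaling hF h2 hM hφψ).1 h⟩

lemma exists_descendsToOneForm_iff :
    (∃ a : OneFormModGradients F U, DescendsToOneForm a) ↔ ∀ b ∈ U, KInv F b = 0 := by
  constructor
  · rintro ⟨a, ha⟩
    obtain ⟨A, rfl⟩ := Quotient.exists_rep a
    obtain ⟨φ, hφ, h⟩ := (ha A).1 rfl
    exact FormPullsBack.kInv hF h2 hφ h
  · intro hK
    refine ⟨Quotient.mk _ (rBar hF h2 hK), fun A => ⟨fun h => ?_, ?_⟩⟩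
    · obtain ⟨ψ, hψ, hr⟩ := Quotient.exact h
      exact ⟨_, contDiffOn_φ0_add_pull hF h2 hψ,
        (formPullsBack_iff_isGradientShift hF h2 hK hψ fun _ _ => rfl).2 hr⟩
    · rintro ⟨φ, hφ, h⟩
      obtain ⟨ψ, hψ, hφψ⟩ := exists_pull hF h2 hφ fun q hq v hv =>
        FormPullsBack.vertical hF h2 hφ h hq hv
      exact Quotient.sound ⟨ψ, hψ, (formPullsBack_iff_isGradientShift hF h2 hK hψ hφψ).1 h⟩

lemma DescendsToWeyl.invariants {s : WeylStructure F U} (hs : DescendsToWeyl s) :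
    (∀ b ∈ U, Monge F b = 0) ∧ ∀ b ∈ U, KInv F b = 0 := by
  obtain ⟨⟨g, A⟩, rfl⟩ := Quotient.exists_rep s
  obtain ⟨φ, hφ, h, h'⟩ := (hs g A).1 rfl
  exact ⟨MetricPullsBack.monge hF h2 hφ h, FormPullsBack.kInv hF h2 hφ h'⟩

lemma exists_descendsToWeyl_iff :
    (∃ s : WeylStructure F U, DescendsToWeyl s) ↔
      (∀ b ∈ U, Monge F b = 0) ∧ (∀ b ∈ U, KInv F b = 0) := by
  constructor
  · rintro ⟨s, hs⟩
    exact DescendsToWeyl.invariants hF h2 hs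
  · rintro ⟨hM, hK⟩
    refine ⟨Quotient.mk _ (gBar hF h2 hM, rBar hF h2 hK), fun g A => ⟨fun h => ?_, ?_⟩⟩
    · obtain ⟨ψ, hψ, hr, hr'⟩ := Quotient.exact h
      exact ⟨_, contDiffOn_φ0_add_pull hF h2 hψ,
        (metricPullsBack_iff_isRescaling hF h2 hM fun _ _ => rfl).2 hr,
        (formPullsBack_iff_isGradientShift hF h2 hK hψ fun _ _ => rfl).2 hr'⟩
    · rintro ⟨φ, hφ, h, h'⟩
      obtain ⟨ψ, hψ, hφψ⟩ := exists_pull hF h2 hφ fun q hq v hv => (h.vertical hF h2 hφ hq hv).1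
      exact Quotient.sound ⟨ψ, hψ, (metricPullsBack_iff_isRescaling hF h2 hM hφψ).1 h,
        (formPullsBack_iff_isGradientShift hF h2 hK hψ hφψ).1 h'⟩

/-! ### Local representatives of the conformal class -/

lemma exists_local_representative (hM : ∀ b ∈ U, Monge F b = 0) :
    ∀ q₀ ∈ P7 U, ∃ W : Set (Fin 7 → ℝ), IsOpen W ∧ q₀ ∈ W ∧ W ⊆ P7 U ∧
      ∃ (G : Fin 3 → Fin 3 → (Fin 3 → ℝ) → ℝ) (φ : (Fin 7 → ℝ) → ℝ),
        (∀ i j, ContDiffOn ℝ ∞ (G i j) (xyz '' W)) ∧ ContDiffOn ℝ ∞ φ W ∧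
        ∀ q ∈ W, ∀ v w : Fin 7 → ℝ, gTilde F q v w =
          Real.exp (2 * φ q) * ∑ i, ∑ j, G i j (xyz q) * xyz v i * xyz w j := by
  intro q₀ hq₀
  obtain ⟨ε, hε, hball⟩ := Metric.isOpen_iff.1 (isOpen_P7 U) q₀ hq₀
  let σ : (Fin 3 → ℝ) → (Fin 7 → ℝ) := fun s => ![s 0, s 1, s 2, q₀ 3, q₀ 4, q₀ 5, q₀ 6]
  -- Balls of the sup norm are cubes, so resetting `p, u₃, u₅, u₈` to their values at `q₀` does not
  -- leave the ball.
  have hσ : ∀ q ∈ Metric.ball q₀ ε, σ (xyz q) ∈ Metric.ball q₀ ε := by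
    intro q hq
    rw [Metric.mem_ball, dist_pi_lt_iff hε] at hq ⊢
    intro i
    fin_cases i
    · exact hq 0
    · exact hq 1
    · exact hq 2
    all_goals simpa [σ] using hε
  have hσs : ContDiff ℝ ∞ fun s => base (σ s) := by
    rw [contDiff_pi]
    intro i
    fin_cases i
    · exact contDiff_apply ℝ ℝ 0
    · exact contDiff_apply ℝ ℝ 1
    · exact contDiff_apply ℝ ℝ 2
    · exact contDiff_const
  refine ⟨Metric.ball q₀ ε, Metric.isOpen_ball, Metric.mem_ball_self hε, hball,
    fun i j s => g3 F (base (σ s)) i j, φ0 F, fun i j => ?_,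
    (contDiffOn_φ0 hF h2).mono hball, fun q hq v w => ?_⟩
  · refine (contDiffOn_g3 hF h2 i j).comp hσs.contDiffOn ?_
    rintro _ ⟨q, hq, rfl⟩
    exact (hball (hσ q hq)).1
  · rw [gTilde_eq_exp h2 (hball hq), bil]
    have hleaf : leaf F U ⟨q, hball hq⟩ = leaf F U ⟨σ (xyz q), hball (hσ q hq)⟩ :=
      leaf_eq_of_segment h2 (((convex_ball _ ε).segment_subset hq (hσ q hq)).trans hball) (by
        funext i; fin_cases i <;> rfl)
    have e := gBar_leaf hF h2 hM ⟨q, hball hq⟩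
    rw [hleaf, gBar_leaf] at e
    simp only [e]

/-! ### The Einstein--Weyl equations on the leaf space -/

omit hF h2 in
-- The antisymmetric part does not contribute to the trace, and the symmetric part is `(s / 2) g`,
-- with trace `3 s / 2`.
lemma sum_inv_mul_of_add_transpose {g R : Matrix (Fin 3) (Fin 3) ℝ} {s : ℝ}
    (hg : ∀ i j, g i j = g j i) (hdet : g.det ≠ 0) (hR : ∀ i j, R i j + R j i = s * g i j) :
    ∑ i, ∑ j, g⁻¹ i j * R i j = 3 / 2 * s := by
  have hsymm : ∀ i j, g⁻¹ i j = g⁻¹ j i := by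
    have ht : g.transpose = g := by ext i j; exact hg j i
    intro i j
    conv_lhs => rw [← ht, ← Matrix.transpose_nonsing_inv]
    rfl
  have h1 : ∑ i, ∑ j, g⁻¹ i j * R i j = ∑ i, ∑ j, g⁻¹ i j * R j i := by
    rw [Finset.sum_comm]
    exact Finset.sum_congr rfl fun i _ => Finset.sum_congr rfl fun j _ => by rw [hsymm]
  have h3 : ∑ i, ∑ j, g⁻¹ i j * g j i = 3 := by
    have : ∀ i, ∑ j, g⁻¹ i j * g j i = 1 := fun i => by
      rw [← Matrix.mul_apply, Matrix.nonsing_inv_mul _ hdet.isUnit, Matrix.one_apply_eq]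
    simp [this]
  have h4 : ∑ i, ∑ j, g⁻¹ i j * R i j + ∑ i, ∑ j, g⁻¹ i j * R j i
      = s * ∑ i, ∑ j, g⁻¹ i j * g j i := by
    simp only [← Finset.sum_add_distrib, Finset.mul_sum]
    refine Finset.sum_congr rfl fun i _ => Finset.sum_congr rfl fun j _ => ?_
    rw [← mul_add, hR, hg]; ring
  rw [h3, ← h1] at h4
  linarith

lemma DescendsToWeyl.isEinsteinWeyl (hDF : ∀ b ∈ U, DF F b = 0) {s : WeylStructure F U}
    (hs : DescendsToWeyl s) : IsEinsteinWeyl s := by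
  obtain ⟨hM, hK⟩ := DescendsToWeyl.invariants hF h2 hs
  intro g A hgA
  obtain ⟨φ, hφ, h, h'⟩ := (hs g A).1 hgA
  obtain ⟨ψ, hψ, hφψ⟩ := exists_pull hF h2 hφ fun q hq v hv => (h.vertical hF h2 hφ hq hv).1
  have hg : ∀ q : P7 U, g3 F (base q) = Real.exp (2 * ψ (leaf F U q)) • g.coeff (leaf F U q) := by
    intro q
    rw [← gBar_leaf hF h2 hM]
    exact (metricPullsBack_iff_isRescaling hF h2 hM hφψ).1 h _
  have hA := (formPullsBack_add_pull_iff hF h2 hψ hφψ).1 h'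
  have hg' : ∀ (q : P7 U) i j,
      g.coeff (leaf F U q) i j = Real.exp (-2 * ψ (leaf F U q)) * g3 F (base q) i j := by
    intro q i j
    rw [hg q, Matrix.smul_apply, smul_eq_mul, ← mul_assoc, ← Real.exp_add]
    simp
  have hΓ := isBasic_Γ3 hF h2 hM hK
  -- The Weyl connection depends only on the class of `(g, A)`, so the connection of the normalised
  -- pair serves every representative.
  refine ⟨fun μ ν σ => desc F (Γ3 F μ ν σ), ⟨fun μ ν σ => leafSmooth_desc h2 (hΓ μ ν σ),
    fun μ ν σ l => ?_, fun q μ ν σ => ?_⟩, fun q μ ν => ?_⟩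
  · simp only [desc, Γ3_symm μ ν σ]
  · have hd : dM (fun l => g.coeff l μ ν) σ q = Real.exp (-2 * ψ (leaf F U q)) *
        (dd σ (fun b => g3 F b μ ν) (base q) - 2 * dM ψ σ q * g3 F (base q) μ ν) := by
      have dg := differentiableAt_of_smooth (contDiffOn_g3 hF h2 μ ν) q.2.1
      have dg' := (hasFDerivAt_comp_base dg).differentiableAt
      have dψ : DifferentiableAt ℝ (pull ψ) (q : Fin 7 → ℝ) := hψ.differentiableAt q
      rw [dM_eq (H := fun q => Real.exp (-2 * pull ψ q) * g3 F (base q) μ ν) (fun q => by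
          rw [hg' q, pull_apply]),
        pd_mul (dψ.const_mul (-2)).exp dg', pd_comp_base dg]
      have hE : HasFDerivAt (fun q => Real.exp (-2 * pull ψ q))
          (Real.exp (-2 * pull ψ q) • ((-2 : ℝ) • fderiv ℝ (pull ψ) (q : Fin 7 → ℝ)))
          (q : Fin 7 → ℝ) := (dψ.hasFDerivAt.const_mul (-2)).exp
      rw [pd, hE.fderiv, pull_apply]
      simp only [smul_apply, smul_eq_mul, dM, pd]
      ring
    rw [hd]
    have hc := Γ3_compatible (h2 _ q.2.1) μ ν σ
    simp only [desc_leaf h2 (hΓ _ _ _), hg', mul_assoc, ← Finset.mul_sum]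
    have hAσ := hA q σ
    -- The term `-2 dψ` from the rescaled metric is absorbed by `A = r - dψ`.
    linear_combination Real.exp (-2 * ψ (leaf F U q)) * hc
      + 2 * Real.exp (-2 * ψ (leaf F U q)) * g3 F (base q) μ ν * hAσ
  · have hric : ∀ μ ν, ricci (fun μ ν σ => desc F (Γ3 F μ ν σ)) q μ ν = Ric3 F (base q) μ ν := by
      intro μ ν
      simp only [ricci, curvature, Ric3, Rm, dΓM, ΓM, dM_desc h2 (hΓ _ _ _),
        desc_leaf h2 (hΓ _ _ _), Matrix.of_apply, Matrix.sub_apply, Matrix.add_apply,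
        Matrix.mul_apply, Finset.sum_sub_distrib, Finset.sum_add_distrib]
      ring
    obtain ⟨c, hc⟩ := exists_ricci_eq hF hDF h2 hM hK q.2.1
    have hR : ∀ μ ν, Ric3 F (base q) μ ν + Ric3 F (base q) ν μ
        = c * Real.exp (2 * ψ (leaf F U q)) * g.coeff (leaf F U q) μ ν := by
      intro μ ν
      rw [hc, hg q, Matrix.smul_apply, smul_eq_mul, mul_assoc]
    have hdet : (g.coeff (leaf F U q)).det ≠ 0 := by
      intro h0
      have := det_g3 (h2 _ q.2.1)
      rw [hg q, Matrix.det_smul, h0, mul_zero] at this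
      norm_num at this
    have hsc := sum_inv_mul_of_add_transpose (fun i j => by rw [hg', hg', g3_symm]) hdet hR
    simp only [scalarCurvature, hric, hsc, hR]
    ring

end Descent

end PDEWeyl

theorem mainTheorem4
    (U : TopologicalSpace.Opens (Fin 4 → ℝ)) (F : (Fin 4 → ℝ) → ℝ)
    (hF : ContDiffOn ℝ ∞ F (U : Set (Fin 4 → ℝ)))
    (hDF : ∀ b ∈ U, PDEWeyl.DF F b = 0)
    (hFpp : ∀ b ∈ U, PDEWeyl.Fp F 2 b ≠ 0) :
    -- the explicit formula, the signature and the degeneracy of the form on `P₇`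
    (∀ q ∈ PDEWeyl.P7 U,
      (∀ v : Fin 7 → ℝ, PDEWeyl.gTilde F q v v =
        q 5 ^ 2 / (9 * PDEWeyl.Fp F 2 (PDEWeyl.base q) ^ 2) *
          ((3 * PDEWeyl.Fp F 2 (PDEWeyl.base q) *
                (v 0 + PDEWeyl.Fp F 1 (PDEWeyl.base q) * v 1)
              - PDEWeyl.Fp F 3 (PDEWeyl.base q) *
                (v 2 - q 3 * v 0 - F (PDEWeyl.base q) * v 1)) ^ 2
            + (v 2 - q 3 * v 0 - F (PDEWeyl.base q) * v 1) *
              (18 * PDEWeyl.Fp F 2 (PDEWeyl.base q) ^ 3 * v 1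
                + (4 * PDEWeyl.Fp F 3 (PDEWeyl.base q) ^ 2
                    - 3 * PDEWeyl.Fp F 2 (PDEWeyl.base q) * PDEWeyl.Fp F 4 (PDEWeyl.base q)) *
                  (v 2 - q 3 * v 0 - F (PDEWeyl.base q) * v 1)))) ∧
      PDEWeyl.HasSignature (PDEWeyl.gTilde F q) ![1, 1, -1, 0, 0, 0, 0] ∧
      (∀ v : Fin 7 → ℝ, v ∈ PDEWeyl.D4 F q ↔ ∀ w, PDEWeyl.gTilde F q v w = 0) ∧
      Module.finrank ℝ (PDEWeyl.D4 F q) = 4) ∧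
    PDEWeyl.D4Integrable F U ∧
    -- `(x, y, z)` are local coordinates on the leaf space
    (∃ χ : PDEWeyl.LeafSpace F U → (Fin 3 → ℝ), IsLocalHomeomorph χ ∧
      ∀ q : PDEWeyl.P7 U, χ (PDEWeyl.leaf F U q) = PDEWeyl.xyz q) ∧
    -- descent of the conformal class
    ((∃ c : PDEWeyl.ConformalClass F U, PDEWeyl.DescendsToConformal c) ↔
      ∀ b ∈ U, PDEWeyl.Monge F b = 0) ∧
    -- local representatives in terms of `dx`, `dy`, `dz`, with coefficients depending on `(x, y, z)`
    ((∀ b ∈ U, PDEWeyl.Monge F b = 0) →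
      ∀ q₀ ∈ PDEWeyl.P7 U, ∃ W : Set (Fin 7 → ℝ), IsOpen W ∧ q₀ ∈ W ∧ W ⊆ PDEWeyl.P7 U ∧
        ∃ (G : Fin 3 → Fin 3 → (Fin 3 → ℝ) → ℝ) (φ : (Fin 7 → ℝ) → ℝ),
          (∀ i j, ContDiffOn ℝ ∞ (G i j) (PDEWeyl.xyz '' W)) ∧ ContDiffOn ℝ ∞ φ W ∧
          ∀ q ∈ W, ∀ v w : Fin 7 → ℝ, PDEWeyl.gTilde F q v w =
            Real.exp (2 * φ q) *
              ∑ i, ∑ j, G i j (PDEWeyl.xyz q) * PDEWeyl.xyz v i * PDEWeyl.xyz w j) ∧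
    -- descent of the 1-form modulo gradients
    ((∃ a : PDEWeyl.OneFormModGradients F U, PDEWeyl.DescendsToOneForm a) ↔
      ∀ b ∈ U, PDEWeyl.KInv F b = 0) ∧
    -- descent of the pair, and the Einstein-Weyl equations
    ((∃ s : PDEWeyl.WeylStructure F U, PDEWeyl.DescendsToWeyl s) ↔
      (∀ b ∈ U, PDEWeyl.Monge F b = 0) ∧ (∀ b ∈ U, PDEWeyl.KInv F b = 0)) ∧
    (∀ s : PDEWeyl.WeylStructure F U, PDEWeyl.DescendsToWeyl s → PDEWeyl.IsEinsteinWeyl s) := by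
  refine ⟨fun q hq => ⟨fun v => ?_, PDEWeyl.hasSignature_gTilde hFpp hq,
    PDEWeyl.mem_D4_iff_radical hFpp hq, PDEWeyl.finrank_D4 hFpp hq⟩,
    PDEWeyl.d4Integrable hFpp, PDEWeyl.exists_localHomeomorph hFpp,
    PDEWeyl.exists_descendsToConformal_iff hF hFpp,
    PDEWeyl.exists_local_representative hF hFpp,
    PDEWeyl.exists_descendsToOneForm_iff hF hFpp,
    PDEWeyl.exists_descendsToWeyl_iff hF hFpp,
    fun s hs => PDEWeyl.DescendsToWeyl.isEinsteinWeyl hF hFpp hDF hs⟩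
  have hne := hFpp _ hq.1
  have hp : PDEWeyl.base q 3 = q 3 := rfl
  rw [PDEWeyl.gTilde_eq hFpp hq]
  simp only [PDEWeyl.bil, PDEWeyl.G3, Fin.sum_univ_three, Matrix.of_apply]
  simp [PDEWeyl.xyz, PDEWeyl.cα, PDEWeyl.cω, PDEWeyl.cy, hp]
  field_simp
  ring
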